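/- **Setting.** Let $1\le d\le 3$, $m=d+2$, and let $\Omega\subset\mathbb{R}^d$ be open. A calorically perfect Newtonian gas obeying Fourier's law is given by constants $\gamma>1$, $c_v>0$, $Pr>0$, $s_0\in\mathbb{R}$ and shear and bulk viscosities $\mu,\beta\ge 0$ (continuous functions of the physical state, e.g. constants). For $u=(\rho,\rho V,\rho E)\in\mathbb{R}^m$ put $p=(\gamma-1)(\rho E-\rho|V|^2/2)$, $T=p/(\rho(\gamma-1)c_v)$, $\kappa=\gamma c_v\mu/Pr$; $u$ is physical ($u\in X_u$) if $\rho>0$ and $p>0$. The inviscid and viscous fluxes are $$F_{\cdot j}(u)=\begin{pmatrix}\rho V_j\\ \rho V_iV_j+\delta_{ij}p\\ V_j(\rho E+p)\end{pmatrix},\qquad G_{\cdot j}(u,\nabla u)=-\begin{pmatrix}0\\ \tau_{ij}\\ V_i\tau_{ij}-f_j\end{pmatrix},$$ $\tau_{ij}=\mu(\partial_jV_i+\partial_iV_j-\tfrac23\,\partial_kV_k\,\delta_{ij})+\beta\,\partial_kV_k\,\delta_{ij}$, $f_j=-\kappa\,\partial_jT$, and $G_{ij}(u,\nabla u)=-[\mathcal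 K_{jk}(u)]_{is}\,\partial_k u_s$. With $s=\log(p/\rho^\gamma)-s_0$, $H=-\rho s$, $\mathcal F=HV$, the entropy variables are $$v(u)=(\gamma-1)\Big(\tfrac{-s}{\gamma-1}+\tfrac{\gamma+1}{\gamma-1}-\tfrac{\rho E}{p},\ \tfrac{\rho V}{p},\ -\tfrac{\rho}{p}\Big),$$ $X_v=v(X_u)$, and $u(v)$ is the inverse map on $X_v$. Write $\tilde A_0=\partial u/\partial v$, $\tilde A_n(v;n)=\big(\tfrac{\partial F}{\partial u}\cdot n\big)(u(v))\,\tilde A_0(v)$, $F(v)=F(u(v))$, $F_n(v)=F(v)\cdot n$, $\mathcal F_n(v)=\mathcal F(u(v))\cdot n$, $G(v,q)=G(u(v),\tilde A_0(v)q)$, and let $\tilde{\mathcal K}(v)\in\mathbb{R}^{md\times md}$ be the matrix with blocks $\tilde{\mathcal K}_{jk}(v)=\mathcal K_{jk}(u(v))\tilde A_0(v)$, $j,k=1,\dots,d$. For $v_1,v_2\in X_v$ let $\tilde v(\theta;v_1,v_2)=v_1+\theta(v_2-v_1)$ (a path in $X_v$, which is convex) and $$\Sigma(v_1,v_2;n)=\int_0^1(1-\theta)\big(\tilde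 A_n(\tilde v(\theta;v_1,v_2);n)-\tilde A_n(\tilde v(\theta;v_2,v_1);n)\big)\,d\theta .$$ **Scheme.** Let $\mathcal T_h$ be a finite non-curved mesh partitioning $\Omega$: the elements $K$ are nonsingular affine images of a reference polytope, with disjoint interiors; their boundaries consist of faces $F$, which are affine images of a reference polytope of dimension $d-1$; each face either lies on $\partial\Omega$ and belongs to one element, or is $\partial K^+\cap\partial K^-$ for the two elements it belongs to. Let $n$ be the outward unit normal of the elements, let $\int_{\partial\mathcal T_h}=\sum_K\int_{\partial K}$, and let $k\ge 0$. $\mathcal V_h^k$, $\mathcal Q_h^k$ are the spaces of $\mathbb{R}^m$-, resp. $\mathbb{R}^{m\times d}$-valued elementwise polynomials of degree at most $k$; $\mathcal M_h^k$ is the space of $\mathbb{R}^m$-valued facewise polynomials of degree at most $k$ on the skeleton that are continuous on the union of a given set of faces; $\Pi$ is the $L^2$ projection onto $\mathcal Q_h^k$. Let $\sigma(\cdot,\cdot;n)\in\mathbb{R}^{m\times m}$ be any stabilization matrix, $\hat f_h=\frac12(F(\hat v_h)+F(v_h))\cdot n+\frac12\sigma(\hat v_h,v_h;n)(v_h-\hat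 v_h)$, $\hat g_h$ any viscous numerical flux and $\hat b_h$ any boundary condition term (both may depend on the whole discrete state, $\hat b_h$ also on a boundary state $v^{\partial\Omega}$). Let $(q_h(t),v_h(t),\hat v_h(t))\in\mathcal Q_h^k\times\mathcal V_h^k\times\mathcal M_h^k$, with $v_h$ differentiable in $t$, satisfy for all $t\in(0,t_f)$ and all $(r,w,\mu)\in\mathcal Q_h^k\times\mathcal V_h^k\times\mathcal M_h^k$ $$(q_h,r)_{\mathcal T_h}+(v_h,\nabla\cdot r)_{\mathcal T_h}-\langle\hat v_h,r\cdot n\rangle_{\partial\mathcal T_h}=0,$$ $$\Big(\frac{\partial u(v_h)}{\partial t},w\Big)_{\mathcal T_h}-\big(F(v_h)+G(v_h,q_h),\nabla w\big)_{\mathcal T_h}+\langle\hat f_h+\hat g_h,w\rangle_{\partial\mathcal T_h}=0,$$ $$\langle\hat f_h+\hat g_h,\mu\rangle_{\partial\mathcal T_h\setminus\partial\Omega}+\langle\hat b_h,\mu\rangle_{\partial\Omega}=0,$$ with arbitrary initial data. Assume that the solution is physical, i.e. $v_h(t)$ (on the closed elements) and $\hat v_h(t)$ take values in $X_v$ pointwise,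 and that $\hat f_h,\hat g_h,\hat b_h$ are integrable on the faces. **Proposition.** For every $v\in X_v$ the matrix $\tilde{\mathcal K}(v)$ is symmetric positive semidefinite. For every $t\in(0,t_f)$ the total generalized entropy $\int_{\mathcal T_h}H(u(v_h))$ is differentiable at $t$ and $$\begin{aligned}\frac{d}{dt}\int_{\mathcal T_h}H(u(v_h))&+\int_{\mathcal T_h}q_h^{t}\,\tilde{\mathcal K}(v_h)\,q_h+\frac12\int_{\partial\mathcal T_h}(v_h-\hat v_h)^t\big[\sigma(\hat v_h,v_h;n)-\Sigma(\hat v_h,v_h;n)\big](v_h-\hat v_h)\\&+\int_{\partial\mathcal T_h}(v_h-\hat v_h)^t\big[\hat g_h-\Pi(G(v_h,q_h))\cdot n\big]+\mathcal B_{\partial\Omega}=0,\end{aligned}$$ where $$\mathcal B_{\partial\Omega}=\int_{\partial\Omega}\mathcal F_n(\hat v_h)-\int_{\partial\Omega}\hat v_h^t F_n(\hat v_h)+\int_{\partial\Omega}\hat v_h^t\big(\hat f_h+\hat g_h-\hat b_h\big).$$ -/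

import Mathlib

open MeasureTheory

namespace HDG

/-! ### States, gases and fluxes -/

/-- Physical space `ℝᵈ` with the Euclidean norm. -/
abbrev E (d : ℕ) := EuclideanSpace ℝ (Fin d)

/-- Indices of the `m = d + 2` components: mass, the `d` momentum components, energy. -/
abbrev Idx (d : ℕ) := Unit ⊕ Fin d ⊕ Unit

/-- States, i.e. vectors of `ℝᵐ`. -/
abbrev State (d : ℕ) := Idx d → ℝ

/-- `m × d` arrays: row index a component, column index a space direction. -/
abbrev Grad (d : ℕ) := Idx d → Fin d → ℝ

/-- The state with given mass, momentum and energy components. -/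
def mkState {d : ℕ} (a : ℝ) (b : Fin d → ℝ) (c : ℝ) : State d :=
  Sum.elim (fun _ => a) (Sum.elim b (fun _ => c))

/-- The density `ρ` of `u = (ρ, ρ V, ρ E)`. -/
def density {d : ℕ} (u : State d) : ℝ := u (Sum.inl ())

/-- The momentum `ρ V`. -/
def momentum {d : ℕ} (u : State d) (j : Fin d) : ℝ := u (Sum.inr (Sum.inl j))

/-- The total energy `ρ E`. -/
def energy {d : ℕ} (u : State d) : ℝ := u (Sum.inr (Sum.inr ()))

/-- The velocity `V`. -/
noncomputable def velocity {d : ℕ} (u : State d) (j : Fin d) : ℝ := momentum u j / density u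

/-- The pressure of a calorically perfect gas, `p = (γ - 1) (ρ E - ρ |V|² / 2)`. -/
noncomputable def pressure {d : ℕ} (γ : ℝ) (u : State d) : ℝ :=
  (γ - 1) * (energy u - density u * (∑ j, velocity u j ^ 2) / 2)

/-- The set `X_u` of physical states: positive density and pressure. -/
def physical (d : ℕ) (γ : ℝ) : Set (State d) := {u | 0 < density u ∧ 0 < pressure γ u}

/-- The data of a calorically perfect Newtonian gas obeying Fourier's law: ratio of specific heats
`γ`, baseline entropy `s₀`, specific heat at constant volume `cv`, Prandtl number `Pr`, shear
viscosity `μ` and bulk viscosity `β` (which may depend on the state). -/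
structure Gas (d : ℕ) where
  γ : ℝ
  s₀ : ℝ
  cv : ℝ
  Pr : ℝ
  μ : State d → ℝ
  β : State d → ℝ
  one_lt_γ : 1 < γ
  cv_pos : 0 < cv
  Pr_pos : 0 < Pr
  μ_nonneg : ∀ u ∈ physical d γ, 0 ≤ μ u
  β_nonneg : ∀ u ∈ physical d γ, 0 ≤ β u
  μ_cont : ContinuousOn μ (physical d γ)
  β_cont : ContinuousOn β (physical d γ)

section fluxes

variable {d : ℕ} (g : Gas d)

/-- The inviscid flux `F(u)`. -/
noncomputable def invFlux (u : State d) : Grad d := fun i j =>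
  mkState (density u * velocity u j)
    (fun l => density u * velocity u l * velocity u j + if l = j then pressure g.γ u else 0)
    (velocity u j * (energy u + pressure g.γ u)) i

/-- The temperature, from `p = ρ (c_p - c_v) T` and `c_p = γ c_v`. -/
noncomputable def temperature (u : State d) : ℝ :=
  pressure g.γ u / (density u * ((g.γ - 1) * g.cv))

/-- The thermal conductivity `κ = c_p μ / Pr`. -/
noncomputable def conductivity (u : State d) : ℝ := g.γ * g.cv * g.μ u / g.Pr

/-- `∂V_i / ∂x_j` computed by the chain rule from the state `u` and its gradient `du`. -/
noncomputable def gradVel (u : State d) (du : Grad d) (i j : Fin d) : ℝ :=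
  fderiv ℝ (fun w : State d => velocity w i) u (fun l => du l j)

/-- `∂T / ∂x_j` computed by the chain rule from the state `u` and its gradient `du`. -/
noncomputable def gradTemp (u : State d) (du : Grad d) (j : Fin d) : ℝ :=
  fderiv ℝ (temperature g) u (fun l => du l j)

/-- The viscous stress tensor `τ`. -/
noncomputable def stress (u : State d) (du : Grad d) (i j : Fin d) : ℝ :=
  g.μ u * (gradVel u du i j + gradVel u du j i
      - 2 / 3 * (∑ k, gradVel u du k k) * (if i = j then 1 else 0))
    + g.β u * (∑ k, gradVel u du k k) * (if i = j then 1 else 0)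

/-- The heat flux `f`. -/
noncomputable def heatFlux (u : State d) (du : Grad d) (j : Fin d) : ℝ :=
  -(conductivity g u * gradTemp g u du j)

/-- The viscous flux `G(u, ∇u)`. -/
noncomputable def viscFlux (u : State d) (du : Grad d) : Grad d := fun i j =>
  -mkState 0 (fun l => stress g u du l j)
    (∑ l, velocity u l * stress g u du l j - heatFlux g u du j) i

/-- The matrices `𝒦_jk(u)` representing the viscous flux, which is linear in `∇u`:
`G_ij(u, ∇u) = - [𝒦_jk(u)]_is ∂u_s/∂x_k`. -/
noncomputable def viscMat (u : State d) (j k : Fin d) : Matrix (Idx d) (Idx d) ℝ :=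
  Matrix.of fun i s =>
    -viscFlux g u (fun s' k' => if s' = s ∧ k' = k then 1 else 0) i j

/-! ### Entropy and entropy variables -/

/-- The non-dimensional thermodynamic entropy `s = log (p / ρ^γ) - s₀`. -/
noncomputable def thermoEntropy (u : State d) : ℝ :=
  Real.log (pressure g.γ u / density u ^ g.γ) - g.s₀

/-- The generalized entropy `H = - ρ s`. -/
noncomputable def entropy (u : State d) : ℝ := -(density u * thermoEntropy g u)

/-- The entropy flux `𝓕 = - ρ s V`. -/
noncomputable def entropyFlux (u : State d) (j : Fin d) : ℝ := entropy g u * velocity u j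

/-- The entropy variables `v(u)`. -/
noncomputable def entropyVars (u : State d) : State d :=
  (g.γ - 1) • mkState
    (-thermoEntropy g u / (g.γ - 1) + (g.γ + 1) / (g.γ - 1) - energy u / pressure g.γ u)
    (fun j => density u * velocity u j / pressure g.γ u)
    (-(density u / pressure g.γ u))

/-- The physical states in entropy variables, `X_v = v(X_u)`. -/
def physicalV : Set (State d) := entropyVars g '' physical d g.γ

/-- The inverse mapping `u(v)`, defined on `X_v`. -/
noncomputable def consVars : State d → State d :=
  Function.invFunOn (entropyVars g) (physical d g.γ)

/-- `Ã₀(v) = ∂u/∂v`. -/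
noncomputable def A0 (v : State d) : Matrix (Idx d) (Idx d) ℝ :=
  Matrix.of fun i s => fderiv ℝ (consVars g) v (Pi.single s 1) i

/-- The normal flux `F_n(v) = F(u(v)) · n`. -/
noncomputable def invFluxN (n : E d) (v : State d) : State d := fun i =>
  ∑ j, invFlux g (consVars g v) i j * n j

/-- The normal entropy flux `𝓕_n(v)`. -/
noncomputable def entropyFluxN (n : E d) (v : State d) : ℝ :=
  ∑ j, entropyFlux g (consVars g v) j * n j

/-- `A_n(u) = (∂F/∂u) · n`. -/
noncomputable def An (n : E d) (u : State d) : Matrix (Idx d) (Idx d) ℝ :=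
  Matrix.of fun i s =>
    ∑ j, fderiv ℝ (fun w : State d => invFlux g w i j) u (Pi.single s 1) * n j

/-- `Ã_n(v) = A_n(u(v)) Ã₀(v)`. -/
noncomputable def AnTilde (n : E d) (v : State d) : Matrix (Idx d) (Idx d) ℝ :=
  An g n (consVars g v) * A0 g v

/-- The path `ṽ(θ; v₁, v₂)` from `v₁` to `v₂`: the segment, run through at constant speed. -/
def path (v₁ v₂ : State d) (θ : ℝ) : State d := v₁ + θ • (v₂ - v₁)

/-- The matrix
`Σ(v₁, v₂; n) = ∫₀¹ (1 - θ) (Ã_n(ṽ(θ; v₁, v₂); n) - Ã_n(ṽ(θ; v₂, v₁); n)) dθ`. -/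
noncomputable def Sig (v₁ v₂ : State d) (n : E d) : Matrix (Idx d) (Idx d) ℝ :=
  Matrix.of fun i s => ∫ θ in (0 : ℝ)..1,
    (1 - θ) * (AnTilde g n (path v₁ v₂ θ) i s - AnTilde g n (path v₂ v₁ θ) i s)

/-- The viscous flux in entropy variables, `G(v, q) = G(u(v), (∂u/∂v) q)`. -/
noncomputable def viscFluxV (v : State d) (q : Grad d) : Grad d :=
  viscFlux g (consVars g v) (fun l k => ∑ s, A0 g v l s * q s k)

/-- The `md × md` matrix `K̃(v)` whose `(j, k)` block is `K̃_jk(v) = 𝒦_jk(u(v)) Ã₀(v)`. -/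
noncomputable def Ktilde (v : State d) : Matrix (Idx d × Fin d) (Idx d × Fin d) ℝ :=
  Matrix.of fun a b => (viscMat g (consVars g v) a.2 b.2 * A0 g v) a.1 b.1

/-- The inviscid numerical flux
`f̂ = (F(v̂) + F(v)) · n / 2 + σ(v̂, v; n) (v - v̂) / 2`. -/
noncomputable def numFlux (σ : State d → State d → E d → Matrix (Idx d) (Idx d) ℝ)
    (n : E d) (vh v : State d) : State d :=
  (1 / 2 : ℝ) • (invFluxN g n vh + invFluxN g n v)
    + (1 / 2 : ℝ) • Matrix.mulVec (σ vh v n) (v - vh)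

end fluxes

/-! ### Meshes -/

/-- A non-curved (`p = 1`) mesh partitioning `Ω`. Elements are images of one reference polytope
under nonsingular affine maps `ψ`, faces are images of one reference polytope of dimension `d - 1`
under injective affine maps `φ`. The boundary of every element consists of faces. A face which lies
on `∂Ω` (a boundary face) belongs to exactly one element; every other face (an interior face) is the
common boundary `∂K⁺ ∩ ∂K⁻` of the exactly two elements it belongs to. -/
structure Mesh (d : ℕ) (Ω : Set (E d)) (ιK ιF : Type*) where
  Kvert : Finset (E d)
  Fvert : Finset (E (d - 1))
  Kref_solid : (interior (convexHull ℝ (Kvert : Set (E d)))).Nonempty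
  Fref_solid : (interior (convexHull ℝ (Fvert : Set (E (d - 1))))).Nonempty
  ψ : ιK → (E d ≃ᵃ[ℝ] E d)
  φ : ιF → (E (d - 1) →ᵃ[ℝ] E d)
  φ_injective : ∀ F, Function.Injective (φ F)
  elem : ιK → Set (E d)
  face : ιF → Set (E d)
  elem_eq : ∀ K, elem K = ψ K '' convexHull ℝ (Kvert : Set (E d))
  face_eq : ∀ F, face F = φ F '' convexHull ℝ (Fvert : Set (E (d - 1)))
  disjoint_elem : ∀ K K', K ≠ K' → Disjoint (interior (elem K)) (interior (elem K'))
  iUnion_elem : ⋃ K, elem K = closure Ω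
  face_inter_null : ∀ F F', F ≠ F' → μHE[d - 1] (face F ∩ face F') = 0
  frontier_elem : ∀ K, frontier (elem K) ⊆ ⋃ F ∈ {F | face F ⊆ frontier (elem K)}, face F
  frontier_domain : frontier Ω = ⋃ F ∈ {F | face F ⊆ frontier Ω}, face F
  boundary_face : ∀ F, face F ⊆ frontier Ω → ∃! K, face F ⊆ frontier (elem K)
  interior_face : ∀ F, ¬ face F ⊆ frontier Ω → ∃ K₁ K₂, K₁ ≠ K₂ ∧
    face F = frontier (elem K₁) ∩ frontier (elem K₂) ∧
    ∀ K, face F ⊆ frontier (elem K) → K = K₁ ∨ K = K₂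

/-- The unit outward normal of a convex solid `K` on a flat piece `F` of its boundary. -/
noncomputable def outwardNormal {d : ℕ} (K F : Set (E d)) : E d :=
  Classical.epsilon fun n : E d => ‖n‖ = 1 ∧ ∀ x ∈ K, ∀ y ∈ F, inner ℝ n (x - y) ≤ 0

/-- Broken vector fields on `𝒯_h`: one function for each element. Only the values on the (closed)
element matter, the values on its boundary being the trace from inside. -/
abbrev VField (ιK : Type*) (d : ℕ) := ιK → E d → State d

/-- Broken `m × d` fields on `𝒯_h`. -/
abbrev QField (ιK : Type*) (d : ℕ) := ιK → E d → Grad d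

/-- Fields on the skeleton `ℰ_h`: one function for each face, only its values there matter. -/
abbrev MField (ιF : Type*) (d : ℕ) := ιF → E d → State d

/-- The function on the set `S` is (the restriction of) a polynomial of degree at most `k`. -/
def IsPolyOn {n : ℕ} (k : ℕ) (S : Set (E n)) (f : E n → ℝ) : Prop :=
  ∃ P : MvPolynomial (Fin n) ℝ, P.totalDegree ≤ k ∧
    ∀ x ∈ S, f x = MvPolynomial.eval (fun j => x j) P

namespace Mesh

variable {d : ℕ} {Ω : Set (E d)} {ιK ιF : Type*} (M : Mesh d Ω ιK ιF)

/-- The reference element. -/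
def Kref : Set (E d) := convexHull ℝ (M.Kvert : Set (E d))

/-- The reference face. -/
def Fref : Set (E (d - 1)) := convexHull ℝ (M.Fvert : Set (E (d - 1)))

/-- The unit normal on the face `F` of the element `K`, pointing outwards from `K`. -/
noncomputable def normal (K : ιK) (F : ιF) : E d := outwardNormal (M.elem K) (M.face F)

/-- The space `𝒬_h^k`. -/
def Qspace (k : ℕ) : Set (QField ιK d) :=
  {r | ∀ K i j, IsPolyOn k M.Kref (fun x => r K (M.ψ K x) i j)}

/-- The space `𝒱_h^k`. -/
def Vspace (k : ℕ) : Set (VField ιK d) :=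
  {w | ∀ K i, IsPolyOn k M.Kref (fun x => w K (M.ψ K x) i)}

/-- The space `ℳ_h^k`: polynomials on each face, continuous on the part `EE` of the skeleton. -/
def Mspace (k : ℕ) (EE : Set ιF) : Set (MField ιF d) :=
  {μ | (∀ F i, IsPolyOn k M.Fref (fun x => μ F (M.φ F x) i)) ∧
    ∃ c : E d → State d, ContinuousOn c (⋃ F ∈ EE, M.face F) ∧
      ∀ F ∈ EE, ∀ x ∈ M.face F, μ F x = c x}

/-- The integral of `f` over the face `F` with respect to surface measure. -/
noncomputable def faceInt (F : ιF) (f : E d → ℝ) : ℝ := ∫ x in M.face F, f x ∂μHE[d - 1]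

section integrals

variable [Fintype ιK] [Fintype ιF]

/-- `∫_{𝒯_h} f`. -/
noncomputable def vol (f : ιK → E d → ℝ) : ℝ := ∑ K, ∫ x in M.elem K, f K x

open Classical in
/-- `∫_{∂𝒯_h} f`; interior faces are visited twice. -/
noncomputable def bdry (f : ιK → ιF → E d → ℝ) : ℝ :=
  ∑ K, ∑ F with M.face F ⊆ frontier (M.elem K), M.faceInt F (f K F)

open Classical in
/-- `∫_{∂𝒯_h \ ∂Ω} f`. -/
noncomputable def bdryInterior (f : ιK → ιF → E d → ℝ) : ℝ :=
  ∑ K, ∑ F with M.face F ⊆ frontier (M.elem K) ∧ ¬ M.face F ⊆ frontier Ω, M.faceInt F (f K F)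

open Classical in
/-- `∫_{∂Ω} f`; every boundary face is visited once, from the element it belongs to. -/
noncomputable def bdryDomain (f : ιK → ιF → E d → ℝ) : ℝ :=
  ∑ K, ∑ F with M.face F ⊆ frontier (M.elem K) ∧ M.face F ⊆ frontier Ω, M.faceInt F (f K F)

/-- `(A, B)_{𝒯_h}` for `m × d` fields. -/
noncomputable def innerQ (A B : QField ιK d) : ℝ :=
  M.vol fun K x => ∑ i, ∑ j, A K x i j * B K x i j

/-- The `L²` projection `Π` onto `𝒬_h^k`. -/
noncomputable def projQ (k : ℕ) (A : QField ιK d) : QField ιK d :=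
  Classical.epsilon fun P => P ∈ M.Qspace k ∧ ∀ r ∈ M.Qspace k, M.innerQ P r = M.innerQ A r

end integrals

end Mesh

/-- The elementwise gradient `∂w_i / ∂x_j`. -/
noncomputable def gradF {ιK : Type*} {d : ℕ} (w : VField ιK d) : QField ιK d := fun K x i j =>
  fderiv ℝ (fun y => w K y i) x (EuclideanSpace.single j 1)

/-- The elementwise divergence `∑_j ∂r_ij / ∂x_j`. -/
noncomputable def divF {ιK : Type*} {d : ℕ} (r : QField ιK d) : VField ιK d := fun K x i =>
  ∑ j, fderiv ℝ (fun y => r K y i j) x (EuclideanSpace.single j 1)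

/-- `r · n`. -/
def dotN {d : ℕ} (r : Grad d) (n : E d) : State d := fun i => ∑ j, r i j * n j

/-! ### The scheme -/

/-- The choices that make up a scheme: the part `EE` of the skeleton on which traces are continuous,
the stabilization matrix `σ`, the viscous numerical flux `ĝ` (a function on element boundaries
that may depend on the whole discrete state `(q_h, v_h, v̂_h)`), the boundary condition term `b̂`
(a function on boundary faces that may depend on the whole discrete state and on the boundary
state), and the boundary state at each time. -/
structure Scheme (d : ℕ) (ιK ιF : Type*) where
  EE : Set ιF
  σ : State d → State d → E d → Matrix (Idx d) (Idx d) ℝ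
  ghat : QField ιK d → VField ιK d → MField ιF d → ιK → ιF → E d → State d
  bhat : MField ιF d → VField ιK d → QField ιK d → (E d → State d) → ιF → E d → State d
  vbd : ℝ → E d → State d

section scheme

variable {d : ℕ} {Ω : Set (E d)} {ιK ιF : Type*} [Fintype ιK] [Fintype ιF]
  (g : Gas d) (M : Mesh d Ω ιK ιF) (S : Scheme d ιK ιF)

/-- The inviscid numerical flux on the face `F` of the element `K`. -/
noncomputable def fhat (v : VField ιK d) (vh : MField ιF d) (K : ιK) (F : ιF) (x : E d) : State d :=
  numFlux g S.σ (M.normal K F) (vh F x) (v K x)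

/-- `(q_h, v_h, v̂_h)` solves the semi-discrete entropy-variable hybridized DG equations with
polynomial degree `k` on the time interval `(0, tf)`. -/
structure IsSolution (k : ℕ) (tf : ℝ) (q : ℝ → QField ιK d) (v : ℝ → VField ιK d)
    (vh : ℝ → MField ιF d) : Prop where
  q_mem : ∀ t ∈ Set.Ioo 0 tf, q t ∈ M.Qspace k
  v_mem : ∀ t ∈ Set.Ioo 0 tf, v t ∈ M.Vspace k
  vh_mem : ∀ t ∈ Set.Ioo 0 tf, vh t ∈ M.Mspace k S.EE
  differentiable_time : ∀ t ∈ Set.Ioo 0 tf, ∀ K, ∀ x ∈ M.elem K,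
    DifferentiableAt ℝ (fun s => v s K x) t
  gradient_eq : ∀ t ∈ Set.Ioo 0 tf, ∀ r ∈ M.Qspace k,
    M.innerQ (q t) r + M.vol (fun K x => v t K x ⬝ᵥ divF r K x)
      - M.bdry (fun K F x => vh t F x ⬝ᵥ dotN (r K x) (M.normal K F)) = 0
  conservation_eq : ∀ t ∈ Set.Ioo 0 tf, ∀ w ∈ M.Vspace k,
    M.vol (fun K x => deriv (fun s => consVars g (v s K x)) t ⬝ᵥ w K x)
      - M.innerQ (fun K x => invFlux g (consVars g (v t K x)) + viscFluxV g (v t K x) (q t K x))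
          (gradF w)
      + M.bdry (fun K F x =>
          (fhat g M S (v t) (vh t) K F x + S.ghat (q t) (v t) (vh t) K F x) ⬝ᵥ w K x) = 0
  flux_eq : ∀ t ∈ Set.Ioo 0 tf, ∀ μ ∈ M.Mspace k S.EE,
    M.bdryInterior (fun K F x =>
        (fhat g M S (v t) (vh t) K F x + S.ghat (q t) (v t) (vh t) K F x) ⬝ᵥ μ F x)
      + M.bdryDomain (fun _ F x => S.bhat (vh t) (v t) (q t) (S.vbd t) F x ⬝ᵥ μ F x) = 0

/-- The discrete solution is physical: `v_h` and `v̂_h` take values in `X_v`. -/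
def IsPhysical (tf : ℝ) (v : ℝ → VField ιK d) (vh : ℝ → MField ιF d) : Prop :=
  ∀ t ∈ Set.Ioo 0 tf, (∀ K, ∀ x ∈ M.elem K, v t K x ∈ physicalV g) ∧
    ∀ F, ∀ x ∈ M.face F, vh t F x ∈ physicalV g

/-- The numerical fluxes `f̂_h`, `ĝ_h`, `b̂_h` are integrable along the discrete solution, so that
the face integrals in the scheme make sense. -/
def FluxesIntegrable (tf : ℝ) (q : ℝ → QField ιK d) (v : ℝ → VField ιK d)
    (vh : ℝ → MField ιF d) : Prop :=
  ∀ t ∈ Set.Ioo 0 tf, ∀ i,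
    (∀ K F, M.face F ⊆ frontier (M.elem K) →
      IntegrableOn (fun x => fhat g M S (v t) (vh t) K F x i) (M.face F) μHE[d - 1] ∧
      IntegrableOn (fun x => S.ghat (q t) (v t) (vh t) K F x i) (M.face F) μHE[d - 1]) ∧
    ∀ F, M.face F ⊆ frontier Ω →
      IntegrableOn (fun x => S.bhat (vh t) (v t) (q t) (S.vbd t) F x i) (M.face F) μHE[d - 1]

/-- The total generalized entropy `∫_{𝒯_h} H(u(v_h))`. -/
noncomputable def totalEntropy (v : VField ιK d) : ℝ :=
  M.vol fun K x => entropy g (consVars g (v K x))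

/-- `∫_{𝒯_h} q_hᵗ K̃(v_h) q_h`. -/
noncomputable def viscDissipation (q : QField ιK d) (v : VField ιK d) : ℝ :=
  M.vol fun K x => (fun a : Idx d × Fin d => q K x a.1 a.2) ⬝ᵥ
    Matrix.mulVec (Ktilde g (v K x)) (fun a : Idx d × Fin d => q K x a.1 a.2)

/-- `∫_{∂𝒯_h} (v_h - v̂_h)ᵗ [σ(v̂_h, v_h; n) - Σ(v̂_h, v_h; n)] (v_h - v̂_h)`. -/
noncomputable def jumpTerm (v : VField ιK d) (vh : MField ιF d) : ℝ :=
  M.bdry fun K F x => (v K x - vh F x) ⬝ᵥ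
    Matrix.mulVec (S.σ (vh F x) (v K x) (M.normal K F) - Sig g (vh F x) (v K x) (M.normal K F))
      (v K x - vh F x)

/-- `∫_{∂𝒯_h} (v_h - v̂_h)ᵗ [ĝ_h - Π(G(v_h, q_h)) · n]`. -/
noncomputable def viscFaceTerm (k : ℕ) (q : QField ιK d) (v : VField ιK d)
    (vh : MField ιF d) : ℝ :=
  M.bdry fun K F x => (v K x - vh F x) ⬝ᵥ
    (S.ghat q v vh K F x
      - dotN (M.projQ k (fun K' y => viscFluxV g (v K' y) (q K' y)) K x) (M.normal K F))

/-- The boundary term `𝓑_∂Ω`. -/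
noncomputable def boundaryTerm (q : QField ιK d) (v : VField ιK d) (vh : MField ιF d)
    (vbd : E d → State d) : ℝ :=
  M.bdryDomain (fun K F x => entropyFluxN g (M.normal K F) (vh F x))
    - M.bdryDomain (fun K F x => vh F x ⬝ᵥ invFluxN g (M.normal K F) (vh F x))
    + M.bdryDomain (fun K F x => vh F x ⬝ᵥ
        (fhat g M S v vh K F x + S.ghat q v vh K F x - S.bhat vh v q vbd F x))

end scheme

end HDG

/-! The identity comes from testing the three equations with w = v_h, r = Π G(v_h, q_h) and μ =
v̂_h. Four facts turn the result into the entropy balance.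

Time: the entropy variables are ∂H/∂u, so ∂ₜu · v_h is ∂ₜH (`hasDerivAt_entropy`). Since v_h(t) lies
in a space determined by finitely many nodal values, pointwise differentiability in time is uniform
in space and the integral may be differentiated (`hasDerivAt_integral_entropy`).

Inviscid volume term: with ψ_j = v · F_j - 𝓕_j = (γ-1)ρV_j one has ∂ψ_j/∂v = F_j
(`fderiv_fluxPotential`), so F(v_h) : ∇v_h is the divergence of ψ(v_h) and its integral is a face
term (`green_flux`).

Viscous volume term: ∇v_h is elementwise polynomial of degree at most k, hence (G, ∇v_h) = (ΠG,
∇v_h). Green's formula and the gradient equation change this to (q_h, ΠG) = (q_h, G) plus a face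
term in v_h - v̂_h, and -(q_h, G) is the quadratic form of K̃.

Faces: for δ = v_h - v̂_h, integration by parts in θ along the segment gives δᵗΣδ = 2(ψ_n(v_h) -
ψ_n(v̂_h)) - (F_n(v̂_h) + F_n(v_h)) · δ (`dotProduct_Sig`). So Σ is exactly the entropy defect of
the central flux, and σ - Σ remains. The leftover ψ_n(v̂_h) cancels between the two sides of an
interior face, because v̂_h is single valued and the normals are opposite; what survives on ∂Ω is
the boundary term.

For K̃, rewriting the form in terms of the velocity gradient and the energy component of q splits it
into viscous work and heat conduction, both symmetric and nonnegative; d ≤ 3 makes the deviatoric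
part nonnegative (`Ktilde_posSemidef`).

Much of the length goes into the divergence theorem for polytopes with Hausdorff surface measure:
the field is multiplied by smooth ramps, and as their width tends to zero the derivatives
concentrate on the facets (`integral_fderiv_polyhedron`). -/

namespace HDG

open Filter Topology Module

/-! ### Hyperplanes: adapted coordinates, surface measure and null sets. -/

section Hyperplane

variable {V : Type*} [NormedAddCommGroup V] [InnerProductSpace ℝ V]

/-- Orthogonal coordinates adapted to the hyperplane through `p` with normal `n`. -/
def slab (n p : V) (z : (ℝ ∙ n)ᗮ × ℝ) : V := (z.1 : V) + z.2 • n + p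

theorem continuous_slab (n p : V) : Continuous (slab n p) := by
  unfold slab; fun_prop

theorem inner_orthogonal_eq_zero {n : V} (y : (ℝ ∙ n)ᗮ) : inner ℝ n (y : V) = 0 :=
  Submodule.mem_orthogonal_singleton_iff_inner_right.1 y.2

theorem inner_slab_normal {n : V} (hn : ‖n‖ = 1) (c : ℝ) (z : (ℝ ∙ n)ᗮ × ℝ) :
    inner ℝ n (slab n (c • n) z) = c + z.2 := by
  simp [slab, inner_add_right, inner_smul_right, inner_orthogonal_eq_zero, hn]
  ring

theorem slab_injective {n : V} (hn : ‖n‖ = 1) (p : V) : Function.Injective (slab n p) := by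
  intro z w h
  have h1 : (z.1 : V) + z.2 • n = w.1 + w.2 • n := add_right_cancel h
  have h2 : z.2 = w.2 := by
    simpa [inner_add_right, inner_smul_right, inner_orthogonal_eq_zero, hn] using
      congrArg (fun x => inner ℝ n x) h1
  rw [h2] at h1
  exact Prod.ext (Subtype.ext (add_right_cancel h1)) h2

variable [FiniteDimensional ℝ V] [MeasurableSpace V] [BorelSpace V]

/-- `slab` is the composite of a swap, the isometry ℝ ≅ ℝn, the orthogonal decomposition and a
translation, each of which preserves volume. -/
theorem measurePreserving_slab {n : V} (hn : ‖n‖ = 1) (p : V) :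
    MeasurePreserving (slab n p) volume volume := by
  have h1 : MeasurePreserving (Prod.swap : (ℝ ∙ n)ᗮ × ℝ → ℝ × (ℝ ∙ n)ᗮ) volume volume :=
    Measure.measurePreserving_swap
  have h2 : MeasurePreserving (Prod.map (LinearIsometryEquiv.toSpanUnitSingleton n hn) id :
      ℝ × (ℝ ∙ n)ᗮ → (ℝ ∙ n) × (ℝ ∙ n)ᗮ) volume volume :=
    (LinearIsometryEquiv.toSpanUnitSingleton (𝕜 := ℝ) n hn).measurePreserving.prod
      (MeasurePreserving.id _)
  have h3 := WithLp.volume_preserving_toLp (ℝ ∙ n) (ℝ ∙ n)ᗮ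
  have h4 := (ℝ ∙ n).orthogonalDecomposition.symm.measurePreserving
  have h5 := measurePreserving_add_right (volume : Measure V) p
  convert h5.comp (h4.comp (h3.comp (h2.comp h1))) using 1
  ext z
  simp [slab, add_comm]

theorem measurableEmbedding_slab {n : V} (hn : ‖n‖ = 1) (p : V) :
    MeasurableEmbedding (slab n p) :=
  (continuous_slab n p).measurableEmbedding (slab_injective hn p)

omit [FiniteDimensional ℝ V] [MeasurableSpace V] [BorelSpace V] in
theorem range_hyperplane {n : V} (hn : ‖n‖ = 1) (c : ℝ) :
    Set.range (fun y : (ℝ ∙ n)ᗮ => (y : V) + c • n) = {x | inner ℝ n x = c} := by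
  ext x
  constructor
  · rintro ⟨y, rfl⟩
    simp [inner_add_right, inner_smul_right, inner_orthogonal_eq_zero, hn]
  · intro hx
    refine ⟨⟨x - c • n, Submodule.mem_orthogonal_singleton_iff_inner_right.2 ?_⟩, by simp⟩
    simp only [Set.mem_ofPred_eq] at hx
    simp [inner_sub_right, inner_smul_right, hn, hx]

omit [FiniteDimensional ℝ V] [MeasurableSpace V] [BorelSpace V] in
theorem isometry_hyperplane (n : V) (c : ℝ) :
    Isometry (fun y : (ℝ ∙ n)ᗮ => (y : V) + c • n) :=
  (isometry_add_right (c • n)).comp isometry_subtype_coe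

/-- An isometry carries Hausdorff measure to Hausdorff measure on its range, and in its own
dimension the Euclidean Hausdorff measure of nᗮ is Lebesgue measure. Surface integrals thereby
become volume integrals over nᗮ. -/
theorem map_hyperplane {n : V} (hn : ‖n‖ = 1) (c : ℝ) :
    Measure.map (fun y : (ℝ ∙ n)ᗮ => (y : V) + c • n) volume
      = μHE[finrank ℝ V - 1].restrict {x | inner ℝ n x = c} := by
  have hf : finrank ℝ (ℝ ∙ n)ᗮ = finrank ℝ V - 1 := by
    have h := (ℝ ∙ n).finrank_add_finrank_orthogonal
    rw [finrank_span_singleton (by rintro rfl; simp at hn)] at h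
    omega
  rw [← range_hyperplane hn c, ← (isometry_hyperplane n c).map_euclideanHausdorffMeasure, ← hf,
    InnerProductSpace.euclideanHausdorffMeasure_eq_volume]

omit [FiniteDimensional ℝ V] in
theorem measurableSet_hyperplane (n : V) (c : ℝ) : MeasurableSet {x : V | inner ℝ n x = c} :=
  (isClosed_eq (by fun_prop) (by fun_prop)).measurableSet

theorem setIntegral_hyperplane {n : V} (hn : ‖n‖ = 1) (c : ℝ) {K : Set V} (hK : MeasurableSet K)
    (f : V → ℝ) :
    ∫ x in K ∩ {x | inner ℝ n x = c}, f x ∂μHE[finrank ℝ V - 1]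
      = ∫ y : (ℝ ∙ n)ᗮ, K.indicator f (y + c • n) := by
  rw [← Measure.restrict_restrict hK, ← integral_indicator hK, ← map_hyperplane hn c,
    MeasurableEmbedding.integral_map]
  exact (isometry_hyperplane n c).continuous.measurableEmbedding
    (isometry_hyperplane n c).injective

/-- Two hyperplanes with non-proportional unit normals meet in a null set of the first one. -/
theorem volume_hyperplane_slice_eq_zero {n m : V} (hn : ‖n‖ = 1) (hm : ‖m‖ = 1) (h1 : m ≠ n)
    (h2 : m ≠ -n) (a c : ℝ) :
    volume {y : (ℝ ∙ n)ᗮ | inner ℝ m ((y : V) + a • n) = c} = 0 := by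
  by_cases hne : {y : (ℝ ∙ n)ᗮ | inner ℝ m ((y : V) + a • n) = c}.Nonempty
  swap
  · rw [Set.not_nonempty_iff_eq_empty.1 hne, measure_empty]
  obtain ⟨y₀, hy₀⟩ := hne
  let L : (ℝ ∙ n)ᗮ →ₗ[ℝ] ℝ := (innerₛₗ ℝ m) ∘ₗ (ℝ ∙ n)ᗮ.subtype
  -- If ⟪m, ·⟫ vanished on nᗮ, then m would lie in ℝn, and unit length would leave only m = ±n.
  have hL : LinearMap.ker L ≠ ⊤ := by
    intro htop
    have hmem : m ∈ (ℝ ∙ n)ᗮᗮ := by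
      rw [Submodule.mem_orthogonal']
      intro u hu
      have : (⟨u, hu⟩ : (ℝ ∙ n)ᗮ) ∈ LinearMap.ker L := htop ▸ Submodule.mem_top
      simpa [L] using this
    rw [Submodule.orthogonal_orthogonal, Submodule.mem_span_singleton] at hmem
    obtain ⟨a, rfl⟩ := hmem
    rw [norm_smul, hn, mul_one, Real.norm_eq_abs, abs_eq zero_le_one] at hm
    rcases hm with rfl | rfl <;> simp at h1 h2
  have hset : {y : (ℝ ∙ n)ᗮ | inner ℝ m ((y : V) + a • n) = c}
      = AffineSubspace.mk' y₀ (LinearMap.ker L) := by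
    ext y
    simp only [Set.mem_ofPred_eq] at hy₀
    simp only [Set.mem_ofPred_eq, SetLike.mem_coe, AffineSubspace.mem_mk', vsub_eq_sub,
      LinearMap.mem_ker, map_sub, L, LinearMap.comp_apply, Submodule.subtype_apply,
      innerₛₗ_apply_apply]
    rw [inner_add_right] at hy₀ ⊢
    constructor <;> intro h <;> linarith
  rw [hset]
  refine Measure.addHaar_affineSubspace _ _ fun htop => hL ?_
  rw [← AffineSubspace.direction_mk' y₀ (LinearMap.ker L), htop, AffineSubspace.direction_top]

theorem volume_hyperplane_eq_zero {n : V} (hn : ‖n‖ = 1) (c : ℝ) :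
    volume {x : V | inner ℝ n x = c} = 0 := by
  have hset : {x : V | inner ℝ n x = c} = AffineSubspace.mk' (c • n) (LinearMap.ker (innerₛₗ ℝ n)) := by
    ext y
    simp [AffineSubspace.mem_mk', inner_sub_right, inner_smul_right, hn, sub_eq_zero]
  rw [hset]
  refine Measure.addHaar_affineSubspace _ _ fun htop => ?_
  have : LinearMap.ker (innerₛₗ ℝ n) = ⊤ := by
    rw [← AffineSubspace.direction_mk' (c • n) (LinearMap.ker (innerₛₗ ℝ n)), htop,
      AffineSubspace.direction_top]
  have h : n ∈ LinearMap.ker (innerₛₗ ℝ n) := this ▸ Submodule.mem_top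
  simp [hn] at h

end Hyperplane

end HDG

namespace HDG

open Filter Topology Module

/-! ### The smooth ramp and its derivative. -/

section Ramp

/-- Such a point is a global minimum of the ramp; this includes x = 0. -/
theorem deriv_smoothTransition_of_nonpos {x : ℝ} (hx : x ≤ 0) :
    deriv Real.smoothTransition x = 0 := by
  refine IsLocalMin.deriv_eq_zero (Eventually.of_forall fun y => ?_)
  rw [Real.smoothTransition.zero_of_nonpos hx]
  exact Real.smoothTransition.nonneg y

theorem deriv_smoothTransition_of_one_le {x : ℝ} (hx : 1 ≤ x) :
    deriv Real.smoothTransition x = 0 := by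
  refine IsLocalMax.deriv_eq_zero (Eventually.of_forall fun y => ?_)
  rw [Real.smoothTransition.one_of_one_le hx]
  exact Real.smoothTransition.le_one y

theorem continuous_deriv_smoothTransition : Continuous (deriv Real.smoothTransition) :=
  (Real.smoothTransition.contDiff (n := 1)).continuous_deriv le_rfl

theorem hasDerivAt_smoothTransition (x : ℝ) :
    HasDerivAt Real.smoothTransition (deriv Real.smoothTransition x) x :=
  ((Real.smoothTransition.contDiff (n := 1)).differentiable one_ne_zero x).hasDerivAt

theorem integrable_deriv_smoothTransition : Integrable (deriv Real.smoothTransition) := by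
  refine continuous_deriv_smoothTransition.integrable_of_hasCompactSupport
    (HasCompactSupport.intro (isCompact_Icc (a := (0 : ℝ)) (b := 1)) fun x hx => ?_)
  by_cases h : x ≤ 0
  · exact deriv_smoothTransition_of_nonpos h
  · refine deriv_smoothTransition_of_one_le ?_
    by_contra h1
    exact hx ⟨le_of_not_ge h, le_of_not_ge h1⟩

/-- The derivative is a kernel of mass one living on [0, 1]; rescaled by ε it becomes the
approximate delta that produces facet integrals. -/
theorem integral_deriv_smoothTransition : ∫ x, deriv Real.smoothTransition x = 1 := by
  rw [integral_of_hasDerivAt_of_tendsto (m := 0) (n := 1) hasDerivAt_smoothTransition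
    integrable_deriv_smoothTransition, sub_zero]
  · exact tendsto_const_nhds.congr' ((eventually_le_atBot 0).mono fun x hx =>
      (Real.smoothTransition.zero_of_nonpos hx).symm)
  · exact tendsto_const_nhds.congr' ((eventually_ge_atTop 1).mono fun x hx =>
      (Real.smoothTransition.one_of_one_le hx).symm)

end Ramp

/-! ### The divergence theorem on a compact polyhedron. -/

section Polyhedron

variable {V : Type*} [NormedAddCommGroup V] [InnerProductSpace ℝ V]
  {ι : Type*}

/-- The intersection of the half-spaces `⟪n i, x⟫ ≤ c i`. -/
def polyhedron (n : ι → V) (c : ι → ℝ) : Set V := {x | ∀ i, inner ℝ (n i) x ≤ c i}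

/-- The product over `s` of smooth ramps of width `ε` at the half-spaces `⟪n i, x⟫ ≤ c i`. -/
noncomputable def cutoff (n : ι → V) (c : ι → ℝ) (s : Finset ι) (ε : ℝ) (x : V) : ℝ :=
  ∏ i ∈ s, Real.smoothTransition ((c i - inner ℝ (n i) x) / ε)

variable {n : ι → V} {c : ι → ℝ} {s : Finset ι} {ε : ℝ} {x : V}

theorem isClosed_polyhedron : IsClosed (polyhedron n c) := by
  have : polyhedron n c = ⋂ i, {x | inner ℝ (n i) x ≤ c i} := by
    ext x; simp [polyhedron]
  rw [this]
  exact isClosed_iInter fun i => isClosed_le (by fun_prop) (by fun_prop)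

theorem cutoff_nonneg : 0 ≤ cutoff n c s ε x :=
  Finset.prod_nonneg fun _ _ => Real.smoothTransition.nonneg _

theorem cutoff_le_one : cutoff n c s ε x ≤ 1 :=
  Finset.prod_le_one (fun _ _ => Real.smoothTransition.nonneg _)
    fun _ _ => Real.smoothTransition.le_one _

theorem cutoff_eq_zero (hε : 0 < ε) {i : ι} (hi : i ∈ s) (hx : c i ≤ inner ℝ (n i) x) :
    cutoff n c s ε x = 0 :=
  Finset.prod_eq_zero hi (Real.smoothTransition.zero_of_nonpos
    (div_nonpos_of_nonpos_of_nonneg (by linarith) hε.le))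

theorem cutoff_eq_one (hε : 0 < ε) (hx : ∀ i ∈ s, ε ≤ c i - inner ℝ (n i) x) :
    cutoff n c s ε x = 1 :=
  Finset.prod_eq_one fun i hi => Real.smoothTransition.one_of_one_le
    ((one_le_div hε).2 (hx i hi))

theorem contDiff_cutoff : ContDiff ℝ 1 (cutoff n c s ε) := by
  unfold cutoff
  exact contDiff_prod fun i _ => (Real.smoothTransition.contDiff (n := 1)).comp
    ((contDiff_const.sub (contDiff_const.inner ℝ contDiff_id)).div_const ε)

/-- Product rule: each summand differentiates one ramp and keeps the others. The minus sign appears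
because the ramps decrease in the direction of the outward normals. -/
theorem fderiv_cutoff [DecidableEq ι] (e : V) :
    fderiv ℝ (cutoff n c s ε) x e = ∑ i ∈ s, -inner ℝ (n i) e *
      (deriv Real.smoothTransition ((c i - inner ℝ (n i) x) / ε) / ε
        * cutoff n c (s.erase i) ε x) := by
  have h (i : ι) : HasFDerivAt (fun x => Real.smoothTransition ((c i - inner ℝ (n i) x) / ε))
      (deriv Real.smoothTransition ((c i - inner ℝ (n i) x) / ε) •
        (ε⁻¹ • -(innerSL ℝ (n i)))) x := by
    refine (hasDerivAt_smoothTransition _).comp_hasFDerivAt x ?_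
    simp_rw [div_eq_inv_mul]
    exact ((innerSL ℝ (n i)).hasFDerivAt.const_sub (c i)).const_mul ε⁻¹
  have := HasFDerivAt.finsetProd (u := s) fun i _ => h i
  rw [show cutoff n c s ε = fun x => ∏ i ∈ s, Real.smoothTransition ((c i - inner ℝ (n i) x) / ε)
    from rfl, this.fderiv]
  simp only [sum_apply, smul_apply,
    neg_apply, innerSL_apply_apply, smul_eq_mul, cutoff]
  refine Finset.sum_congr rfl fun i _ => ?_
  ring

variable [FiniteDimensional ℝ V] [MeasurableSpace V] [BorelSpace V] [Fintype ι]

open Classical in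
/-- The concentration of the derivative of a ramp on the corresponding facet. -/
theorem tendsto_integral_facet (hn : ∀ i, ‖n i‖ = 1) (hinj : Function.Injective n)
    (hK : IsCompact (polyhedron n c)) (hne : ∃ x, ∀ i, inner ℝ (n i) x < c i)
    {f : V → ℝ} (hf : ContinuousOn f (polyhedron n c)) (i : ι) :
    Tendsto (fun ε => ∫ x, f x * (deriv Real.smoothTransition ((c i - inner ℝ (n i) x) / ε) / ε
        * cutoff n c (Finset.univ.erase i) ε x)) (𝓝[>] 0)
      (𝓝 (∫ x in polyhedron n c ∩ {x | inner ℝ (n i) x = c i}, f x ∂μHE[finrank ℝ V - 1])) := by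
  set K := polyhedron n c with hKdef
  set φ := K.indicator f with hφ
  have hKm : MeasurableSet K := isClosed_polyhedron.measurableSet
  have hφm : Measurable φ := hf.measurable_piecewise continuousOn_const hKm
  obtain ⟨M, hM⟩ := hK.exists_bound_of_continuousOn hf
  obtain ⟨R, hR⟩ := hK.isBounded.subset_closedBall (0 : V)
  have hcont (ε : ℝ) : Continuous (cutoff n c (Finset.univ.erase i) ε) := contDiff_cutoff.continuous
  set p := c i • n i with hp
  let S : (ℝ ∙ n i)ᗮ × ℝ → V := slab (n i) p
  have hS : Continuous S := continuous_slab _ _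
  -- the integral over a slice parallel to the facet
  let G : ℝ → ℝ → ℝ := fun ε τ =>
    ∫ y : (ℝ ∙ n i)ᗮ, φ (S (y, τ)) * cutoff n c (Finset.univ.erase i) ε (S (y, τ))
  have hGm (ε : ℝ) : StronglyMeasurable (G ε) := by
    refine StronglyMeasurable.integral_prod_left'
      (f := fun z => φ (S z) * cutoff n c (Finset.univ.erase i) ε (S z)) ?_
    exact ((hφm.comp hS.measurable).mul ((hcont ε).comp hS).measurable).stronglyMeasurable
  -- Orthogonal projection does not increase norms, so slice points in K have their coordinate y in
  -- the ball of radius R. One dominating function then serves for all ε and τ.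
  have hbound (ε τ : ℝ) (y : (ℝ ∙ n i)ᗮ) :
      ‖φ (S (y, τ)) * cutoff n c (Finset.univ.erase i) ε (S (y, τ))‖
        ≤ (Metric.closedBall (0 : (ℝ ∙ n i)ᗮ) R).indicator (fun _ => M) y := by
    by_cases hx : S (y, τ) ∈ K
    · have hy : y ∈ Metric.closedBall (0 : (ℝ ∙ n i)ᗮ) R := by
        have h1 : ‖(y : V)‖ ≤ ‖S (y, τ)‖ := by
          have h2 : ((ℝ ∙ n i)ᗮ).starProjection (S (y, τ)) = y := by
            simp only [S, slab, hp, map_add, map_smul]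
            rw [Submodule.starProjection_eq_self_iff.2 y.2,
              (Submodule.starProjection_apply_eq_zero_iff _).2
                (Submodule.le_orthogonal_orthogonal _ (Submodule.mem_span_singleton_self (n i)))]
            simp
          rw [← h2]
          exact Submodule.norm_starProjection_apply_le _ _
        simpa using h1.trans (by simpa using hR hx)
      rw [Set.indicator_of_mem hy, hφ, Set.indicator_of_mem hx, norm_mul]
      have h0 : 0 ≤ M := (norm_nonneg _).trans (hM _ hx)
      calc _ ≤ M * 1 := by
            refine mul_le_mul (hM _ hx) ?_ (norm_nonneg _) h0
            rw [Real.norm_of_nonneg cutoff_nonneg]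
            exact cutoff_le_one
        _ = M := mul_one M
    · rw [hφ, Set.indicator_of_notMem hx, zero_mul, norm_zero]
      refine Set.indicator_nonneg (fun y _ => ?_) y
      obtain ⟨x₀, hx₀⟩ := hne
      exact (norm_nonneg _).trans (hM x₀ fun j => (hx₀ j).le)
  have hboundint : Integrable
      ((Metric.closedBall (0 : (ℝ ∙ n i)ᗮ) R).indicator (fun _ => M)) volume :=
    (integrable_indicator_iff Metric.isClosed_closedBall.measurableSet).2
      (integrableOn_const (isCompact_closedBall _ _).measure_lt_top.ne)
  -- change of variables
  have hkey {ε : ℝ} (hε : 0 < ε) :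
      ∫ x, f x * (deriv Real.smoothTransition ((c i - inner ℝ (n i) x) / ε) / ε
        * cutoff n c (Finset.univ.erase i) ε x)
      = ∫ r, deriv Real.smoothTransition r * G ε (-ε * r) := by
    let h : V → ℝ := fun x => deriv Real.smoothTransition ((c i - inner ℝ (n i) x) / ε) / ε
        * cutoff n c (Finset.univ.erase i) ε x
    have hhc : Continuous h :=
      ((continuous_deriv_smoothTransition.comp (by fun_prop)).div_const ε).mul (hcont ε)
    -- Off K the weight h vanishes: a violated constraint kills either the derivative of the ramp i
    -- or one of the other ramps. So f may be cut off sharply at K.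
    have h1 : (fun x => f x * h x) = fun x => φ x * h x := by
      ext x
      by_cases hx : x ∈ K
      · rw [hφ, Set.indicator_of_mem hx]
      · have : h x = 0 := by
          simp only [hKdef, polyhedron, Set.mem_ofPred_eq, not_forall, not_le] at hx
          obtain ⟨j, hj⟩ := hx
          by_cases hji : j = i
          · subst hji
            simp only [h]
            rw [deriv_smoothTransition_of_nonpos
              (div_nonpos_of_nonpos_of_nonneg (by linarith) hε.le)]
            simp
          · simp only [h]
            rw [cutoff_eq_zero hε (Finset.mem_erase.2 ⟨hji, Finset.mem_univ j⟩) hj.le, mul_zero]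
        rw [this, mul_zero, mul_zero]
    have hint : Integrable (fun x => φ x * h x) := by
      have : (fun x => φ x * h x) = K.indicator (fun x => f x * h x) := by
        ext x
        by_cases hx : x ∈ K <;> simp [hφ, hx]
      rw [this, integrable_indicator_iff hKm]
      exact (hf.mul hhc.continuousOn).integrableOn_compact hK
    have hmp := measurePreserving_slab (hn i) p
    have hme := measurableEmbedding_slab (hn i) p
    change ∫ x, f x * h x = _
    rw [h1, ← hmp.integral_comp hme, Measure.volume_eq_prod, integral_prod_symm]
    · have h2 (τ : ℝ) : ∫ y : (ℝ ∙ n i)ᗮ, φ (slab (n i) p (y, τ)) * h (slab (n i) p (y, τ))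
          = deriv Real.smoothTransition (-τ / ε) / ε * G ε τ := by
        simp only [G, S, ← integral_const_mul]
        refine integral_congr_ae (Eventually.of_forall fun y => ?_)
        simp only [h, hp, inner_slab_normal (hn i)]
        rw [show c i - (c i + τ) = -τ by ring]
        ring
      simp_rw [h2]
      -- Substituting τ = -ε r, the Jacobian ε cancels the factor 1/ε and the kernel no longer
      -- depends on ε.
      have h3 := Measure.integral_comp_mul_left
        (fun τ => deriv Real.smoothTransition (-τ / ε) * G ε τ) (-ε)
      have h4 (r : ℝ) : -(-ε * r) / ε = r := by field_simp
      simp only [h4] at h3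
      rw [h3, abs_inv, abs_neg, abs_of_pos hε, smul_eq_mul, ← integral_const_mul]
      refine integral_congr_ae (Eventually.of_forall fun τ => ?_)
      simp only
      ring
    · exact (hmp.integrable_comp_emb hme).2 hint
  -- Only r ≥ 0 matters: for r < 0 the slice lies beyond the facet, and the kernel vanishes there.
  have hlimG {r : ℝ} (hr : 0 ≤ r) : Tendsto (fun ε => G ε (-ε * r)) (𝓝[>] 0)
      (𝓝 (∫ y : (ℝ ∙ n i)ᗮ, φ (y + p))) := by
    refine tendsto_integral_filter_of_dominated_convergence _ ?_ ?_ hboundint ?_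
    · refine Eventually.of_forall fun ε => ?_
      have : Continuous fun y : (ℝ ∙ n i)ᗮ => S (y, -ε * r) := hS.comp (by fun_prop)
      exact ((hφm.comp this.measurable).mul ((hcont ε).comp this).measurable).aestronglyMeasurable
    · exact Eventually.of_forall fun ε => Eventually.of_forall fun y => hbound _ _ _
    -- Points on a second bounding hyperplane are negligible. If its normal is opposite to n i, the
    -- two hyperplanes are disjoint, since a strictly interior point lies between them; equal
    -- normals are excluded by injectivity.
    · have hae : ∀ᵐ y : (ℝ ∙ n i)ᗮ, ∀ j, j ≠ i → inner ℝ (n j) ((y : V) + p) ≠ c j := by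
        rw [ae_all_iff]
        intro j
        by_cases hji : j = i
        · exact Eventually.of_forall fun y h => absurd hji h
        by_cases hneg : n j = -n i
        · obtain ⟨x₀, hx₀⟩ := hne
          refine Eventually.of_forall fun y _ h => ?_
          have h1 := hx₀ i
          have h2 := hx₀ j
          rw [hneg, inner_neg_left] at h h2
          have h3 : inner ℝ (n i) ((y : V) + p) = c i := by
            simp [hp, inner_add_right, inner_smul_right, inner_orthogonal_eq_zero, hn]
          linarith
        · have := volume_hyperplane_slice_eq_zero (hn i) (hn j) (fun h => hji (hinj h)) hneg
            (c i) (c j)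
          rw [measure_eq_zero_iff_ae_notMem] at this
          filter_upwards [this] with y hy _ h using hy h
      filter_upwards [hae] with y hy
      have hpath : Tendsto (fun ε : ℝ => S (y, -ε * r)) (𝓝[>] 0) (𝓝 ((y : V) + p)) := by
        have : Continuous fun ε : ℝ => S (y, -ε * r) := hS.comp (by fun_prop)
        have h := this.tendsto 0
        simp only [S, slab, neg_zero, zero_mul, zero_smul, add_zero] at h
        exact h.mono_left nhdsWithin_le_nhds
      by_cases hin : ∀ j, j ≠ i → inner ℝ (n j) ((y : V) + p) < c j
      · have hmem : (y : V) + p ∈ K := by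
          intro j
          by_cases hji : j = i
          · subst hji
            simp [hp, inner_add_right, inner_smul_right, inner_orthogonal_eq_zero, hn]
          · exact (hin j hji).le
        have hev : ∀ᶠ ε in 𝓝[>] (0 : ℝ), ∀ j, j ≠ i →
            ε ≤ c j - inner ℝ (n j) (S (y, -ε * r)) := by
          rw [eventually_all]
          intro j
          by_cases hji : j = i
          · exact Eventually.of_forall fun ε h => absurd hji h
          have h1 : Tendsto (fun ε : ℝ => c j - inner ℝ (n j) (S (y, -ε * r)) - ε) (𝓝[>] 0)
              (𝓝 (c j - inner ℝ (n j) ((y : V) + p) - 0)) := by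
            refine (tendsto_const_nhds.sub (tendsto_const_nhds.inner hpath)).sub ?_
            exact tendsto_id.mono_left nhdsWithin_le_nhds
          have h2 := h1.eventually (lt_mem_nhds (a := 0) (by linarith [hin j hji]))
          filter_upwards [h2] with ε hε _
          linarith
        have hevK : ∀ᶠ ε in 𝓝[>] (0 : ℝ), S (y, -ε * r) ∈ K := by
          filter_upwards [hev, self_mem_nhdsWithin] with ε hε hpos j
          simp only [Set.mem_Ioi] at hpos
          by_cases hji : j = i
          · subst hji
            simp only [S, hp, inner_slab_normal (hn _)]
            nlinarith
          · linarith [hε j hji]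
        have h1 : Tendsto (fun ε : ℝ => f (S (y, -ε * r))) (𝓝[>] 0) (𝓝 (f ((y : V) + p))) :=
          (hf _ hmem).tendsto.comp (tendsto_nhdsWithin_iff.2 ⟨hpath, hevK⟩)
        rw [hφ, Set.indicator_of_mem hmem]
        refine h1.congr' ?_
        filter_upwards [hev, hevK, self_mem_nhdsWithin] with ε hε hεK hpos
        rw [Set.indicator_of_mem hεK, cutoff_eq_one hpos
          fun j hj => hε j (Finset.ne_of_mem_erase hj), mul_one]
      · push Not at hin
        obtain ⟨j, hji, hj⟩ := hin
        have hj' : c j < inner ℝ (n j) ((y : V) + p) := lt_of_le_of_ne hj (hy j hji).symm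
        have hmem : (y : V) + p ∉ K := fun h => (h j).not_gt hj'
        rw [hφ, Set.indicator_of_notMem hmem]
        refine tendsto_const_nhds.congr' ?_
        have h1 := ((tendsto_const_nhds (x := n j)).inner hpath).eventually (lt_mem_nhds hj')
        filter_upwards [h1, self_mem_nhdsWithin] with ε hε hpos
        rw [cutoff_eq_zero hpos (Finset.mem_erase.2 ⟨hji, Finset.mem_univ j⟩) hε.le, mul_zero]
  rw [setIntegral_hyperplane (hn i) (c i) hKm f]
  have hL : ∫ y : (ℝ ∙ n i)ᗮ, φ (y + p)
      = ∫ r, deriv Real.smoothTransition r * ∫ y : (ℝ ∙ n i)ᗮ, φ (y + p) := by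
    rw [integral_mul_const, integral_deriv_smoothTransition, one_mul]
  change Tendsto _ _ (𝓝 (∫ y : (ℝ ∙ n i)ᗮ, φ (y + p)))
  rw [hL]
  have hlim : Tendsto (fun ε => ∫ r, deriv Real.smoothTransition r * G ε (-ε * r)) (𝓝[>] 0)
      (𝓝 (∫ r, deriv Real.smoothTransition r * ∫ y : (ℝ ∙ n i)ᗮ, φ (y + p))) := by
    refine tendsto_integral_filter_of_dominated_convergence
      (fun r => ‖deriv Real.smoothTransition r‖ *
        ∫ y, (Metric.closedBall (0 : (ℝ ∙ n i)ᗮ) R).indicator (fun _ => M) y) ?_ ?_ ?_ ?_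
    · refine Eventually.of_forall fun ε => ?_
      refine (continuous_deriv_smoothTransition.measurable.mul
        ((hGm ε).measurable.comp ?_)).aestronglyMeasurable
      fun_prop
    · refine Eventually.of_forall fun ε => Eventually.of_forall fun r => ?_
      rw [norm_mul]
      exact mul_le_mul_of_nonneg_left (norm_integral_le_of_norm_le hboundint
        (Eventually.of_forall fun y => hbound _ _ _)) (norm_nonneg _)
    · exact integrable_deriv_smoothTransition.norm.mul_const _
    · refine Eventually.of_forall fun r => ?_
      by_cases hr : 0 ≤ r
      · exact (hlimG hr).const_mul _
      · simp [deriv_smoothTransition_of_nonpos (le_of_not_ge hr)]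
  exact hlim.congr' (eventually_mem_nhdsWithin.mono fun ε hε => (hkey hε).symm)

open Classical in
/-- The divergence theorem on a compact polyhedron. -/
theorem integral_fderiv_polyhedron (hn : ∀ i, ‖n i‖ = 1) (hinj : Function.Injective n)
    (hK : IsCompact (polyhedron n c)) (hne : ∃ x, ∀ i, inner ℝ (n i) x < c i)
    {f : V → ℝ} {U : Set V} (hU : IsOpen U) (hKU : polyhedron n c ⊆ U) (hf : ContDiffOn ℝ 1 f U)
    (e : V) :
    ∫ x in polyhedron n c, fderiv ℝ f x e
      = ∑ i, inner ℝ (n i) e *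
        ∫ x in polyhedron n c ∩ {x | inner ℝ (n i) x = c i}, f x ∂μHE[finrank ℝ V - 1] := by
  set K := polyhedron n c with hKdef
  have hKm : MeasurableSet K := isClosed_polyhedron.measurableSet
  have hfK : ContinuousOn f K := hf.continuousOn.mono hKU
  have hf' : ContinuousOn (fun x => fderiv ℝ f x e) K :=
    ((hf.continuousOn_fderiv_of_isOpen hU le_rfl).clm_apply continuousOn_const).mono hKU
  let T : ι → ℝ → V → ℝ := fun i ε x =>
    deriv Real.smoothTransition ((c i - inner ℝ (n i) x) / ε) / ε
        * cutoff n c (Finset.univ.erase i) ε x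
  have hTc (i : ι) (ε : ℝ) : Continuous (T i ε) :=
    ((continuous_deriv_smoothTransition.comp (by fun_prop)).div_const ε).mul
      contDiff_cutoff.continuous
  have hoff {ε : ℝ} (hε : 0 < ε) {x : V} (hx : x ∉ K) : cutoff n c Finset.univ ε x = 0 := by
    simp only [hKdef, polyhedron, Set.mem_ofPred_eq, not_forall, not_le] at hx
    obtain ⟨j, hj⟩ := hx
    exact cutoff_eq_zero hε (Finset.mem_univ j) hj.le
  have hTK {ε : ℝ} (hε : 0 < ε) (i : ι) {x : V} (hx : x ∉ K) : T i ε x = 0 := by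
    simp only [hKdef, polyhedron, Set.mem_ofPred_eq, not_forall, not_le] at hx
    obtain ⟨j, hj⟩ := hx
    by_cases hji : j = i
    · subst hji
      simp only [T]
      rw [deriv_smoothTransition_of_nonpos (div_nonpos_of_nonpos_of_nonneg (by linarith) hε.le)]
      simp
    · simp only [T]
      rw [cutoff_eq_zero hε (Finset.mem_erase.2 ⟨hji, Finset.mem_univ j⟩) hj.le, mul_zero]
  -- The product of f and the cutoff is a compactly supported C¹ function on all of V, so its
  -- derivative integrates to zero; the product rule then separates the volume part from the ramp
  -- parts.
  have hzero {ε : ℝ} (hε : 0 < ε) : ∫ x in K, fderiv ℝ f x e * cutoff n c Finset.univ ε x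
      = ∑ i, inner ℝ (n i) e * ∫ x, f x * T i ε x := by
    let u : V → ℝ := fun x => f x * cutoff n c Finset.univ ε x
    -- The cutoff vanishes on the open complement of K, so u is smooth there although f is
    -- controlled only on U.
    have hu0 {x : V} (hx : x ∉ K) : u =ᶠ[𝓝 x] fun _ => 0 := by
      filter_upwards [isClosed_polyhedron.isOpen_compl.mem_nhds hx] with y hy
      simp only [u]
      rw [hoff hε hy, mul_zero]
    have hu : ContDiff ℝ 1 u := by
      rw [contDiff_iff_contDiffAt]
      intro x
      by_cases hx : x ∈ K
      · exact (hf.contDiffAt (hU.mem_nhds (hKU hx))).mul contDiff_cutoff.contDiffAt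
      · exact contDiffAt_const.congr_of_eventuallyEq (hu0 hx)
    have husupp : HasCompactSupport u :=
      HasCompactSupport.intro hK fun x hx => (hu0 hx).self_of_nhds
    have hint0 : ∫ x, fderiv ℝ u x e = 0 := by
      have := integral_mul_fderiv_eq_neg_fderiv_mul_of_integrable (μ := volume)
        (f := fun _ : V => (1 : ℝ)) (g := u) (v := e) (by simp) ?_ ?_ (by simp)
        (fun x _ => hu.differentiable one_ne_zero x)
      · simpa using this
      · simp only [one_mul]
        refine Continuous.integrable_of_hasCompactSupport
          ((hu.continuous_fderiv one_ne_zero).clm_apply continuous_const) ?_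
        exact (husupp.fderiv ℝ).mono' fun x hx => subset_tsupport _ fun h => hx (by simp [h])
      · simp only [one_mul]
        exact hu.continuous.integrable_of_hasCompactSupport husupp
    have hderiv : (fun x => fderiv ℝ u x e) = K.indicator fun x =>
        fderiv ℝ f x e * cutoff n c Finset.univ ε x
          - ∑ i, inner ℝ (n i) e * (f x * T i ε x) := by
      ext x
      by_cases hx : x ∈ K
      · rw [Set.indicator_of_mem hx, show u = f * cutoff n c Finset.univ ε from rfl,
          fderiv_mul ((hf.contDiffAt (hU.mem_nhds (hKU hx))).differentiableAt one_ne_zero)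
          (contDiff_cutoff.contDiffAt.differentiableAt one_ne_zero), add_apply, smul_apply,
          smul_apply, fderiv_cutoff, smul_eq_mul, smul_eq_mul, Finset.mul_sum,
          sub_eq_add_neg, ← Finset.sum_neg_distrib, add_comm, mul_comm]
        congr 1
        refine Finset.sum_congr rfl fun i _ => ?_
        simp only [T]
        ring
      · rw [Set.indicator_of_notMem hx, (hu0 hx).fderiv_eq]
        simp
    rw [hderiv, integral_indicator hKm, integral_sub, integral_finsetSum, sub_eq_zero] at hint0
    · rw [hint0]
      refine Finset.sum_congr rfl fun i _ => ?_
      rw [integral_const_mul, setIntegral_eq_integral_of_forall_compl_eq_zero]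
      intro x hx
      rw [hTK hε i hx, mul_zero]
    · intro i _
      exact ((hfK.mul (hTc i ε).continuousOn).integrableOn_compact hK).const_mul _
    · exact (hf'.mul contDiff_cutoff.continuous.continuousOn).integrableOn_compact hK
    · exact integrable_finsetSum _ fun i _ =>
        ((hfK.mul (hTc i ε).continuousOn).integrableOn_compact hK).const_mul _
  have hlim : Tendsto (fun ε => ∫ x in K, fderiv ℝ f x e * cutoff n c Finset.univ ε x) (𝓝[>] 0)
      (𝓝 (∫ x in K, fderiv ℝ f x e)) := by
    refine tendsto_integral_filter_of_dominated_convergence (fun x => ‖fderiv ℝ f x e‖) ?_ ?_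
      (hf'.integrableOn_compact hK).norm ?_
    · exact Eventually.of_forall fun ε =>
        (hf'.mul contDiff_cutoff.continuous.continuousOn).aestronglyMeasurable hKm
    · refine Eventually.of_forall fun ε => Eventually.of_forall fun x => ?_
      rw [norm_mul, Real.norm_of_nonneg (cutoff_nonneg (x := x))]
      exact mul_le_of_le_one_right (norm_nonneg _) cutoff_le_one
    -- Almost every point of K satisfies all constraints strictly, and there the cutoff is
    -- eventually 1.
    · have hae : ∀ᵐ x : V ∂volume.restrict K, ∀ j, inner ℝ (n j) x ≠ c j := by
        refine ae_restrict_of_ae ?_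
        rw [ae_all_iff]
        intro j
        exact measure_eq_zero_iff_ae_notMem.1 (volume_hyperplane_eq_zero (hn j) (c j))
      filter_upwards [hae, ae_restrict_mem hKm] with x hx hxK
      refine tendsto_const_nhds.congr' ?_
      have hev : ∀ᶠ ε in 𝓝[>] (0 : ℝ), ∀ j, ε ≤ c j - inner ℝ (n j) x := by
        rw [eventually_all]
        intro j
        have hj : 0 < c j - inner ℝ (n j) x := sub_pos.2 (lt_of_le_of_ne (hxK j) (hx j))
        filter_upwards [Ioo_mem_nhdsGT hj] with ε hε using hε.2.le
      filter_upwards [hev, self_mem_nhdsWithin] with ε hε hpos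
      rw [cutoff_eq_one hpos fun j _ => hε j, mul_one]
  refine tendsto_nhds_unique hlim ?_
  refine Tendsto.congr' (eventually_mem_nhdsWithin.mono fun ε hε => (hzero hε).symm) ?_
  exact tendsto_finsetSum _ fun i _ => (tendsto_integral_facet hn hinj hK hne hfK i).const_mul _

end Polyhedron

end HDG

namespace HDG

open Filter Topology Module

/-! ### Mesh geometry: normals, elements as polyhedra, the divergence theorem on an element. -/

namespace Mesh

variable {d : ℕ} {Ω : Set (E d)} {ιK ιF : Type*} (M : Mesh d Ω ιK ιF)

theorem isCompact_elem (K : ιK) : IsCompact (M.elem K) := by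
  rw [M.elem_eq]
  exact (M.Kvert.finite_toSet.isCompact_convexHull ℝ).image
    (M.ψ K).toAffineMap.continuous_of_finiteDimensional

theorem convex_elem (K : ιK) : Convex ℝ (M.elem K) := by
  rw [M.elem_eq]
  exact (convex_convexHull ℝ _).affine_image (M.ψ K).toAffineMap

theorem isCompact_face (F : ιF) : IsCompact (M.face F) := by
  rw [M.face_eq]
  exact (M.Fvert.finite_toSet.isCompact_convexHull ℝ).image
    (M.φ F).continuous_of_finiteDimensional

theorem measurableSet_elem (K : ιK) : MeasurableSet (M.elem K) :=
  (M.isCompact_elem K).isClosed.measurableSet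

theorem measurableSet_face (F : ιF) : MeasurableSet (M.face F) :=
  (M.isCompact_face F).isClosed.measurableSet

theorem interior_elem_nonempty (K : ιK) : (interior (M.elem K)).Nonempty := by
  obtain ⟨x, hx⟩ := M.Kref_solid
  let h : E d ≃ₜ E d := (AffineEquiv.toContinuousAffineEquiv (M.ψ K)).toHomeomorph
  have : M.elem K = h '' convexHull ℝ (M.Kvert : Set (E d)) := M.elem_eq K
  rw [this, ← h.image_interior]
  exact ⟨h x, x, hx, rfl⟩

theorem face_subset_elem {K : ιK} {F : ιF} (hF : M.face F ⊆ frontier (M.elem K)) :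
    M.face F ⊆ M.elem K :=
  hF.trans (M.isCompact_elem K).isClosed.frontier_subset

variable {M}

/-- `outwardNormal` is a choice, so some valid normal has to be exhibited. Hahn-Banach separates a
relatively interior point of the face from the interior of the convex element, and the normalised
Riesz vector of the functional works. -/
theorem normal_spec {K : ιK} {F : ιF} (hF : M.face F ⊆ frontier (M.elem K)) :
    ‖M.normal K F‖ = 1 ∧ ∀ x ∈ M.elem K, ∀ y ∈ M.face F, inner ℝ (M.normal K F) (x - y) ≤ 0 := by
  refine Classical.epsilon_spec (p := fun n : E d => ‖n‖ = 1 ∧ ∀ x ∈ M.elem K, ∀ y ∈ M.face F,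
    inner ℝ n (x - y) ≤ 0) ?_
  obtain ⟨z₀, hz₀⟩ := M.Fref_solid
  have hz₀F : M.φ F z₀ ∈ M.face F := M.face_eq F ▸ ⟨z₀, interior_subset hz₀, rfl⟩
  obtain ⟨f, hf⟩ := geometric_hahn_banach_open_point (M.convex_elem K).interior isOpen_interior
    (x := M.φ F z₀) (fun h => (hF hz₀F).2 h)
  have hle (x : E d) (hx : x ∈ M.elem K) : f x ≤ f (M.φ F z₀) := by
    have h1 : x ∈ closure (interior (M.elem K)) := by
      rw [(M.convex_elem K).closure_interior_eq_closure_of_nonempty_interior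
        (M.interior_elem_nonempty K)]
      exact subset_closure hx
    exact closure_minimal (fun y hy => (hf y hy).le)
      (isClosed_le f.continuous continuous_const) h1
  -- On the face f is maximal at the image of an interior point of the reference face. Along any
  -- line through that point f is affine with a local maximum, hence constant.
  have hconst (z : E (d - 1)) : f (M.φ F z) = f (M.φ F z₀) := by
    have hmax : IsLocalMax (fun t : ℝ => f (M.φ F (AffineMap.lineMap z₀ z t))) 0 := by
      have hc : ContinuousAt (fun t : ℝ => (AffineMap.lineMap z₀ z t : E (d - 1))) 0 :=
        (AffineMap.lineMap_continuous (R := ℝ)).continuousAt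
      have hnh : convexHull ℝ (M.Fvert : Set (E (d - 1)))
          ∈ 𝓝 (AffineMap.lineMap z₀ z (0 : ℝ)) := by
        rw [AffineMap.lineMap_apply_zero]
        exact mem_interior_iff_mem_nhds.1 hz₀
      filter_upwards [hc hnh] with t ht
      rw [AffineMap.lineMap_apply_zero]
      exact hle _ (M.face_subset_elem hF (M.face_eq F ▸ ⟨_, ht, rfl⟩))
    have hform : (fun t : ℝ => f (M.φ F (AffineMap.lineMap z₀ z t)))
        = fun t => t * (f (M.φ F z) - f (M.φ F z₀)) + f (M.φ F z₀) := by
      ext t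
      rw [AffineMap.apply_lineMap, AffineMap.lineMap_apply]
      simp
    rw [hform] at hmax
    have hd : HasDerivAt (fun t : ℝ => t * (f (M.φ F z) - f (M.φ F z₀)) + f (M.φ F z₀))
        (1 * (f (M.φ F z) - f (M.φ F z₀))) 0 :=
      ((hasDerivAt_id (0 : ℝ)).mul_const _).add_const _
    have := hmax.hasDerivAt_eq_zero hd
    linarith
  obtain ⟨x₀, hx₀⟩ := M.interior_elem_nonempty K
  let m : E d := (InnerProductSpace.toDual ℝ (E d)).symm f
  have hm (x : E d) : inner ℝ m x = f x := InnerProductSpace.toDual_symm_apply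
  have hm0 : m ≠ 0 := by
    intro h
    have := hf x₀ hx₀
    rw [← hm, ← hm, h] at this
    simp at this
  refine ⟨‖m‖⁻¹ • m, norm_smul_inv_norm (𝕜 := ℝ) hm0, fun x hx y hy => ?_⟩
  rw [M.face_eq] at hy
  obtain ⟨z, -, rfl⟩ := hy
  rw [real_inner_smul_left, inner_sub_right, hm, hm, hconst z]
  exact mul_nonpos_of_nonneg_of_nonpos (by positivity) (by linarith [hle x hx])

/-- The support function of an element. -/
noncomputable def _root_.HDG.Mesh.offset (M : Mesh d Ω ιK ιF) (K : ιK) (n : E d) : ℝ :=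
  sSup ((fun x => inner ℝ n x) '' M.elem K)

theorem inner_normal_face {K : ιK} {F : ιF} (hF : M.face F ⊆ frontier (M.elem K)) {y : E d}
    (hy : y ∈ M.face F) : inner ℝ (M.normal K F) y = M.offset K (M.normal K F) := by
  refine (IsGreatest.csSup_eq (s := (fun x => inner ℝ (M.normal K F) x) '' M.elem K)
    ⟨⟨y, M.face_subset_elem hF hy, rfl⟩, ?_⟩).symm
  rintro _ ⟨x, hx, rfl⟩
  have := (normal_spec hF).2 x hx y hy
  rw [inner_sub_right] at this
  simp only
  linarith

theorem inner_le_offset {K : ιK} (n : E d) {x : E d} (hx : x ∈ M.elem K) :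
    inner ℝ n x ≤ M.offset K n :=
  le_csSup ((M.isCompact_elem K).image (by fun_prop)).bddAbove ⟨x, hx, rfl⟩

theorem inner_lt_offset {K : ιK} {n : E d} (hn : ‖n‖ = 1) {x : E d}
    (hx : x ∈ interior (M.elem K)) : inner ℝ n x < M.offset K n := by
  have hc : Continuous fun t : ℝ => x + t • n := by fun_prop
  have h1 : ∀ᶠ t in 𝓝[>] (0 : ℝ), x + t • n ∈ M.elem K := by
    refine (hc.tendsto 0).mono_left nhdsWithin_le_nhds ?_
    simpa using mem_interior_iff_mem_nhds.1 hx
  obtain ⟨t, ht, hpos⟩ := (h1.and self_mem_nhdsWithin).exists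
  have := inner_le_offset n ht
  rw [inner_add_right, inner_smul_right, real_inner_self_eq_norm_sq, hn] at this
  have hpos' : 0 < t := hpos
  linarith

variable [Fintype ιF]

open Classical in
/-- The outward unit normals of an element. -/
noncomputable def _root_.HDG.Mesh.normals (M : Mesh d Ω ιK ιF) (K : ιK) : Finset (E d) :=
  (Finset.univ.filter fun F => M.face F ⊆ frontier (M.elem K)).image (M.normal K)

theorem mem_normals {K : ιK} {n : E d} :
    n ∈ M.normals K ↔ ∃ F, M.face F ⊆ frontier (M.elem K) ∧ M.normal K F = n := by
  simp [normals]

theorem norm_of_mem_normals {K : ιK} {n : E d} (hn : n ∈ M.normals K) : ‖n‖ = 1 := by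
  obtain ⟨F, hF, rfl⟩ := mem_normals.1 hn
  exact (normal_spec hF).1

/-- Suppose z satisfies all face constraints but lies outside the element. The segment to z from an
interior point x₀ meets the frontier in a point w of some face. The functional of that face equals
the offset at w, is smaller at x₀ and not larger at z; hence w = z, which contradicts closedness. -/
theorem elem_eq_polyhedron (K : ιK) :
    M.elem K = polyhedron (fun n : M.normals K => (n : E d)) (fun n => M.offset K n) := by
  refine Set.Subset.antisymm (fun x hx n => inner_le_offset _ hx) fun z hz => ?_
  by_contra hzK
  obtain ⟨x₀, hx₀⟩ := M.interior_elem_nonempty K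
  have hcl := (M.isCompact_elem K).isClosed
  have hfr : (segment ℝ x₀ z ∩ frontier (M.elem K)).Nonempty := by
    by_contra hemp
    rw [Set.not_nonempty_iff_eq_empty] at hemp
    have hsub : segment ℝ x₀ z ⊆ interior (M.elem K) ∪ (M.elem K)ᶜ := by
      intro w hw
      by_cases h1 : w ∈ interior (M.elem K)
      · exact Or.inl h1
      · refine Or.inr fun h2 => ?_
        have : w ∈ segment ℝ x₀ z ∩ frontier (M.elem K) := ⟨hw, subset_closure h2, h1⟩
        rw [hemp] at this
        exact this
    have := (convex_segment x₀ z).isPreconnected.subset_left_of_subset_union isOpen_interior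
      hcl.isOpen_compl (Set.disjoint_compl_right_iff_subset.2 interior_subset) hsub
      ⟨x₀, left_mem_segment ℝ x₀ z, hx₀⟩
    exact hzK (interior_subset (this (right_mem_segment ℝ x₀ z)))
  obtain ⟨w, ⟨a, b, ha, hb, hab, rfl⟩, hwF⟩ := hfr
  obtain ⟨F, hF, hw⟩ := Set.mem_iUnion₂.1 (M.frontier_elem K hwF)
  have h1 := inner_normal_face hF hw
  have h2 := hz ⟨M.normal K F, mem_normals.2 ⟨F, hF, rfl⟩⟩
  have h3 := inner_lt_offset (normal_spec hF).1 hx₀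
  simp only at h2
  rw [inner_add_right, inner_smul_right, inner_smul_right] at h1
  have ha0 : a = 0 := by
    by_contra hne
    have ha' : 0 < a := lt_of_le_of_ne ha (Ne.symm hne)
    have h4 : M.offset K (M.normal K F)
        = a * M.offset K (M.normal K F) + b * M.offset K (M.normal K F) := by
      rw [← add_mul, hab, one_mul]
    linarith [mul_lt_mul_of_pos_left h3 ha', mul_le_mul_of_nonneg_left h2 hb]
  have hb1 : b = 1 := by linarith
  rw [ha0, hb1] at hwF
  simp only [zero_smul, one_smul, zero_add] at hwF
  exact hzK (hcl.frontier_subset hwF)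

-- The face lies in a hyperplane, where surface measure is the Lebesgue measure of a bounded
-- preimage.
omit [Fintype ιF] in
theorem face_lt_top {K : ιK} {F : ιF} (hF : M.face F ⊆ frontier (M.elem K)) :
    μHE[d - 1] (M.face F) < ⊤ := by
  have hn := (normal_spec hF).1
  have hmap := map_hyperplane hn (M.offset K (M.normal K F))
  rw [finrank_euclideanSpace_fin] at hmap
  have hsub : M.face F ⊆ {x | inner ℝ (M.normal K F) x = M.offset K (M.normal K F)} :=
    fun y hy => inner_normal_face hF hy
  rw [← Set.inter_eq_left.2 hsub, ← Measure.restrict_apply (M.measurableSet_face F), ← hmap,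
    Measure.map_apply (isometry_hyperplane _ _).continuous.measurable (M.measurableSet_face F)]
  refine Bornology.IsBounded.measure_lt_top ?_
  exact (isometry_hyperplane _ _).antilipschitz.isBounded_preimage
    (M.isCompact_face F).isBounded

omit [Fintype ιF] in
theorem integrableOn_face {K : ιK} {F : ιF} (hF : M.face F ⊆ frontier (M.elem K)) {f : E d → ℝ}
    (hf : ContinuousOn f (M.face F)) : IntegrableOn f (M.face F) μHE[d - 1] := by
  obtain ⟨C, hC⟩ := (M.isCompact_face F).exists_bound_of_continuousOn hf
  exact IntegrableOn.of_bound (face_lt_top hF)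
    (hf.aestronglyMeasurable (M.measurableSet_face F)) C
    (ae_restrict_of_forall_mem (M.measurableSet_face F) hC)

/-- Opposite normals give disjoint hyperplanes, because the interior of the element lies strictly
between them; otherwise the hyperplanes are transversal. -/
theorem hyperplane_inter_null {K : ιK} {n m : E d} (hn : n ∈ M.normals K) (hm : m ∈ M.normals K)
    (hnm : m ≠ n) :
    μHE[d - 1] ({x : E d | inner ℝ n x = M.offset K n} ∩ {x | inner ℝ m x = M.offset K m}) = 0 := by
  have hn1 := norm_of_mem_normals hn
  have hm1 := norm_of_mem_normals hm
  by_cases hneg : m = -n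
  · obtain ⟨x₀, hx₀⟩ := M.interior_elem_nonempty K
    convert measure_empty (μ := (μHE[d - 1] : Measure (E d)))
    refine Set.eq_empty_iff_forall_notMem.2 fun x hx => ?_
    have h1 := inner_lt_offset hn1 hx₀
    have h2 := inner_lt_offset hm1 hx₀
    have h3 : inner ℝ n x = M.offset K n := hx.1
    have h4 : inner ℝ m x = M.offset K m := hx.2
    rw [← h4] at h2
    rw [hneg, inner_neg_left, inner_neg_left] at h2
    linarith
  · have hmap := map_hyperplane hn1 (M.offset K n)
    rw [finrank_euclideanSpace_fin] at hmap
    rw [Set.inter_comm, ← Measure.restrict_apply (measurableSet_hyperplane _ _), ← hmap,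
      Measure.map_apply (isometry_hyperplane _ _).continuous.measurable
        (measurableSet_hyperplane _ _)]
    exact volume_hyperplane_slice_eq_zero hn1 hm1 hnm hneg _ _

-- Several faces may share a normal, so a facet of the polyhedron is a union of faces up to a null
-- set: a facet point on a face with another normal lies in two hyperplanes. Distinct faces overlap
-- in null sets, so their integrals add.
open Classical in
theorem setIntegral_facet {K : ιK} {n : E d} (hn : n ∈ M.normals K) {f : E d → ℝ}
    (hf : ContinuousOn f (M.elem K)) :
    ∫ x in M.elem K ∩ {x | inner ℝ n x = M.offset K n}, f x ∂μHE[d - 1]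
      = ∑ F with M.face F ⊆ frontier (M.elem K) ∧ M.normal K F = n, M.faceInt F f := by
  let I := {F // M.face F ⊆ frontier (M.elem K) ∧ M.normal K F = n}
  have hint (F : I) : IntegrableOn f (M.face F) μHE[d - 1] :=
    integrableOn_face F.2.1 (hf.mono (M.face_subset_elem F.2.1))
  have hae : (M.elem K ∩ {x | inner ℝ n x = M.offset K n} : Set (E d))
      =ᵐ[μHE[d - 1]] ⋃ F : I, M.face F := by
    refine Filter.EventuallyLE.antisymm ?_ ?_
    · have hnull : ∀ᵐ x ∂(μHE[d - 1] : Measure (E d)), ∀ m : M.normals K, (m : E d) ≠ n →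
          x ∉ {x : E d | inner ℝ n x = M.offset K n} ∩ {x | inner ℝ (m : E d) x = M.offset K m} := by
        rw [ae_all_iff]
        intro m
        by_cases hmn : (m : E d) = n
        · exact Eventually.of_forall fun x h => absurd hmn h
        · filter_upwards [measure_eq_zero_iff_ae_notMem.1 (hyperplane_inter_null hn m.2 hmn)]
            with x hx _ using hx
      filter_upwards [hnull] with x hx hxK
      have hfr : x ∈ frontier (M.elem K) := by
        refine ⟨subset_closure hxK.1, fun h => ?_⟩
        have := inner_lt_offset (norm_of_mem_normals hn) h
        have h2 : inner ℝ n x = M.offset K n := hxK.2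
        linarith
      obtain ⟨F, hF, hxF⟩ := Set.mem_iUnion₂.1 (M.frontier_elem K hfr)
      have hFn : M.normal K F = n := by
        by_contra hne
        exact hx ⟨M.normal K F, mem_normals.2 ⟨F, hF, rfl⟩⟩ hne
          ⟨hxK.2, inner_normal_face hF hxF⟩
      exact Set.mem_iUnion.2 ⟨⟨F, hF, hFn⟩, hxF⟩
    · refine Eventually.of_forall fun x hx => ?_
      obtain ⟨⟨F, hF, hFn⟩, hxF⟩ := Set.mem_iUnion.1 hx
      refine ⟨M.face_subset_elem hF hxF, ?_⟩
      subst hFn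
      exact inner_normal_face hF hxF
  rw [setIntegral_congr_set hae, integral_iUnion_ae
    (s := fun F : I => M.face F) (fun F => (M.measurableSet_face F).nullMeasurableSet)
    (fun F F' hne => M.face_inter_null F F' fun h => hne (Subtype.ext h))
    ((integrableOn_finite_iUnion (t := fun F : I => M.face F)).2 hint), tsum_fintype]
  exact (Finset.sum_subtype (p := fun F => M.face F ⊆ frontier (M.elem K) ∧ M.normal K F = n) _
    (by simp) fun F => M.faceInt F f).symm

open Classical in
/-- The divergence theorem on an element of the mesh. -/
theorem integral_fderiv_elem (K : ιK) {f : E d → ℝ} {U : Set (E d)} (hU : IsOpen U)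
    (hKU : M.elem K ⊆ U) (hf : ContDiffOn ℝ 1 f U) (e : E d) :
    ∫ x in M.elem K, fderiv ℝ f x e
      = ∑ F with M.face F ⊆ frontier (M.elem K),
        inner ℝ (M.normal K F) e * M.faceInt F f := by
  obtain ⟨x₀, hx₀⟩ := M.interior_elem_nonempty K
  have h := integral_fderiv_polyhedron (n := fun n : M.normals K => (n : E d))
    (c := fun n => M.offset K n) (fun n => norm_of_mem_normals n.2) Subtype.val_injective
    (elem_eq_polyhedron (M := M) K ▸ M.isCompact_elem K)
    ⟨x₀, fun n => inner_lt_offset (norm_of_mem_normals n.2) hx₀⟩ hU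
    (elem_eq_polyhedron (M := M) K ▸ hKU) hf e
  rw [← elem_eq_polyhedron, finrank_euclideanSpace_fin] at h
  rw [h, Finset.sum_congr rfl fun n _ => congrArg _ (setIntegral_facet n.2
    (hf.continuousOn.mono hKU)), Finset.sum_coe_sort (M.normals K) fun n => inner ℝ n e *
    ∑ F with M.face F ⊆ frontier (M.elem K) ∧ M.normal K F = n, M.faceInt F f]
  rw [← Finset.sum_fiberwise_of_maps_to (t := M.normals K) (g := M.normal K)
    fun F hF => mem_normals.2 ⟨F, (Finset.mem_filter.1 hF).2, rfl⟩]
  refine Finset.sum_congr rfl fun n _ => ?_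
  rw [Finset.mul_sum, Finset.filter_filter]
  refine Finset.sum_congr rfl fun F hF => ?_
  rw [(Finset.mem_filter.1 hF).2.2]

-- The face has solid preimage and constant inner product with n, so its directions lie in nᗮ;
-- equality follows by dimension.
omit [Fintype ιF] in
theorem range_linear_face (hd : 1 ≤ d) {F : ιF} {n : E d} (hn : ‖n‖ = 1) {a : ℝ}
    (ha : ∀ y ∈ M.face F, inner ℝ n y = a) : LinearMap.range (M.φ F).linear = (ℝ ∙ n)ᗮ := by
  obtain ⟨z₀, hz₀⟩ := M.Fref_solid
  refine Submodule.eq_of_le_of_finrank_eq ?_ ?_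
  · rintro _ ⟨w, rfl⟩
    rw [Submodule.mem_orthogonal_singleton_iff_inner_right]
    have hc : Continuous fun t : ℝ => z₀ + t • w := by fun_prop
    have h1 : ∀ᶠ t in 𝓝[>] (0 : ℝ), z₀ + t • w ∈ convexHull ℝ (M.Fvert : Set (E (d - 1))) := by
      refine (hc.tendsto 0).mono_left nhdsWithin_le_nhds ?_
      simpa using mem_interior_iff_mem_nhds.1 hz₀
    obtain ⟨t, ht, hpos⟩ := (h1.and self_mem_nhdsWithin).exists
    have hpos' : 0 < t := hpos
    have h2 := ha (M.φ F z₀) (M.face_eq F ▸ ⟨_, interior_subset hz₀, rfl⟩)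
    have h3 := ha (M.φ F (z₀ + t • w)) (M.face_eq F ▸ ⟨_, ht, rfl⟩)
    have h4 : M.φ F (z₀ + t • w) = t • (M.φ F).linear w + M.φ F z₀ := by
      rw [add_comm, ← vadd_eq_add, AffineMap.map_vadd, map_smul, vadd_eq_add]
    rw [h4, inner_add_right, inner_smul_right, h2] at h3
    have h5 : t * inner ℝ n ((M.φ F).linear w) = 0 := by linarith
    exact (mul_eq_zero.1 h5).resolve_left hpos'.ne'
  · have h1 := (ℝ ∙ n).finrank_add_finrank_orthogonal
    rw [finrank_span_singleton (by rintro rfl; simp at hn), finrank_euclideanSpace_fin] at h1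
    rw [LinearMap.finrank_range_of_inj ((AffineMap.linear_injective_iff _).2 (M.φ_injective F)),
      finrank_euclideanSpace_fin]
    omega

-- The direction space of the face is the orthogonal complement of both unit vectors, so they span
-- the same line.
omit [Fintype ιF] in
theorem normal_eq_or_eq_neg (hd : 1 ≤ d) {F : ιF} {n m : E d} (hn : ‖n‖ = 1) (hm : ‖m‖ = 1)
    {a b : ℝ} (ha : ∀ y ∈ M.face F, inner ℝ n y = a) (hb : ∀ y ∈ M.face F, inner ℝ m y = b) :
    m = n ∨ m = -n := by
  have h : (ℝ ∙ n)ᗮ = (ℝ ∙ m)ᗮ := (range_linear_face hd hn ha).symm.trans (range_linear_face hd hm hb)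
  have h2 : m ∈ (ℝ ∙ n) := by
    rw [← (ℝ ∙ n).orthogonal_orthogonal, h, (ℝ ∙ m).orthogonal_orthogonal]
    exact Submodule.mem_span_singleton_self m
  obtain ⟨t, rfl⟩ := Submodule.mem_span_singleton.1 h2
  rw [norm_smul, hn, mul_one, Real.norm_eq_abs, abs_eq zero_le_one] at hm
  rcases hm with rfl | rfl
  · exact Or.inl (one_smul _ _)
  · exact Or.inr (by simp)

omit [Fintype ιF] in
/-- Points slightly below the interior of a face belong to the interior of the element. -/
theorem eventually_mem_interior (hd : 1 ≤ d) {K : ιK} {F : ιF}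
    (hF : M.face F ⊆ frontier (M.elem K)) {z₀ : E (d - 1)}
    (hz₀ : z₀ ∈ interior (convexHull ℝ (M.Fvert : Set (E (d - 1))))) :
    ∀ᶠ s in 𝓝[>] (0 : ℝ), M.φ F z₀ - s • M.normal K F ∈ interior (M.elem K) := by
  obtain ⟨x, hx⟩ := M.interior_elem_nonempty K
  set n := M.normal K F
  have hn : ‖n‖ = 1 := (normal_spec hF).1
  have hz₀F : M.φ F z₀ ∈ M.face F := M.face_eq F ▸ ⟨z₀, interior_subset hz₀, rfl⟩
  have hy := inner_normal_face hF hz₀F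
  set δ := M.offset K n - inner ℝ n x with hδdef
  have hδ : 0 < δ := sub_pos.2 (inner_lt_offset hn hx)
  have hw : x + δ • n - M.φ F z₀ ∈ LinearMap.range (M.φ F).linear := by
    rw [range_linear_face hd hn fun y hy => inner_normal_face hF hy,
      Submodule.mem_orthogonal_singleton_iff_inner_right, inner_sub_right, inner_add_right,
      inner_smul_right, real_inner_self_eq_norm_sq, hn, hy]
    simp only [hδdef, n]
    ring
  obtain ⟨w, hw⟩ := hw
  -- With λ = s/δ and y the image of z₀ - (λ/(1-λ)) w, the point below the face is (1-λ) y + λ x: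
  -- the shift of the base point compensates the tangential part of x.
  have hc : ContinuousAt (fun s : ℝ => z₀ - ((s / δ) / (1 - s / δ)) • w) 0 := by
    have : ContinuousAt (fun s : ℝ => (s / δ) / (1 - s / δ)) 0 :=
      ContinuousAt.div (by fun_prop) (by fun_prop) (by simp)
    fun_prop
  have h1 : ∀ᶠ s in 𝓝[>] (0 : ℝ), z₀ - ((s / δ) / (1 - s / δ)) • w
      ∈ convexHull ℝ (M.Fvert : Set (E (d - 1))) := by
    refine (hc.tendsto).mono_left nhdsWithin_le_nhds ?_
    simpa using mem_interior_iff_mem_nhds.1 hz₀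
  filter_upwards [h1, Ioo_mem_nhdsGT hδ] with s hs hsδ
  have ht0 : 0 < s / δ := div_pos hsδ.1 hδ
  have ht1 : 0 < 1 - s / δ := sub_pos.2 ((div_lt_one hδ).2 hsδ.2)
  have hmem : M.φ F (z₀ - ((s / δ) / (1 - s / δ)) • w) ∈ M.elem K :=
    M.face_subset_elem hF (M.face_eq F ▸ ⟨_, hs, rfl⟩)
  have := (M.convex_elem K).combo_self_interior_mem_interior hmem hx ht1.le ht0 (by ring)
  convert this using 1
  have h4 : M.φ F (z₀ - ((s / δ) / (1 - s / δ)) • w)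
      = -(((s / δ) / (1 - s / δ)) • (x + δ • n - M.φ F z₀)) + M.φ F z₀ := by
    rw [sub_eq_neg_add, ← vadd_eq_add, AffineMap.map_vadd, map_neg, map_smul, vadd_eq_add, hw]
  have h5 : (1 - s / δ) * ((s / δ) / (1 - s / δ)) = s / δ := by
    rw [mul_div_assoc', mul_div_cancel_left₀ _ ht1.ne']
  have h6 : s / δ * δ = s := by field_simp
  rw [h4, smul_add, smul_neg, smul_smul, h5, smul_sub, smul_add, smul_smul, h6, sub_smul, one_smul]
  abel

omit [Fintype ιF] in
/-- The normals from both sides of an interior face are opposite. -/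
theorem normal_eq_neg_of_ne (hd : 1 ≤ d) {K K' : ιK} (hne : K ≠ K') {F : ιF}
    (hF : M.face F ⊆ frontier (M.elem K)) (hF' : M.face F ⊆ frontier (M.elem K')) :
    M.normal K' F = -M.normal K F := by
  refine (normal_eq_or_eq_neg hd (normal_spec hF).1 (normal_spec hF').1
    (fun y hy => inner_normal_face hF hy) (fun y hy => inner_normal_face hF' hy)).resolve_left
    fun h => ?_
  -- Equal normals would place the same points just below the face in both interiors, which are
  -- disjoint.
  obtain ⟨z₀, hz₀⟩ := M.Fref_solid
  have h1 := eventually_mem_interior hd hF hz₀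
  have h2 := eventually_mem_interior hd hF' hz₀
  rw [h] at h2
  obtain ⟨s, hs1, hs2⟩ := (h1.and h2).exists
  exact Set.disjoint_left.1 (M.disjoint_elem K K' hne) hs1 hs2

end Mesh

end HDG

namespace HDG

open Filter Topology Module

/-! ### The entropy variables and their explicit inverse. -/

section EntropyVariables

variable {d : ℕ}

@[simp] theorem density_mkState (a : ℝ) (b : Fin d → ℝ) (c : ℝ) : density (mkState a b c) = a := rfl

@[simp] theorem momentum_mkState (a : ℝ) (b : Fin d → ℝ) (c : ℝ) (j : Fin d) :
    momentum (mkState a b c) j = b j := rfl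

@[simp] theorem energy_mkState (a : ℝ) (b : Fin d → ℝ) (c : ℝ) : energy (mkState a b c) = c := rfl

@[simp] theorem mkState_inl (a : ℝ) (b : Fin d → ℝ) (c : ℝ) (i : Unit) :
    (mkState a b c : State d) (Sum.inl i) = a := rfl

@[simp] theorem mkState_inr_inl (a : ℝ) (b : Fin d → ℝ) (c : ℝ) (i : Fin d) :
    (mkState a b c : State d) (Sum.inr (Sum.inl i)) = b i := rfl

@[simp] theorem mkState_inr_inr (a : ℝ) (b : Fin d → ℝ) (c : ℝ) (i : Unit) :
    (mkState a b c : State d) (Sum.inr (Sum.inr i)) = c := rfl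

@[simp] theorem density_smul (t : ℝ) (u : State d) : density (t • u) = t * density u := rfl

@[simp] theorem momentum_smul (t : ℝ) (u : State d) (j : Fin d) :
    momentum (t • u) j = t * momentum u j := rfl

@[simp] theorem energy_smul (t : ℝ) (u : State d) : energy (t • u) = t * energy u := rfl

theorem state_ext {u w : State d} (h1 : density u = density w)
    (h2 : ∀ j, momentum u j = momentum w j) (h3 : energy u = energy w) : u = w := by
  ext i
  rcases i with ⟨⟩ | j | ⟨⟩
  exacts [h1, h2 j, h3]

theorem sum_idx (f : Idx d → ℝ) :
    ∑ i, f i = f (Sum.inl ()) + ∑ j, f (Sum.inr (Sum.inl j)) + f (Sum.inr (Sum.inr ())) := by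
  simp [Fintype.sum_sum_type, add_assoc]

theorem dotProduct_state (u w : State d) : u ⬝ᵥ w
    = density u * density w + ∑ j, momentum u j * momentum w j + energy u * energy w :=
  sum_idx _

/-- The velocity as a function of the entropy variables. -/
noncomputable def velV (v : State d) (j : Fin d) : ℝ := -(momentum v j / energy v)

variable (g : Gas d)

/-- The density as a function of the entropy variables. -/
noncomputable def rhoV (v : State d) : ℝ :=
  Real.exp ((Real.log (g.γ - 1) - Real.log (-energy v) - g.γ + density v
    - (∑ j, momentum v j ^ 2) / (2 * energy v) - g.s₀) / (g.γ - 1))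

/-- The conservative variables as an explicit function of the entropy variables. -/
noncomputable def stateV (v : State d) : State d :=
  mkState (rhoV g v) (fun j => rhoV g v * velV v j)
    (rhoV g v * ((∑ j, velV v j ^ 2) / 2 - 1 / energy v))

theorem rhoV_pos (v : State d) : 0 < rhoV g v := Real.exp_pos _

@[simp] theorem density_stateV (v : State d) : density (stateV g v) = rhoV g v := rfl

@[simp] theorem velocity_stateV (v : State d) : velocity (stateV g v) = velV v := by
  ext j
  have := (rhoV_pos g v).ne'
  simp only [velocity, stateV, momentum_mkState, density_mkState]
  field_simp

theorem pressure_stateV (v : State d) :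
    pressure g.γ (stateV g v) = -((g.γ - 1) * rhoV g v / energy v) := by
  simp only [pressure, velocity_stateV, density_stateV]
  simp only [stateV, energy_mkState]
  ring

variable {g} in
theorem gamma_sub_one_pos : 0 < g.γ - 1 := sub_pos.2 g.one_lt_γ

variable {g}

theorem pressure_stateV_pos {v : State d} (hv : energy v < 0) :
    0 < pressure g.γ (stateV g v) := by
  rw [pressure_stateV, ← div_neg]
  exact div_pos (mul_pos gamma_sub_one_pos (rhoV_pos g v)) (neg_pos.2 hv)

theorem stateV_mem_physical {v : State d} (hv : energy v < 0) : stateV g v ∈ physical d g.γ :=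
  ⟨rhoV_pos g v, pressure_stateV_pos hv⟩

/-- The exponent in `rhoV` is what results from solving this relation for log ρ, after inserting p =
-(γ-1)ρ / v_E, where v_E is the energy component of v. -/
theorem thermoEntropy_stateV {v : State d} (hv : energy v < 0) :
    thermoEntropy g (stateV g v)
      = g.γ - density v + (∑ j, momentum v j ^ 2) / (2 * energy v) := by
  have hγ := gamma_sub_one_pos (g := g)
  have hρ := rhoV_pos g v
  rw [thermoEntropy, density_stateV, Real.log_div (pressure_stateV_pos hv).ne'
    (Real.rpow_pos_of_pos hρ _).ne', Real.log_rpow hρ, pressure_stateV, ← div_neg,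
    Real.log_div (mul_pos hγ hρ).ne' (neg_pos.2 hv).ne', Real.log_mul hγ.ne' hρ.ne']
  have hlog : (g.γ - 1) * Real.log (rhoV g v) = Real.log (g.γ - 1) - Real.log (-energy v) - g.γ
      + density v - (∑ j, momentum v j ^ 2) / (2 * energy v) - g.s₀ := by
    rw [rhoV, Real.log_exp]
    field_simp
  linarith

theorem entropyVars_stateV {v : State d} (hv : energy v < 0) :
    entropyVars g (stateV g v) = v := by
  have hγ := (gamma_sub_one_pos (g := g)).ne'
  have hρ := (rhoV_pos g v).ne'
  have hv' := hv.ne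
  refine state_ext ?_ (fun j => ?_) ?_
  · simp only [entropyVars, density_smul, density_mkState, thermoEntropy_stateV hv,
      pressure_stateV]
    simp only [stateV, energy_mkState, velV, neg_sq, div_pow, ← Finset.sum_div]
    field_simp
    ring
  · simp only [entropyVars, momentum_smul, momentum_mkState, velocity_stateV, density_stateV,
      pressure_stateV, velV]
    field_simp
  · simp only [entropyVars, energy_smul, energy_mkState, density_stateV, pressure_stateV]
    field_simp

theorem energy_entropyVars_neg {u : State d} (hu : u ∈ physical d g.γ) :
    energy (entropyVars g u) < 0 := by
  simp only [entropyVars, energy_smul, energy_mkState]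
  have := mul_pos (gamma_sub_one_pos (g := g)) (div_pos hu.1 hu.2)
  linarith

theorem momentum_eq {u : State d} (hu : u ∈ physical d g.γ) (j : Fin d) :
    momentum u j = density u * velocity u j := by
  have := hu.1.ne'
  rw [velocity]
  field_simp

theorem energy_eq (u : State d) :
    energy u = pressure g.γ u / (g.γ - 1) + density u * (∑ j, velocity u j ^ 2) / 2 := by
  have hγ := (gamma_sub_one_pos (g := g)).ne'
  rw [pressure]
  field_simp
  ring

theorem velV_entropyVars {u : State d} (hu : u ∈ physical d g.γ) :
    velV (entropyVars g u) = velocity u := by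
  have hγ := (gamma_sub_one_pos (g := g)).ne'
  have hρ := hu.1.ne'
  have hp := hu.2.ne'
  ext j
  simp only [velV, entropyVars, energy_smul, energy_mkState, momentum_smul, momentum_mkState]
  field_simp

theorem rhoV_entropyVars {u : State d} (hu : u ∈ physical d g.γ) :
    rhoV g (entropyVars g u) = density u := by
  have hγ := gamma_sub_one_pos (g := g)
  have hρ := hu.1
  have hp := hu.2
  have hρ' := hρ.ne'
  have hp' := hp.ne'
  have hγ' := hγ.ne'
  have hE : -energy (entropyVars g u) = (g.γ - 1) * density u / pressure g.γ u := by
    simp only [entropyVars, energy_smul, energy_mkState]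
    ring
  have hK : (∑ j, momentum (entropyVars g u) j ^ 2) / (2 * energy (entropyVars g u))
      = -((g.γ - 1) * density u * (∑ j, velocity u j ^ 2) / (2 * pressure g.γ u)) := by
    simp only [entropyVars, energy_smul, energy_mkState, momentum_smul, momentum_mkState, mul_pow,
      div_pow, ← Finset.mul_sum, ← Finset.sum_div]
    field_simp
  have hD : density (entropyVars g u) = -thermoEntropy g u + (g.γ + 1)
      - 1 - (g.γ - 1) * density u * (∑ j, velocity u j ^ 2) / (2 * pressure g.γ u) := by
    simp only [entropyVars, density_smul, density_mkState]
    rw [energy_eq (g := g) u]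
    field_simp
    ring
  have hS : thermoEntropy g u = Real.log (pressure g.γ u) - g.γ * Real.log (density u) - g.s₀ := by
    rw [thermoEntropy, Real.log_div hp' (Real.rpow_pos_of_pos hρ _).ne', Real.log_rpow hρ]
  rw [rhoV, hE, hK, hD, hS, Real.log_div (mul_pos hγ hρ).ne' hp', Real.log_mul hγ' hρ']
  -- Here a = log (γ-1), b = log ρ, c = log p, and e is the kinetic term.
  rw [show ∀ a b c e : ℝ, (a - (a + b - c) - g.γ + (-(c - g.γ * b - g.s₀) + (g.γ + 1) - 1 - e)
    - -e - g.s₀) / (g.γ - 1) = b by intros; field_simp; ring, Real.exp_log hρ]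

theorem stateV_entropyVars {u : State d} (hu : u ∈ physical d g.γ) :
    stateV g (entropyVars g u) = u := by
  have hγ' := (gamma_sub_one_pos (g := g)).ne'
  have hρ' := hu.1.ne'
  have hp' := hu.2.ne'
  refine state_ext (rhoV_entropyVars hu) (fun j => ?_) ?_
  · rw [stateV, momentum_mkState, velV_entropyVars hu, rhoV_entropyVars hu, momentum_eq hu]
  · rw [stateV, energy_mkState, velV_entropyVars hu, rhoV_entropyVars hu, energy_eq (g := g) u]
    simp only [entropyVars, energy_smul, energy_mkState]
    field_simp
    ring

/-- X_v is an open half-space; its openness and its convexity, which the segments in Σ require, both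
rest on this. -/
theorem mem_physicalV {v : State d} : v ∈ physicalV g ↔ energy v < 0 := by
  constructor
  · rintro ⟨u, hu, rfl⟩
    exact energy_entropyVars_neg hu
  · exact fun hv => ⟨_, stateV_mem_physical hv, entropyVars_stateV hv⟩

/-- The left inverse `stateV_entropyVars` makes `entropyVars` injective on physical states, so the
choice in `Function.invFunOn` is forced. -/
theorem consVars_eq {v : State d} (hv : v ∈ physicalV g) : consVars g v = stateV g v := by
  have h1 : consVars g v ∈ physical d g.γ := Function.invFunOn_mem hv
  have h2 : entropyVars g (consVars g v) = v := Function.invFunOn_eq hv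
  rw [← stateV_entropyVars h1, h2]

theorem consVars_mem {v : State d} (hv : v ∈ physicalV g) : consVars g v ∈ physical d g.γ :=
  Function.invFunOn_mem hv

@[fun_prop]
theorem contDiff_density : ContDiff ℝ 1 (density : State d → ℝ) := contDiff_apply ℝ ℝ _

@[fun_prop]
theorem contDiff_momentum (j : Fin d) : ContDiff ℝ 1 (fun u : State d => momentum u j) :=
  contDiff_apply ℝ ℝ _

@[fun_prop]
theorem contDiff_energy : ContDiff ℝ 1 (energy : State d → ℝ) := contDiff_apply ℝ ℝ _

theorem isOpen_physicalV : IsOpen (physicalV g) := by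
  have : physicalV g = {v | energy v < 0} := Set.ext fun v => mem_physicalV
  rw [this]
  exact isOpen_lt contDiff_energy.continuous continuous_const

theorem convex_physicalV : Convex ℝ (physicalV g) := by
  intro v hv w hw a b ha hb hab
  rw [mem_physicalV] at *
  change a * energy v + b * energy w < 0
  rcases ha.eq_or_lt with rfl | ha
  · have : b = 1 := by linarith
    subst this
    linarith
  · nlinarith [mul_neg_of_pos_of_neg ha hv]

theorem contDiffOn_rhoV : ContDiffOn ℝ 1 (rhoV g) (physicalV g) := by
  intro v hv
  rw [mem_physicalV] at hv
  have h1 : -energy v ≠ 0 := neg_ne_zero.2 hv.ne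
  have h2 : 2 * energy v ≠ 0 := mul_ne_zero two_ne_zero hv.ne
  refine ContDiffAt.contDiffWithinAt ?_
  unfold rhoV
  refine ContDiffAt.exp (ContDiffAt.div_const ?_ _)
  refine ContDiffAt.sub (ContDiffAt.sub (ContDiffAt.add (ContDiffAt.sub (ContDiffAt.sub
    contDiffAt_const (ContDiffAt.log (by fun_prop) h1)) contDiffAt_const) (by fun_prop))
    (ContDiffAt.div (by fun_prop) (by fun_prop) h2)) contDiffAt_const

theorem contDiffOn_velV (j : Fin d) : ContDiffOn ℝ 1 (fun v => velV v j) (physicalV g) := by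
  intro v hv
  rw [mem_physicalV] at hv
  refine ContDiffAt.contDiffWithinAt ?_
  unfold velV
  exact (ContDiffAt.div (by fun_prop) (by fun_prop) hv.ne).neg

theorem contDiffOn_stateV : ContDiffOn ℝ 1 (stateV g) (physicalV g) := by
  rw [contDiffOn_pi]
  rintro (_ | j | _)
  · exact contDiffOn_rhoV
  · exact contDiffOn_rhoV.mul (contDiffOn_velV j)
  · refine contDiffOn_rhoV.mul (((ContDiffOn.sum fun j _ => (contDiffOn_velV j).pow 2).div_const
      2).sub ?_)
    intro v hv
    rw [mem_physicalV] at hv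
    refine ContDiffAt.contDiffWithinAt ?_
    exact ContDiffAt.div (by fun_prop) (by fun_prop) hv.ne

theorem contDiffOn_consVars : ContDiffOn ℝ 1 (consVars g) (physicalV g) :=
  contDiffOn_stateV.congr fun _ hv => consVars_eq hv

theorem differentiableAt_of_contDiffOn {A B : Type*} [NormedAddCommGroup A] [NormedSpace ℝ A]
    [NormedAddCommGroup B] [NormedSpace ℝ B] {f : A → B} {s : Set A} (hf : ContDiffOn ℝ 1 f s)
    (hs : IsOpen s) {x : A} (hx : x ∈ s) : DifferentiableAt ℝ f x :=
  (hf.contDiffAt (hs.mem_nhds hx)).differentiableAt one_ne_zero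

/-- Derivatives in entropy variables are computed along lines v + t w, where one-variable rules
apply. -/
theorem hasFDerivAt_comp_line {A : Type*} [NormedAddCommGroup A] [NormedSpace ℝ A] {f : A → ℝ}
    {v w : A} {a : ℝ} (hf : DifferentiableAt ℝ f v)
    (h : HasDerivAt (fun t : ℝ => f (v + t • w)) a 0) : fderiv ℝ f v w = a := by
  have h1 : HasDerivAt (fun t : ℝ => v + t • w) w 0 := by
    simpa using ((hasDerivAt_id (0 : ℝ)).smul_const w).const_add v
  have h2 : HasFDerivAt f (fderiv ℝ f v) (v + (0 : ℝ) • w) := by simpa using hf.hasFDerivAt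
  exact (h2.comp_hasDerivAt (0 : ℝ) h1).unique h

/-- The derivative of the velocity along a line. -/
theorem hasDerivAt_velV {v : State d} (hv : v ∈ physicalV g) (w : State d) (j : Fin d) :
    HasDerivAt (fun t : ℝ => velV (v + t • w) j)
      (-((momentum w j + velV v j * energy w) / energy v)) 0 := by
  rw [mem_physicalV] at hv
  have h1 : HasDerivAt (fun t : ℝ => momentum (v + t • w) j) (momentum w j) 0 := by
    simpa [momentum] using ((hasDerivAt_id (0 : ℝ)).mul_const (momentum w j)).const_add (momentum v j)
  have h2 : HasDerivAt (fun t : ℝ => energy (v + t • w)) (energy w) 0 := by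
    simpa [energy] using ((hasDerivAt_id (0 : ℝ)).mul_const (energy w)).const_add (energy v)
  have h3 := (h1.div h2 (by simpa using hv.ne)).neg
  refine h3.congr_deriv ?_
  have := hv.ne
  simp only [zero_smul, add_zero, velV]
  field_simp
  ring

/-- The bracket times ρ is u(v) · w. Thus (γ-1)ρ is a potential whose gradient in v is the state
u(v): the Legendre dual of H. -/
theorem hasDerivAt_rhoV {v : State d} (hv : v ∈ physicalV g) (w : State d) :
    HasDerivAt (fun t : ℝ => rhoV g (v + t • w)) (rhoV g v / (g.γ - 1) * (density w
      + ∑ j, velV v j * momentum w j + ((∑ j, velV v j ^ 2) / 2 - 1 / energy v) * energy w)) 0 := by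
  rw [mem_physicalV] at hv
  have h0 : HasDerivAt (fun t : ℝ => density (v + t • w)) (density w) 0 := by
    simpa [density] using ((hasDerivAt_id (0 : ℝ)).mul_const (density w)).const_add (density v)
  have h1 (j : Fin d) : HasDerivAt (fun t : ℝ => momentum (v + t • w) j) (momentum w j) 0 := by
    simpa [momentum] using ((hasDerivAt_id (0 : ℝ)).mul_const (momentum w j)).const_add (momentum v j)
  have h2 : HasDerivAt (fun t : ℝ => energy (v + t • w)) (energy w) 0 := by
    simpa [energy] using ((hasDerivAt_id (0 : ℝ)).mul_const (energy w)).const_add (energy v)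
  have h3 : HasDerivAt (fun t : ℝ => ∑ j, momentum (v + t • w) j ^ 2)
      (∑ j, 2 * momentum v j * momentum w j) 0 := by
    refine HasDerivAt.fun_sum fun j _ => ?_
    have := (h1 j).mul (h1 j)
    simp only [zero_smul, add_zero] at this
    simp_rw [pow_two]
    exact this.congr_deriv (by ring)
  have h4 := (((((h2.neg.log (by simpa using hv.ne)).const_sub (Real.log (g.γ - 1))).sub_const
    g.γ).add h0).sub (h3.div (h2.const_mul 2) (by simpa using hv.ne))).sub_const g.s₀
  have h5 : HasDerivAt (fun t : ℝ => rhoV g (v + t • w)) _ 0 := (h4.div_const (g.γ - 1)).exp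
  refine h5.congr_deriv ?_
  have hv' := hv.ne
  have hγ := (gamma_sub_one_pos (g := g)).ne'
  simp only [zero_smul, add_zero, Pi.add_apply, Pi.sub_apply, Pi.neg_apply, Pi.div_apply]
  rw [rhoV]
  generalize Real.exp _ = X
  have e1 : ∑ j, 2 * momentum v j * momentum w j = 2 * ∑ j, momentum v j * momentum w j := by
    simp_rw [mul_assoc, Finset.mul_sum]
  have e2 : ∑ j, velV v j * momentum w j = -((∑ j, momentum v j * momentum w j) / energy v) := by
    rw [Finset.sum_div, ← Finset.sum_neg_distrib]
    exact Finset.sum_congr rfl fun j _ => by rw [velV]; ring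
  have e3 : ∑ j, velV v j ^ 2 = (∑ j, momentum v j ^ 2) / energy v ^ 2 := by
    rw [Finset.sum_div]
    exact Finset.sum_congr rfl fun j _ => by rw [velV]; ring
  rw [e1, e2, e3]
  field_simp
  ring

end EntropyVariables

end HDG

namespace HDG

open Filter Topology Module

/-! ### The inviscid flux, its potential and the matrix Σ. -/

section InviscidFlux

variable {d : ℕ} {g : Gas d}

theorem contDiffAt_velocity {u : State d} (hu : density u ≠ 0) (j : Fin d) :
    ContDiffAt ℝ 1 (fun w : State d => velocity w j) u := by
  unfold velocity
  exact ContDiffAt.div (by fun_prop) (by fun_prop) hu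

theorem contDiffAt_pressure (γ : ℝ) {u : State d} (hu : density u ≠ 0) :
    ContDiffAt ℝ 1 (fun w : State d => pressure γ w) u := by
  unfold pressure
  refine contDiffAt_const.mul (ContDiffAt.sub (by fun_prop) (ContDiffAt.div_const
    (ContDiffAt.mul (by fun_prop) ?_) _))
  exact ContDiffAt.sum fun j _ => (contDiffAt_velocity hu j).pow 2

theorem contDiffAt_invFlux {u : State d} (hu : density u ≠ 0) (i : Idx d) (j : Fin d) :
    ContDiffAt ℝ 1 (fun w : State d => invFlux g w i j) u := by
  have hρ : ContDiffAt ℝ 1 (fun w : State d => density w) u := by fun_prop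
  have hE : ContDiffAt ℝ 1 (fun w : State d => energy w) u := by fun_prop
  have hV := contDiffAt_velocity hu
  have hp := contDiffAt_pressure g.γ hu
  rcases i with _ | l | _
  · exact hρ.mul (hV j)
  · refine ((hρ.mul (hV l)).mul (hV j)).add ?_
    by_cases h : l = j
    · simpa [h] using hp
    · simpa [h] using contDiffAt_const
  · exact (hV j).mul (hE.add hp)

theorem contDiffOn_invFlux_consVars (i : Idx d) (j : Fin d) :
    ContDiffOn ℝ 1 (fun v => invFlux g (consVars g v) i j) (physicalV g) := fun v hv =>
  (contDiffAt_invFlux (consVars_mem hv).1.ne' i j).comp_contDiffWithinAt v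
    (contDiffOn_consVars v hv)

theorem contDiffOn_invFluxN (n : E d) : ContDiffOn ℝ 1 (invFluxN g n) (physicalV g) :=
  contDiffOn_pi.2 fun i => ContDiffOn.sum fun j _ =>
    (contDiffOn_invFlux_consVars i j).mul contDiffOn_const

theorem A0_mulVec (v w : State d) (l : Idx d) :
    ∑ s, A0 g v l s * w s = fderiv ℝ (consVars g) v w l := by
  conv_rhs => rw [← Finset.univ_sum_single w, map_sum, Finset.sum_apply]
  refine Finset.sum_congr rfl fun s _ => ?_
  have : (Pi.single s (w s) : State d) = w s • Pi.single s 1 := by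
    rw [← Pi.single_smul, smul_eq_mul, mul_one]
  rw [this, map_smul, Pi.smul_apply, smul_eq_mul, mul_comm]
  rfl

/-- Chain rule: Ã_n is the Jacobian of v ↦ F_n(v), so that its integrals along segments can be
evaluated by parts. -/
theorem AnTilde_apply (n : E d) {v : State d} (hv : v ∈ physicalV g) (i s : Idx d) :
    AnTilde g n v i s = fderiv ℝ (invFluxN g n) v (Pi.single s 1) i := by
  have hc : HasFDerivAt (consVars g) (fderiv ℝ (consVars g) v) v :=
    (differentiableAt_of_contDiffOn contDiffOn_consVars isOpen_physicalV hv).hasFDerivAt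
  have hF (j : Fin d) : HasFDerivAt (fun w : State d => invFlux g w i j)
      (fderiv ℝ (fun w : State d => invFlux g w i j) (consVars g v)) (consVars g v) :=
    ((contDiffAt_invFlux (consVars_mem hv).1.ne' i j).differentiableAt one_ne_zero).hasFDerivAt
  have hN := HasFDerivAt.fun_sum (u := Finset.univ) fun j _ => ((hF j).comp v hc).mul_const (n j)
  have hd := differentiableAt_of_contDiffOn (contDiffOn_invFluxN (g := g) n) isOpen_physicalV hv
  have h := DFunLike.congr_fun ((hasFDerivAt_pi'.1 hd.hasFDerivAt i).unique hN) (Pi.single s 1)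
  refine Eq.trans ?_ h.symm
  simp only [AnTilde, Matrix.mul_apply, An, Matrix.of_apply, sum_apply, smul_apply,
    ContinuousLinearMap.comp_apply, smul_eq_mul, Finset.sum_mul]
  rw [Finset.sum_comm]
  refine Finset.sum_congr rfl fun j _ => ?_
  have hlin (L : State d →L[ℝ] ℝ) (w : State d) : L w = ∑ l, L (Pi.single l 1) * w l := by
    conv_lhs => rw [← Finset.univ_sum_single w, map_sum]
    refine Finset.sum_congr rfl fun l _ => ?_
    have : (Pi.single l (w l) : State d) = w l • Pi.single l 1 := by
      rw [← Pi.single_smul, smul_eq_mul, mul_one]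
    rw [this, map_smul, smul_eq_mul, mul_comm]
  rw [hlin, Finset.mul_sum]
  refine Finset.sum_congr rfl fun l _ => ?_
  simp only [A0, Matrix.of_apply]
  ring

/-- The potential of the inviscid flux in direction `j`. -/
noncomputable def fluxPotential (g : Gas d) (j : Fin d) (v : State d) : ℝ :=
  (g.γ - 1) * (rhoV g v * velV v j)

theorem contDiffOn_fluxPotential (j : Fin d) :
    ContDiffOn ℝ 1 (fluxPotential g j) (physicalV g) :=
  contDiffOn_const.mul (contDiffOn_rhoV.mul (contDiffOn_velV j))

/-- The structural fact behind the inviscid balance: F_j is a gradient in entropy variables. It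
makes F(v) : ∇v a divergence and F_n · δ an exact derivative along segments. -/
theorem fderiv_fluxPotential {v : State d} (hv : v ∈ physicalV g) (w : State d) (j : Fin d) :
    fderiv ℝ (fluxPotential g j) v w = ∑ i, invFlux g (consVars g v) i j * w i := by
  refine hasFDerivAt_comp_line (differentiableAt_of_contDiffOn (contDiffOn_fluxPotential j)
    isOpen_physicalV hv) ?_
  have h := ((hasDerivAt_rhoV hv w).mul (hasDerivAt_velV hv w j)).const_mul (g.γ - 1)
  refine HasDerivAt.congr_deriv h ?_
  have hv' := (mem_physicalV.1 hv).ne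
  have hγ := (gamma_sub_one_pos (g := g)).ne'
  rw [consVars_eq hv, sum_idx]
  simp only [invFlux, mkState_inl, mkState_inr_inl, mkState_inr_inr, velocity_stateV,
    density_stateV, pressure_stateV, zero_smul, add_zero]
  simp only [stateV, energy_mkState]
  change _ = rhoV g v * velV v j * density w + ∑ l, (_ : ℝ) * momentum w l + _ * energy w
  have e : ∑ l, (rhoV g v * velV v l * velV v j
        + if l = j then -((g.γ - 1) * rhoV g v / energy v) else 0) * momentum w l
      = rhoV g v * velV v j * (∑ l, velV v l * momentum w l)
        - (g.γ - 1) * rhoV g v / energy v * momentum w j := by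
    simp_rw [add_mul, Finset.sum_add_distrib, ite_mul, zero_mul, Finset.sum_ite_eq',
      Finset.mul_sum, Finset.mem_univ, if_true]
    rw [neg_mul, ← sub_eq_add_neg]
    congr 1
    exact Finset.sum_congr rfl fun l _ => by ring
  rw [e]
  field_simp
  ring

/-- Relates the closed form of the potential to the entropy flux, which is how the latter enters the
boundary term. -/
theorem fluxPotential_eq {v : State d} (hv : v ∈ physicalV g) (j : Fin d) :
    ∑ i, v i * invFlux g (consVars g v) i j - entropyFlux g (consVars g v) j
      = fluxPotential g j v := by
  have hv' := (mem_physicalV.1 hv).ne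
  rw [consVars_eq hv, sum_idx, entropyFlux, entropy, thermoEntropy_stateV (mem_physicalV.1 hv)]
  simp only [invFlux, mkState_inl, mkState_inr_inl, mkState_inr_inr, velocity_stateV,
    density_stateV, pressure_stateV]
  simp only [stateV, energy_mkState]
  change density v * _ + ∑ l, momentum v l * _ + energy v * _ - _ = _
  have e1 : ∑ l, momentum v l * (rhoV g v * velV v l * velV v j
        + if l = j then -((g.γ - 1) * rhoV g v / energy v) else 0)
      = -(rhoV g v * velV v j * (∑ l, momentum v l ^ 2) / energy v)
        - (g.γ - 1) * rhoV g v / energy v * momentum v j := by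
    simp_rw [mul_add, Finset.sum_add_distrib, mul_ite, mul_zero, Finset.sum_ite_eq',
      Finset.mem_univ, if_true]
    rw [mul_neg, ← sub_eq_add_neg, mul_comm (momentum v j), Finset.mul_sum, Finset.sum_div,
      ← Finset.sum_neg_distrib]
    congr 1
    exact Finset.sum_congr rfl fun l _ => by rw [velV]; ring
  have e2 : ∑ j, velV v j ^ 2 = (∑ j, momentum v j ^ 2) / energy v ^ 2 := by
    rw [Finset.sum_div]
    exact Finset.sum_congr rfl fun j _ => by rw [velV]; ring
  rw [e1, e2, fluxPotential]
  have e3 : momentum v j = -(velV v j * energy v) := by rw [velV]; field_simp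
  rw [e3]
  field_simp
  ring

theorem fluxPotentialN_eq (n : E d) {v : State d} (hv : v ∈ physicalV g) :
    v ⬝ᵥ invFluxN g n v - entropyFluxN g n v = ∑ j, fluxPotential g j v * n j := by
  simp only [dotProduct, invFluxN, entropyFluxN, Finset.mul_sum]
  rw [Finset.sum_comm, ← Finset.sum_sub_distrib]
  refine Finset.sum_congr rfl fun j _ => ?_
  rw [← fluxPotential_eq hv, sub_mul, Finset.sum_mul]
  congr 1
  exact Finset.sum_congr rfl fun i _ => by ring

theorem path_mem {v w : State d} (hv : v ∈ physicalV g) (hw : w ∈ physicalV g) {θ : ℝ}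
    (hθ : θ ∈ Set.Icc (0 : ℝ) 1) : path v w θ ∈ physicalV g :=
  convex_physicalV.add_smul_sub_mem hv hw hθ

/-- The entropy conservation defect of the central flux is measured by `Σ`. -/
theorem dotProduct_Sig (n : E d) {v w : State d} (hv : v ∈ physicalV g) (hw : w ∈ physicalV g) :
    (w - v) ⬝ᵥ Matrix.mulVec (Sig g v w n) (w - v)
      = 2 * (∑ j, fluxPotential g j w * n j - ∑ j, fluxPotential g j v * n j)
        - (invFluxN g n v + invFluxN g n w) ⬝ᵥ (w - v) := by
  set δ := w - v with hδ
  have hpath (θ : ℝ) : HasDerivAt (path v w) δ θ := by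
    unfold path
    simpa using ((hasDerivAt_id θ).smul_const δ).const_add v
  have hrev (θ : ℝ) : path w v θ = path v w (1 - θ) := by
    simp only [path]; module
  have hpathc : Continuous (path v w) := continuous_iff_continuousAt.2 fun θ => (hpath θ).continuousAt
  have hD : ContinuousOn (fun θ => fderiv ℝ (invFluxN g n) (path v w θ)) (Set.Icc 0 1) :=
    ((contDiffOn_invFluxN n).continuousOn_fderiv_of_isOpen isOpen_physicalV le_rfl).comp
      hpathc.continuousOn fun θ hθ => path_mem hv hw hθ
  have hA (i s : Idx d) :
      ContinuousOn (fun θ => AnTilde g n (path v w θ) i s) (Set.Icc (0 : ℝ) 1) := by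
    have h : ContinuousOn (fun θ => fderiv ℝ (invFluxN g n) (path v w θ) (Pi.single s 1) i)
        (Set.Icc 0 1) :=
      (continuous_apply i).comp_continuousOn (hD.clm_apply continuousOn_const)
    exact h.congr fun θ hθ => AnTilde_apply n (path_mem hv hw hθ) i s
  have hrefl : ContinuousOn (fun θ : ℝ => 1 - θ) (Set.Icc (0 : ℝ) 1) := by fun_prop
  have hmaps : Set.MapsTo (fun θ : ℝ => 1 - θ) (Set.Icc (0 : ℝ) 1) (Set.Icc 0 1) :=
    fun θ hθ => ⟨by linarith [hθ.2], by linarith [hθ.1]⟩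
  -- a is the derivative of θ ↦ F_n · δ along the segment. The reversed segment contributes a(1-θ),
  -- so Σ reduces to integrals of a with weights 1-θ and θ.
  let a : ℝ → ℝ := fun θ => ∑ i, ∑ s, δ i * AnTilde g n (path v w θ) i s * δ s
  have hac : ContinuousOn a (Set.Icc 0 1) := by
    refine continuousOn_finsetSum _ fun i _ => continuousOn_finsetSum _ fun s _ => ?_
    exact (continuousOn_const.mul (hA i s)).mul continuousOn_const
  have hint {f : ℝ → ℝ} (hf : ContinuousOn f (Set.Icc 0 1)) : IntervalIntegrable f volume 0 1 := by
    refine ContinuousOn.intervalIntegrable ?_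
    rwa [Set.uIcc_of_le zero_le_one]
  have hQ : ContinuousOn (fun θ => invFluxN g n (path v w θ) ⬝ᵥ δ) (Set.Icc 0 1) := by
    have h : ContinuousOn (fun θ => invFluxN g n (path v w θ)) (Set.Icc 0 1) :=
      (contDiffOn_invFluxN n).continuousOn.comp hpathc.continuousOn
        fun θ hθ => path_mem hv hw hθ
    exact continuousOn_finsetSum _ fun i _ =>
      ((continuous_apply i).comp_continuousOn h).mul continuousOn_const
  have hQ' {θ : ℝ} (hθ : θ ∈ Set.Icc (0 : ℝ) 1) :
      HasDerivAt (fun θ => invFluxN g n (path v w θ) ⬝ᵥ δ) (a θ) θ := by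
    have h1 := (differentiableAt_of_contDiffOn (contDiffOn_invFluxN n) isOpen_physicalV
      (path_mem (g := g) hv hw hθ)).hasFDerivAt.comp_hasDerivAt θ (hpath θ)
    have h2 := HasDerivAt.fun_sum (u := Finset.univ)
      fun i _ => ((hasDerivAt_pi.1 h1 i).mul_const (δ i))
    refine HasDerivAt.congr_deriv h2 (Finset.sum_congr rfl fun i _ => ?_)
    conv_lhs => rw [← Finset.univ_sum_single δ, map_sum, Finset.sum_apply, Finset.sum_mul]
    refine Finset.sum_congr rfl fun s _ => ?_
    have : (Pi.single s (δ s) : State d) = δ s • Pi.single s 1 := by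
      rw [← Pi.single_smul, smul_eq_mul, mul_one]
    rw [Finset.univ_sum_single, this, map_smul, Pi.smul_apply, smul_eq_mul,
      ← AnTilde_apply n (path_mem hv hw hθ)]
    ring
  have hflux : ∫ θ in (0 : ℝ)..1, invFluxN g n (path v w θ) ⬝ᵥ δ
      = ∑ j, fluxPotential g j w * n j - ∑ j, fluxPotential g j v * n j := by
    have h1 := intervalIntegral.integral_eq_sub_of_hasDerivAt (a := 0) (b := 1)
      (f := fun θ => ∑ j, fluxPotential g j (path v w θ) * n j)
      (f' := fun θ => invFluxN g n (path v w θ) ⬝ᵥ δ) ?_ (hint hQ)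
    · rw [h1]
      simp [path]
    · intro θ hθ
      rw [Set.uIcc_of_le zero_le_one] at hθ
      have hm := path_mem (g := g) hv hw hθ
      have h2 := HasDerivAt.fun_sum (u := Finset.univ) fun j _ =>
        ((differentiableAt_of_contDiffOn (contDiffOn_fluxPotential (g := g) j) isOpen_physicalV
          hm).hasFDerivAt.comp_hasDerivAt θ (hpath θ)).mul_const (n j)
      refine HasDerivAt.congr_deriv h2 ?_
      simp only [dotProduct, invFluxN, Finset.sum_mul]
      rw [Finset.sum_comm]
      refine Finset.sum_congr rfl fun j _ => ?_
      rw [fderiv_fluxPotential hm, Finset.sum_mul]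
      exact Finset.sum_congr rfl fun i _ => by ring
  -- By parts, the weight 1-θ leaves the flux at v and the weight θ the flux at w; both leave ∫ F_n
  -- · δ, which is the jump of the potential.
  have hparts : ∫ θ in (0 : ℝ)..1, (1 - θ) * a θ = -(invFluxN g n v ⬝ᵥ δ)
      + ∫ θ in (0 : ℝ)..1, invFluxN g n (path v w θ) ⬝ᵥ δ := by
    have h := intervalIntegral.integral_mul_deriv_eq_deriv_mul (a := 0) (b := 1)
      (u := fun θ : ℝ => 1 - θ) (u' := fun _ => -1) (v := fun θ => invFluxN g n (path v w θ) ⬝ᵥ δ)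
      (v' := a) (fun θ _ => by simpa using (hasDerivAt_id θ).const_sub 1)
      (fun θ hθ => hQ' (by rwa [Set.uIcc_of_le zero_le_one] at hθ)) (by simp) (hint hac)
    rw [h]
    simp [path]
  have hparts' : ∫ θ in (0 : ℝ)..1, θ * a θ = (invFluxN g n w ⬝ᵥ δ)
      - ∫ θ in (0 : ℝ)..1, invFluxN g n (path v w θ) ⬝ᵥ δ := by
    have h := intervalIntegral.integral_mul_deriv_eq_deriv_mul (a := 0) (b := 1)
      (u := fun θ : ℝ => θ) (u' := fun _ => 1) (v := fun θ => invFluxN g n (path v w θ) ⬝ᵥ δ)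
      (v' := a) (fun θ _ => hasDerivAt_id θ)
      (fun θ hθ => hQ' (by rwa [Set.uIcc_of_le zero_le_one] at hθ)) (by simp) (hint hac)
    rw [h]
    simp [path, hδ]
  have hSig : δ ⬝ᵥ Matrix.mulVec (Sig g v w n) δ
      = ∫ θ in (0 : ℝ)..1, ((1 - θ) * a θ - (1 - θ) * a (1 - θ)) := by
    have hcont (i s : Idx d) : ContinuousOn (fun θ : ℝ => δ i * ((1 - θ) *
        (AnTilde g n (path v w θ) i s - AnTilde g n (path w v θ) i s)) * δ s) (Set.Icc 0 1) := by
      simp_rw [hrev]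
      exact (continuousOn_const.mul (hrefl.mul ((hA i s).sub ((hA i s).comp hrefl hmaps)))).mul
        continuousOn_const
    have h1 : ∀ θ : ℝ, (1 - θ) * a θ - (1 - θ) * a (1 - θ) = ∑ i, ∑ s, δ i * ((1 - θ) *
        (AnTilde g n (path v w θ) i s - AnTilde g n (path w v θ) i s)) * δ s := by
      intro θ
      simp only [a, hrev, Finset.mul_sum, ← Finset.sum_sub_distrib]
      exact Finset.sum_congr rfl fun i _ => Finset.sum_congr rfl fun s _ => by ring
    simp_rw [h1]
    rw [intervalIntegral.integral_finsetSum fun i _ => hint (continuousOn_finsetSum _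
      fun s _ => hcont i s)]
    refine Finset.sum_congr rfl fun i _ => ?_
    rw [intervalIntegral.integral_finsetSum fun s _ => hint (hcont i s), Matrix.mulVec, dotProduct,
      Finset.mul_sum]
    refine Finset.sum_congr rfl fun s _ => ?_
    rw [intervalIntegral.integral_mul_const, intervalIntegral.integral_const_mul, Sig,
      Matrix.of_apply]
    ring
  rw [hSig, intervalIntegral.integral_sub (f := fun θ => (1 - θ) * a θ)
    (g := fun θ => (1 - θ) * a (1 - θ)) (hint (hrefl.mul hac))
    (hint (hrefl.mul (hac.comp hrefl hmaps))), hparts,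
    intervalIntegral.integral_comp_sub_left (fun θ => θ * a θ) 1]
  rw [sub_self, sub_zero, hparts', hflux, add_dotProduct]
  ring

/-- The entropy as a function of the entropy variables. -/
theorem entropy_consVars {v : State d} (hv : v ∈ physicalV g) :
    entropy g (consVars g v) = v ⬝ᵥ stateV g v - (g.γ - 1) * rhoV g v := by
  have hv' := (mem_physicalV.1 hv).ne
  rw [consVars_eq hv, entropy, thermoEntropy_stateV (mem_physicalV.1 hv), dotProduct_state]
  simp only [stateV, energy_mkState, density_mkState, momentum_mkState]
  have e1 : ∑ l, momentum v l * (rhoV g v * velV v l)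
      = -(rhoV g v * (∑ l, momentum v l ^ 2) / energy v) := by
    rw [Finset.mul_sum, Finset.sum_div, ← Finset.sum_neg_distrib]
    exact Finset.sum_congr rfl fun l _ => by rw [velV]; ring
  have e2 : ∑ j, velV v j ^ 2 = (∑ j, momentum v j ^ 2) / energy v ^ 2 := by
    rw [Finset.sum_div]
    exact Finset.sum_congr rfl fun j _ => by rw [velV]; ring
  rw [e1, e2]
  field_simp
  ring

theorem contDiffOn_entropy : ContDiffOn ℝ 1 (fun v => entropy g (consVars g v)) (physicalV g) := by
  refine ContDiffOn.congr ?_ fun v hv => entropy_consVars hv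
  refine ContDiffOn.sub (ContDiffOn.sum fun i _ => ?_) (contDiffOn_const.mul contDiffOn_rhoV)
  exact (contDiff_apply ℝ ℝ i).contDiffOn.mul (contDiffOn_pi.1 contDiffOn_stateV i)

theorem fderiv_rhoV {v : State d} (hv : v ∈ physicalV g) (w : State d) :
    fderiv ℝ (fun v => (g.γ - 1) * rhoV g v) v w = stateV g v ⬝ᵥ w := by
  refine hasFDerivAt_comp_line (differentiableAt_of_contDiffOn
    (contDiffOn_const.mul contDiffOn_rhoV) isOpen_physicalV hv) ?_
  refine HasDerivAt.congr_deriv ((hasDerivAt_rhoV hv w).const_mul (g.γ - 1)) ?_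
  have hγ := (gamma_sub_one_pos (g := g)).ne'
  rw [dotProduct_state]
  simp only [stateV, energy_mkState, density_mkState, momentum_mkState]
  simp_rw [mul_assoc, ← Finset.mul_sum]
  field_simp

/-- The entropy variables are the derivative of the entropy, along a curve of states. -/
theorem hasDerivAt_entropy {v : ℝ → State d} {t : ℝ} (hv : v t ∈ physicalV g)
    (hd : DifferentiableAt ℝ v t) :
    HasDerivAt (fun s => entropy g (consVars g (v s)))
      (deriv (fun s => consVars g (v s)) t ⬝ᵥ v t) t := by
  have hev : ∀ᶠ s in 𝓝 t, v s ∈ physicalV g := hd.continuousAt (isOpen_physicalV.mem_nhds hv)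
  have hu : HasDerivAt (fun s => stateV g (v s)) (deriv (fun s => stateV g (v s)) t) t :=
    ((differentiableAt_of_contDiffOn contDiffOn_stateV isOpen_physicalV hv).comp t hd).hasDerivAt
  have hr := (differentiableAt_of_contDiffOn (contDiffOn_const.mul contDiffOn_rhoV)
    isOpen_physicalV hv : DifferentiableAt ℝ (fun v => (g.γ - 1) * rhoV g v)
      (v t)).hasFDerivAt.comp_hasDerivAt t hd.hasDerivAt
  rw [fderiv_rhoV hv] at hr
  have hp : HasDerivAt (fun s => v s ⬝ᵥ stateV g (v s))
      (deriv v t ⬝ᵥ stateV g (v t) + v t ⬝ᵥ deriv (fun s => stateV g (v s)) t) t := by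
    have := HasDerivAt.fun_sum (u := Finset.univ) fun i _ =>
      ((hasDerivAt_pi.1 hd.hasDerivAt i).mul (hasDerivAt_pi.1 hu i))
    refine HasDerivAt.congr_deriv this ?_
    simp [dotProduct, Finset.sum_add_distrib]
  have hc : (fun s => consVars g (v s)) =ᶠ[𝓝 t] fun s => stateV g (v s) :=
    hev.mono fun s hs => consVars_eq hs
  rw [hc.deriv_eq]
  refine HasDerivAt.congr_of_eventuallyEq (HasDerivAt.congr_deriv (hp.sub hr) ?_)
    (hev.mono fun s hs => entropy_consVars hs)
  -- H = v · u - (γ-1)ρ: the term v' · u cancels the derivative of (γ-1)ρ, and v · u' remains.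
  rw [dotProduct_comm (deriv v t), dotProduct_comm (v t)]
  ring

end InviscidFlux

end HDG

namespace HDG

open Filter Topology Module

/-! ### The viscous flux and the matrix K̃. -/

section Viscous

variable {d : ℕ} {g : Gas d}

/-- The viscous stress as a function of the velocity gradient. -/
noncomputable def stressOf (μ β : ℝ) (W : Fin d → Fin d → ℝ) (i j : Fin d) : ℝ :=
  μ * (W i j + W j i - 2 / 3 * (∑ k, W k k) * (if i = j then 1 else 0))
    + β * (∑ k, W k k) * (if i = j then 1 else 0)

theorem stress_eq (u : State d) (du : Grad d) :
    stress g u du = stressOf (g.μ u) (g.β u) (gradVel u du) := rfl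

/-- Separates the gradient part from the trace part, from which symmetry and sign can be read off.
-/
theorem stressOf_form (μ β : ℝ) (W Z : Fin d → Fin d → ℝ) :
    ∑ i, ∑ j, Z i j * stressOf μ β W i j
      = μ * ((∑ i, ∑ j, Z i j * (W i j + W j i)) - 2 / 3 * ((∑ k, W k k) * ∑ k, Z k k))
        + β * ((∑ k, W k k) * ∑ k, Z k k) := by
  have h (c : ℝ) : ∑ i, ∑ j, Z i j * (c * if i = j then (1 : ℝ) else 0) = c * ∑ k, Z k k := by
    simp only [mul_ite, mul_one, mul_zero, Finset.sum_ite_eq, Finset.mem_univ, if_true]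
    rw [← Finset.sum_mul, mul_comm]
  have e (i j : Fin d) : Z i j * stressOf μ β W i j = μ * (Z i j * (W i j + W j i))
      - Z i j * ((μ * (2 / 3) * ∑ k, W k k) * if i = j then (1 : ℝ) else 0)
      + Z i j * ((β * ∑ k, W k k) * if i = j then (1 : ℝ) else 0) := by
    rw [stressOf]; ring
  simp_rw [e, Finset.sum_add_distrib, Finset.sum_sub_distrib, h, ← Finset.mul_sum]
  ring

theorem stressOf_form_symm (μ β : ℝ) (W Z : Fin d → Fin d → ℝ) :
    ∑ i, ∑ j, Z i j * stressOf μ β W i j = ∑ i, ∑ j, W i j * stressOf μ β Z i j := by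
  rw [stressOf_form, stressOf_form]
  have : ∑ i, ∑ j, Z i j * (W i j + W j i) = ∑ i, ∑ j, W i j * (Z i j + Z j i) := by
    simp_rw [mul_add, Finset.sum_add_distrib]
    congr 1
    · exact Finset.sum_congr rfl fun i _ => Finset.sum_congr rfl fun j _ => mul_comm _ _
    · rw [Finset.sum_comm]
      exact Finset.sum_congr rfl fun i _ => Finset.sum_congr rfl fun j _ => mul_comm _ _
  rw [this]
  ring

/-- The symmetrised square dominates its diagonal part 2 ∑ W_kk², while Cauchy-Schwarz gives (tr W)²
≤ d ∑ W_kk² ≤ 3 ∑ W_kk². This is exactly what the coefficient 2/3 allows. -/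
theorem stressOf_form_nonneg (hd : d ≤ 3) {μ β : ℝ} (hμ : 0 ≤ μ) (hβ : 0 ≤ β)
    (W : Fin d → Fin d → ℝ) : 0 ≤ ∑ i, ∑ j, W i j * stressOf μ β W i j := by
  rw [stressOf_form]
  have h1 : ∑ i, ∑ j, W i j * (W i j + W j i) = ∑ i, ∑ j, (W i j + W j i) ^ 2 / 2 := by
    have h2 : ∑ i, ∑ j, W i j * (W i j + W j i) = ∑ i, ∑ j, W j i * (W j i + W i j) :=
      Finset.sum_comm
    have h3 : ∑ i, ∑ j, (W i j + W j i) ^ 2 / 2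
        = (∑ i, ∑ j, W i j * (W i j + W j i) + ∑ i, ∑ j, W j i * (W j i + W i j)) / 2 := by
      simp_rw [← Finset.sum_add_distrib, Finset.sum_div]
      exact Finset.sum_congr rfl fun i _ => Finset.sum_congr rfl fun j _ => by ring
    rw [h3, ← h2]
    ring
  have h2 : 2 * ∑ k, W k k ^ 2 ≤ ∑ i, ∑ j, (W i j + W j i) ^ 2 / 2 := by
    rw [Finset.mul_sum]
    refine Finset.sum_le_sum fun i _ => ?_
    calc 2 * W i i ^ 2 = (W i i + W i i) ^ 2 / 2 := by ring
      _ ≤ _ := Finset.single_le_sum (f := fun j => (W i j + W j i) ^ 2 / 2)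
        (fun j _ => by positivity) (Finset.mem_univ i)
  have h3 : (∑ k, W k k) ^ 2 ≤ 3 * ∑ k, W k k ^ 2 := by
    have h4 := sq_sum_le_card_mul_sum_sq (s := Finset.univ) (f := fun k => W k k)
    rw [Finset.card_univ, Fintype.card_fin] at h4
    refine h4.trans (mul_le_mul_of_nonneg_right (by exact_mod_cast hd)
      (Finset.sum_nonneg fun k _ => sq_nonneg _))
  rw [h1]
  refine add_nonneg (mul_nonneg hμ ?_) (mul_nonneg hβ (mul_self_nonneg _))
  nlinarith

theorem velocity_consVars {v : State d} (hv : v ∈ physicalV g) :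
    velocity (consVars g v) = velV v := by
  rw [consVars_eq hv, velocity_stateV]

theorem temperature_consVars {v : State d} (hv : v ∈ physicalV g) :
    temperature g (consVars g v) = -(1 / (g.cv * energy v)) := by
  have h1 := (rhoV_pos g v).ne'
  have h2 := (gamma_sub_one_pos (g := g)).ne'
  have h3 := g.cv_pos.ne'
  have h4 := (mem_physicalV.1 hv).ne
  rw [consVars_eq hv, temperature, pressure_stateV, density_stateV]
  field_simp

/-- The chain rule for functions of the conservative variables. -/
theorem fderiv_comp_consVars {v : State d} (hv : v ∈ physicalV g) {f : State d → ℝ}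
    (hf : DifferentiableAt ℝ f (consVars g v)) {φ : State d → ℝ}
    (hφ : ∀ w ∈ physicalV g, f (consVars g w) = φ w) {w : State d} {a : ℝ}
    (h : HasDerivAt (fun t : ℝ => φ (v + t • w)) a 0) :
    fderiv ℝ f (consVars g v) (fun l => ∑ s, A0 g v l s * w s) = a := by
  have hc := differentiableAt_of_contDiffOn (contDiffOn_consVars (g := g)) isOpen_physicalV hv
  have h1 : (fun l => ∑ s, A0 g v l s * w s) = fderiv ℝ (consVars g) v w :=
    funext fun l => A0_mulVec v w l
  have h2 := fderiv_comp v hf hc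
  have h3 : fderiv ℝ (f ∘ consVars g) v w = a := by
    refine hasFDerivAt_comp_line (hf.comp v hc) ?_
    refine h.congr_of_eventuallyEq ?_
    have hcont : ContinuousAt (fun t : ℝ => v + t • w) 0 := by fun_prop
    have : ∀ᶠ t in 𝓝 (0 : ℝ), v + t • w ∈ physicalV g :=
      hcont (isOpen_physicalV.mem_nhds (by simpa using hv))
    exact this.mono fun t ht => hφ _ ht
  rw [← h3, h2]
  exact congrArg _ h1

/-- The velocity gradient in terms of the gradient of the entropy variables. -/
noncomputable def velGradV (v : State d) (q : Grad d) (i j : Fin d) : ℝ :=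
  -((q (Sum.inr (Sum.inl i)) j + velV v i * q (Sum.inr (Sum.inr ())) j) / energy v)

theorem gradVel_A0 {v : State d} (hv : v ∈ physicalV g) (q : Grad d) :
    gradVel (consVars g v) (fun l k => ∑ s, A0 g v l s * q s k) = velGradV v q := by
  ext i j
  exact fderiv_comp_consVars hv
    ((contDiffAt_velocity (consVars_mem hv).1.ne' i).differentiableAt one_ne_zero)
    (fun w hw => congrFun (velocity_consVars hw) i) (hasDerivAt_velV hv (fun s => q s j) i)

theorem gradTemp_A0 {v : State d} (hv : v ∈ physicalV g) (q : Grad d) (j : Fin d) :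
    gradTemp g (consVars g v) (fun l k => ∑ s, A0 g v l s * q s k) j
      = q (Sum.inr (Sum.inr ())) j / (g.cv * energy v ^ 2) := by
  have h4 := (mem_physicalV.1 hv).ne
  have h3 := g.cv_pos.ne'
  refine fderiv_comp_consVars hv (φ := fun v => -(1 / (g.cv * energy v))) (w := fun s => q s j)
    ?_ (fun w hw => temperature_consVars hw) ?_
  · have hρ := (consVars_mem hv).1.ne'
    refine ContDiffAt.differentiableAt (n := 1) ?_ one_ne_zero
    unfold temperature
    exact (contDiffAt_pressure g.γ hρ).div (by fun_prop)
      (mul_ne_zero hρ (mul_ne_zero (gamma_sub_one_pos (g := g)).ne' h3))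
  · have h2 : HasDerivAt (fun t : ℝ => energy (v + t • fun s => q s j))
        (q (Sum.inr (Sum.inr ())) j) 0 := by
      have := ((hasDerivAt_id (0 : ℝ)).mul_const (q (Sum.inr (Sum.inr ())) j)).const_add (energy v)
      simp only [one_mul] at this
      exact this
    have h5 := (((h2.const_mul g.cv).inv (by simpa using ⟨h3, h4⟩))).neg
    simp_rw [one_div]
    refine HasDerivAt.congr_deriv h5 ?_
    simp only [zero_smul, add_zero]
    field_simp

/-- The viscous flux in terms of the entropy variables. -/
theorem viscFluxV_eq {v : State d} (hv : v ∈ physicalV g) (q : Grad d) (i : Idx d) (j : Fin d) :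
    viscFluxV g v q i j = -mkState 0
      (fun l => stressOf (g.μ (consVars g v)) (g.β (consVars g v)) (velGradV v q) l j)
      (∑ l, velV v l * stressOf (g.μ (consVars g v)) (g.β (consVars g v)) (velGradV v q) l j
        + conductivity g (consVars g v) * (q (Sum.inr (Sum.inr ())) j / (g.cv * energy v ^ 2))) i := by
  rw [viscFluxV, viscFlux, stress_eq, gradVel_A0 hv, velocity_consVars hv]
  simp only [heatFlux, gradTemp_A0 hv, sub_neg_eq_add]

/-- The viscous flux tested with a gradient. -/
theorem viscFluxV_form {v : State d} (hv : v ∈ physicalV g) (p q : Grad d) :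
    ∑ i, ∑ j, p i j * -viscFluxV g v q i j
      = -energy v * ∑ i, ∑ j, velGradV v p i j
          * stressOf (g.μ (consVars g v)) (g.β (consVars g v)) (velGradV v q) i j
        + conductivity g (consVars g v) / (g.cv * energy v ^ 2)
          * ∑ j, p (Sum.inr (Sum.inr ())) j * q (Sum.inr (Sum.inr ())) j := by
  have hE := (mem_physicalV.1 hv).ne
  simp_rw [viscFluxV_eq hv, neg_neg]
  rw [sum_idx]
  simp only [mkState_inl, mkState_inr_inl, mkState_inr_inr, mul_zero, Finset.sum_const_zero,
    zero_add]
  generalize hτ : stressOf (g.μ (consVars g v)) (g.β (consVars g v)) (velGradV v q) = τ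
  simp_rw [mul_add, Finset.sum_add_distrib, ← add_assoc]
  congr 1
  -- The work term V · τ of the energy row joins the momentum rows: p_m + V p_E = -v_E W(p), with
  -- W(p) the velocity gradient belonging to p.
  · have h1 : ∑ j, p (Sum.inr (Sum.inr ())) j * ∑ l, velV v l * τ l j
        = ∑ l, ∑ j, p (Sum.inr (Sum.inr ())) j * (velV v l * τ l j) := by
      simp_rw [Finset.mul_sum]
      exact Finset.sum_comm
    rw [h1, ← Finset.sum_add_distrib, Finset.mul_sum]
    refine Finset.sum_congr rfl fun i _ => ?_
    rw [← Finset.sum_add_distrib, Finset.mul_sum]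
    refine Finset.sum_congr rfl fun j _ => ?_
    rw [velGradV]
    field_simp
  · rw [Finset.mul_sum]
    exact Finset.sum_congr rfl fun j _ => by ring

theorem viscFlux_add (u : State d) (du dw : Grad d) :
    viscFlux g u (du + dw) = viscFlux g u du + viscFlux g u dw := by
  have h1 (f : State d → ℝ) (j : Fin d) : fderiv ℝ f u (fun l => (du + dw) l j)
      = fderiv ℝ f u (fun l => du l j) + fderiv ℝ f u (fun l => dw l j) := by
    rw [← map_add]; rfl
  ext i j
  have hs (l : Fin d) : stress g u (du + dw) l j = stress g u du l j + stress g u dw l j := by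
    simp only [stress, gradVel, h1, Finset.sum_add_distrib]; ring
  have hf : heatFlux g u (du + dw) j = heatFlux g u du j + heatFlux g u dw j := by
    simp only [heatFlux, gradTemp, h1]; ring
  rcases i with _ | l | _
  · simp [viscFlux]
  · simp only [viscFlux, Pi.add_apply, mkState_inr_inl, hs]; ring
  · simp only [viscFlux, Pi.add_apply, mkState_inr_inr, hs, hf, mul_add, Finset.sum_add_distrib]
    ring

theorem viscFlux_smul (u : State d) (c : ℝ) (du : Grad d) :
    viscFlux g u (c • du) = c • viscFlux g u du := by
  have h1 (f : State d → ℝ) (j : Fin d) : fderiv ℝ f u (fun l => (c • du) l j)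
      = c * fderiv ℝ f u (fun l => du l j) := by
    rw [← smul_eq_mul, ← map_smul]; rfl
  ext i j
  have hs (l : Fin d) : stress g u (c • du) l j = c * stress g u du l j := by
    simp only [stress, gradVel, h1, ← Finset.mul_sum]; ring
  have hf : heatFlux g u (c • du) j = c * heatFlux g u du j := by
    simp only [heatFlux, gradTemp, h1]; ring
  rcases i with _ | l | _
  · simp [viscFlux]
  · simp only [viscFlux, Pi.smul_apply, smul_eq_mul, mkState_inr_inl, hs]; ring
  · simp only [viscFlux, Pi.smul_apply, smul_eq_mul, mkState_inr_inr, hs, hf, mul_left_comm _ c,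
      ← Finset.mul_sum]
    ring

/-- The viscous flux as a linear function of the gradient. -/
noncomputable def viscFluxL (g : Gas d) (u : State d) : Grad d →ₗ[ℝ] Grad d where
  toFun := viscFlux g u
  map_add' := viscFlux_add u
  map_smul' := viscFlux_smul u

/-- `viscMat` records the flux on elementary gradients only; linearity recovers it on all gradients.
-/
theorem viscFlux_eq_sum (u : State d) (du : Grad d) (i : Idx d) (j : Fin d) :
    -viscFlux g u du i j = ∑ k, ∑ l, viscMat g u j k i l * du l k := by
  have h : du = ∑ k, ∑ l, du l k •
      (fun s' k' => if s' = l ∧ k' = k then (1 : ℝ) else 0 : Grad d) := by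
    ext s' k'
    simp [Finset.sum_apply, ite_and, -Fintype.sum_sum_type]
  have h2 := congrArg (viscFluxL g u) h
  simp only [map_sum, map_smul] at h2
  have h3 := congrFun (congrFun h2 i) j
  simp only [Finset.sum_apply, Pi.smul_apply, smul_eq_mul] at h3
  change viscFlux g u du i j = _ at h3
  rw [h3, ← Finset.sum_neg_distrib]
  refine Finset.sum_congr rfl fun k _ => ?_
  rw [← Finset.sum_neg_distrib]
  refine Finset.sum_congr rfl fun l _ => ?_
  simp only [viscMat, Matrix.of_apply]
  change -(du l k * viscFlux g u _ i j) = _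
  ring

theorem Ktilde_mulVec (v : State d) (q : Idx d × Fin d → ℝ) (a : Idx d × Fin d) :
    Matrix.mulVec (Ktilde g v) q a = -viscFluxV g v (fun i j => q (i, j)) a.1 a.2 := by
  rw [viscFluxV, viscFlux_eq_sum, Matrix.mulVec, dotProduct, Fintype.sum_prod_type_right]
  refine Finset.sum_congr rfl fun k _ => ?_
  simp only [Ktilde, Matrix.of_apply, Matrix.mul_apply, Finset.sum_mul, Finset.mul_sum]
  rw [Finset.sum_comm]
  exact Finset.sum_congr rfl fun l _ => Finset.sum_congr rfl fun s _ => by ring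

theorem Ktilde_form (v : State d) (p q : Idx d × Fin d → ℝ) :
    p ⬝ᵥ Matrix.mulVec (Ktilde g v) q
      = ∑ i, ∑ j, p (i, j) * -viscFluxV g v (fun i j => q (i, j)) i j := by
  rw [dotProduct, Fintype.sum_prod_type]
  simp_rw [Ktilde_mulVec]

/-- By `viscFluxV_form` the form is a sum of a stress form and a heat conduction form, both
symmetric, with nonnegative coefficients -v_E and κ / (c_v v_E²). -/
theorem Ktilde_posSemidef (hd : d ≤ 3) {v : State d} (hv : v ∈ physicalV g) :
    (Ktilde g v).PosSemidef := by
  have hu := consVars_mem hv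
  have hμ := g.μ_nonneg _ hu
  have hβ := g.β_nonneg _ hu
  have hE := mem_physicalV.1 hv
  have hsymm (p q : Idx d × Fin d → ℝ) :
      p ⬝ᵥ Matrix.mulVec (Ktilde g v) q = q ⬝ᵥ Matrix.mulVec (Ktilde g v) p := by
    rw [Ktilde_form, Ktilde_form, viscFluxV_form hv fun i j => p (i, j),
      viscFluxV_form hv fun i j => q (i, j), stressOf_form_symm]
    congr 2
    exact Finset.sum_congr rfl fun j _ => mul_comm _ _
  refine Matrix.PosSemidef.of_dotProduct_mulVec_nonneg ?_ fun p => ?_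
  · refine Matrix.IsHermitian.ext fun a b => ?_
    have := hsymm (Pi.single b 1) (Pi.single a 1)
    simpa using this
  · rw [star_trivial, Ktilde_form, viscFluxV_form hv fun i j => p (i, j)]
    have h1 := stressOf_form_nonneg hd hμ hβ (velGradV v fun i j => p (i, j))
    have hκ : 0 ≤ conductivity g (consVars g v) :=
      div_nonneg (mul_nonneg (mul_nonneg (zero_le_one.trans g.one_lt_γ.le) g.cv_pos.le) hμ)
        g.Pr_pos.le
    have hc := g.cv_pos
    refine add_nonneg (mul_nonneg (by linarith) h1) (mul_nonneg (by positivity)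
      (Finset.sum_nonneg fun j _ => mul_self_nonneg _))

/-- The definition goes through derivatives; continuity is read off from the closed form
`viscFluxV_eq`. -/
theorem continuousOn_viscFluxV {X : Type*} [TopologicalSpace X] {s : Set X} {v : X → State d}
    {q : X → Grad d} (hv : ContinuousOn v s) (hq : ContinuousOn q s)
    (hm : ∀ x ∈ s, v x ∈ physicalV g) (i : Idx d) (j : Fin d) :
    ContinuousOn (fun x => viscFluxV g (v x) (q x) i j) s := by
  have hu : ContinuousOn (fun x => consVars g (v x)) s := contDiffOn_consVars.continuousOn.comp hv hm
  have hμ : ContinuousOn (fun x => g.μ (consVars g (v x))) s :=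
    g.μ_cont.comp hu fun x hx => consVars_mem (hm x hx)
  have hβ : ContinuousOn (fun x => g.β (consVars g (v x))) s :=
    g.β_cont.comp hu fun x hx => consVars_mem (hm x hx)
  have hE : ContinuousOn (fun x => energy (v x)) s := contDiff_energy.continuous.comp_continuousOn hv
  have hE0 : ∀ x ∈ s, energy (v x) ≠ 0 := fun x hx => (mem_physicalV.1 (hm x hx)).ne
  have hV (l : Fin d) : ContinuousOn (fun x => velV (v x) l) s :=
    (contDiffOn_velV (g := g) l).continuousOn.comp hv hm
  have hqc (i : Idx d) (j : Fin d) : ContinuousOn (fun x => q x i j) s :=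
    continuousOn_pi.1 (continuousOn_pi.1 hq i) j
  have hW (i j : Fin d) : ContinuousOn (fun x => velGradV (v x) (q x) i j) s :=
    (((hqc _ j).add ((hV i).mul (hqc _ j))).div hE hE0).neg
  have hτ (i j : Fin d) : ContinuousOn (fun x => stressOf (g.μ (consVars g (v x)))
      (g.β (consVars g (v x))) (velGradV (v x) (q x)) i j) s := by
    have htr : ContinuousOn (fun x => ∑ k, velGradV (v x) (q x) k k) s :=
      continuousOn_finsetSum _ fun k _ => hW k k
    exact (hμ.mul (((hW i j).add (hW j i)).sub ((continuousOn_const.mul htr).mul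
      continuousOn_const))).add ((hβ.mul htr).mul continuousOn_const)
  refine ContinuousOn.congr ?_ fun x hx => viscFluxV_eq (hm x hx) (q x) i j
  rcases i with _ | l | _
  · simp only [mkState_inl]
    exact continuousOn_const
  · exact (hτ l j).neg
  · refine ((continuousOn_finsetSum _ fun l _ => (hV l).mul (hτ l j)).add (ContinuousOn.mul ?_
      ((hqc _ j).div (continuousOn_const.mul (hE.pow 2)) fun x hx =>
        mul_ne_zero g.cv_pos.ne' (pow_ne_zero 2 (hE0 x hx))))).neg
    exact (continuousOn_const.mul hμ).div_const _

end Viscous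

end HDG

namespace HDG

open Filter Topology Module

/-! ### Polynomial fields on elements and faces. -/

section Polynomials

theorem totalDegree_pderiv_le {σ : Type*} (i : σ) (P : MvPolynomial σ ℝ) :
    (MvPolynomial.pderiv i P).totalDegree ≤ P.totalDegree := by
  conv_lhs => rw [P.as_sum, map_sum]
  refine MvPolynomial.totalDegree_finsetSum_le fun s hs => ?_
  rw [MvPolynomial.pderiv_monomial]
  refine (MvPolynomial.totalDegree_monomial_le _ _).trans ?_
  refine le_trans ?_ (MvPolynomial.le_totalDegree hs)
  exact Finsupp.degree_mono (tsub_le_self : s - Finsupp.single i 1 ≤ s)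

variable {n : ℕ}

/-- The polynomial function of the coordinates. -/
noncomputable def polyFun (P : MvPolynomial (Fin n) ℝ) (x : E n) : ℝ :=
  MvPolynomial.eval (fun j => x j) P

theorem polyFun_C (a : ℝ) : (polyFun (MvPolynomial.C a) : E n → ℝ) = fun _ => a := by
  ext x; simp [polyFun]

theorem polyFun_add (P Q : MvPolynomial (Fin n) ℝ) :
    polyFun (P + Q) = fun x => polyFun P x + polyFun Q x := by
  ext x; simp [polyFun]

theorem polyFun_mul_X (P : MvPolynomial (Fin n) ℝ) (i : Fin n) :
    polyFun (P * MvPolynomial.X i) = fun x => polyFun P x * x i := by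
  ext x; simp [polyFun]

theorem contDiff_polyFun (P : MvPolynomial (Fin n) ℝ) : ContDiff ℝ 1 (polyFun P) := by
  induction P using MvPolynomial.induction_on with
  | C a => rw [polyFun_C]; exact contDiff_const
  | add P Q hP hQ => rw [polyFun_add]; exact hP.add hQ
  | mul_X P i hP =>
    rw [polyFun_mul_X]
    exact hP.mul (EuclideanSpace.proj i : E n →L[ℝ] ℝ).contDiff

theorem fderiv_polyFun (P : MvPolynomial (Fin n) ℝ) (x e : E n) :
    fderiv ℝ (polyFun P) x e = ∑ l, e l * polyFun (MvPolynomial.pderiv l P) x := by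
  have hd (P : MvPolynomial (Fin n) ℝ) : DifferentiableAt ℝ (polyFun P) x :=
    (contDiff_polyFun P).differentiable one_ne_zero x
  induction P using MvPolynomial.induction_on with
  | C a =>
    rw [polyFun_C]
    simp [polyFun]
  | add P Q hP hQ =>
    rw [polyFun_add, fderiv_fun_add (hd P) (hd Q), add_apply, hP, hQ, ← Finset.sum_add_distrib]
    refine Finset.sum_congr rfl fun l _ => ?_
    rw [map_add, polyFun_add, mul_add]
  | mul_X P i hP =>
    have hX : HasFDerivAt (fun x : E n => x i) (EuclideanSpace.proj i : E n →L[ℝ] ℝ) x :=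
      (EuclideanSpace.proj i : E n →L[ℝ] ℝ).hasFDerivAt
    rw [polyFun_mul_X, fderiv_fun_mul (hd P) hX.differentiableAt, hX.fderiv, add_apply, smul_apply,
      smul_apply, hP]
    have h (l : Fin n) : polyFun (MvPolynomial.pderiv l (P * MvPolynomial.X i)) x
        = polyFun P x * (if i = l then 1 else 0) + x i * polyFun (MvPolynomial.pderiv l P) x := by
      rw [MvPolynomial.pderiv_mul, MvPolynomial.pderiv_X, polyFun_add, polyFun_mul_X]
      simp only [polyFun, map_mul, Pi.single_apply]
      split_ifs <;> simp <;> ring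
    simp_rw [h, mul_add, Finset.sum_add_distrib]
    simp [Finset.mul_sum, mul_comm, mul_left_comm]

end Polynomials

namespace Mesh

variable {d : ℕ} {Ω : Set (E d)} {ιK ιF : Type*} {M : Mesh d Ω ιK ιF} {k : ℕ}

/-- The inverse of the element map, as a continuous affine map. -/
noncomputable def _root_.HDG.Mesh.pull (M : Mesh d Ω ιK ιF) (K : ιK) : E d →ᴬ[ℝ] E d where
  toAffineMap := (M.ψ K).symm.toAffineMap
  cont := (M.ψ K).symm.toAffineMap.continuous_of_finiteDimensional

theorem pull_psi (K : ιK) (x : E d) : M.pull K (M.ψ K x) = x := (M.ψ K).symm_apply_apply x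

theorem psi_pull (K : ιK) (x : E d) : M.ψ K (M.pull K x) = x := (M.ψ K).apply_symm_apply x

theorem pull_mem {K : ιK} {x : E d} (hx : x ∈ M.elem K) : M.pull K x ∈ M.Kref := by
  rw [M.elem_eq] at hx
  obtain ⟨y, hy, rfl⟩ := hx
  rwa [pull_psi]

theorem contDiff_poly_pull (K : ιK) (P : MvPolynomial (Fin d) ℝ) :
    ContDiff ℝ 1 fun x => polyFun P (M.pull K x) :=
  (contDiff_polyFun P).comp (M.pull K).contDiff

theorem poly_eq_on_elem {K : ιK} {f : E d → ℝ} {P : MvPolynomial (Fin d) ℝ}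
    (h : ∀ x ∈ M.Kref, f (M.ψ K x) = MvPolynomial.eval (fun j => x j) P) {x : E d}
    (hx : x ∈ M.elem K) : f x = polyFun P (M.pull K x) := by
  rw [← psi_pull K x, h _ (pull_mem hx), pull_psi]
  rfl

/-- Directional derivatives of polynomials of degree at most `k` are such polynomials. -/
theorem isPolyOn_fderiv (K : ιK) {P : MvPolynomial (Fin d) ℝ} (hP : P.totalDegree ≤ k) (e : E d) :
    IsPolyOn k M.Kref fun x => fderiv ℝ (fun y => polyFun P (M.pull K y)) (M.ψ K x) e := by
  refine ⟨∑ l, (M.pull K).contLinear e l • MvPolynomial.pderiv l P, ?_, fun x _ => ?_⟩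
  · exact MvPolynomial.totalDegree_finsetSum_le fun l _ =>
      (MvPolynomial.totalDegree_smul_le _ _).trans ((totalDegree_pderiv_le l P).trans hP)
  · have h := ((contDiff_polyFun P).differentiable one_ne_zero
      (M.pull K (M.ψ K x))).hasFDerivAt.comp (M.ψ K x) (M.pull K).hasFDerivAt
    beta_reduce
    rw [show (fun y => polyFun P (M.pull K y)) = polyFun P ∘ M.pull K from rfl, h.fderiv,
      ContinuousLinearMap.comp_apply, fderiv_polyFun, pull_psi]
    simp [polyFun]

theorem ae_interior (K : ιK) : ∀ᵐ x ∂volume.restrict (M.elem K), x ∈ interior (M.elem K) := by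
  rw [ae_restrict_iff' (M.measurableSet_elem K)]
  filter_upwards [measure_eq_zero_iff_ae_notMem.1 ((M.convex_elem K).addHaar_frontier volume)]
    with x hx hxK
  by_contra h
  exact hx ⟨subset_closure hxK, h⟩

/-- Broken fields are arbitrary off their element, so derivatives are determined only at interior
points. That suffices, the frontier of a convex set being null. -/
theorem ae_fderiv_eq {K : ιK} {f h : E d → ℝ} (hfh : Set.EqOn f h (M.elem K)) :
    ∀ᵐ x ∂volume.restrict (M.elem K), fderiv ℝ f x = fderiv ℝ h x := by
  filter_upwards [ae_interior K] with x hx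
  refine Filter.EventuallyEq.fderiv_eq ?_
  filter_upwards [mem_interior_iff_mem_nhds.1 hx] with y hy using hfh hy

/-- W is the polynomial itself, taken on the whole space. That its gradient lies in 𝒬_h^k is what
later allows the viscous flux to be replaced by its projection. -/
theorem exists_extension_of_mem_Vspace {w : VField ιK d} (hw : w ∈ M.Vspace k) :
    ∃ W : VField ιK d, (∀ K i, ContDiff ℝ 1 fun x => W K x i) ∧
      (∀ K, ∀ x ∈ M.elem K, w K x = W K x) ∧ gradF W ∈ M.Qspace k := by
  choose P hP hPw using hw
  refine ⟨fun K x i => polyFun (P K i) (M.pull K x), fun K i => contDiff_poly_pull K _,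
    fun K x hx => funext fun i => poly_eq_on_elem (f := fun x => w K x i) (hPw K i) hx,
    fun K i j => isPolyOn_fderiv K (hP K i) _⟩

theorem exists_extension_of_mem_Qspace {r : QField ιK d} (hr : r ∈ M.Qspace k) :
    ∃ R : QField ιK d, (∀ K i j, ContDiff ℝ 1 fun x => R K x i j) ∧
      ∀ K, ∀ x ∈ M.elem K, r K x = R K x := by
  choose P hP hPr using hr
  exact ⟨fun K x i j => polyFun (P K i j) (M.pull K x), fun K i j => contDiff_poly_pull K _,
    fun K x hx => funext fun i => funext fun j =>
      poly_eq_on_elem (f := fun x => r K x i j) (hPr K i j) hx⟩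

theorem continuousOn_of_mem_Vspace {w : VField ιK d} (hw : w ∈ M.Vspace k) (K : ιK) :
    ContinuousOn (w K) (M.elem K) := by
  obtain ⟨W, hW, hwW, -⟩ := exists_extension_of_mem_Vspace hw
  exact (continuous_pi fun i => (hW K i).continuous).continuousOn.congr (hwW K)

theorem continuousOn_of_mem_Qspace {r : QField ιK d} (hr : r ∈ M.Qspace k) (K : ιK) :
    ContinuousOn (r K) (M.elem K) := by
  obtain ⟨R, hR, hrR⟩ := exists_extension_of_mem_Qspace hr
  exact (continuous_pi fun i => continuous_pi fun j => (hR K i j).continuous).continuousOn.congr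
    (hrR K)

/-- An injective affine map is a closed embedding, so continuity in reference coordinates transfers
to the face. -/
theorem continuousOn_of_mem_Mspace {EE : Set ιF} {μ : MField ιF d} (hμ : μ ∈ M.Mspace k EE)
    (F : ιF) : ContinuousOn (μ F) (M.face F) := by
  have hemb : Topology.IsClosedEmbedding (M.φ F) := by
    have hl := LinearMap.isClosedEmbedding_of_injective
      (f := (M.φ F).linear) (LinearMap.ker_eq_bot.2 ((AffineMap.linear_injective_iff _).2 (M.φ_injective F)))
    have h : (M.φ F : E (d - 1) → E d) = (Homeomorph.addRight (M.φ F 0)) ∘ (M.φ F).linear := by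
      ext1 x
      exact congrFun (M.φ F).decomp x
    rw [h]
    exact (Homeomorph.isClosedEmbedding _).comp hl
  rw [M.face_eq, hemb.isInducing.continuousOn_image_iff]
  refine continuousOn_pi.2 fun i => ?_
  obtain ⟨P, -, hP⟩ := hμ.1 F i
  exact (contDiff_polyFun P).continuous.continuousOn.congr hP

end Mesh

end HDG

namespace HDG

open Filter Topology Module

/-! ### Volume integrals, the L² projection and Green's formulas. -/

namespace Mesh

variable {d : ℕ} {Ω : Set (E d)} {ιK ιF : Type*} {M : Mesh d Ω ιK ιF} {k : ℕ}

theorem integrableOn_elem {K : ιK} {f : E d → ℝ} (hf : ContinuousOn f (M.elem K)) :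
    IntegrableOn f (M.elem K) :=
  hf.integrableOn_compact (M.isCompact_elem K)

section Vol

variable [Fintype ιK]

theorem vol_congr_ae {f h : ιK → E d → ℝ}
    (H : ∀ K, ∀ᵐ x ∂volume.restrict (M.elem K), f K x = h K x) : M.vol f = M.vol h :=
  Finset.sum_congr rfl fun K _ => integral_congr_ae (H K)

theorem vol_congr {f h : ιK → E d → ℝ} (H : ∀ K, ∀ x ∈ M.elem K, f K x = h K x) :
    M.vol f = M.vol h :=
  vol_congr_ae fun K => ae_restrict_of_forall_mem (M.measurableSet_elem K) (H K)

theorem vol_add {f h : ιK → E d → ℝ} (hf : ∀ K, IntegrableOn (f K) (M.elem K))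
    (hh : ∀ K, IntegrableOn (h K) (M.elem K)) :
    M.vol (fun K x => f K x + h K x) = M.vol f + M.vol h := by
  simp only [vol]
  rw [← Finset.sum_add_distrib]
  exact Finset.sum_congr rfl fun K _ => integral_add (hf K) (hh K)

theorem vol_smul (c : ℝ) (f : ιK → E d → ℝ) : M.vol (fun K x => c * f K x) = c * M.vol f := by
  simp only [vol, Finset.mul_sum]
  exact Finset.sum_congr rfl fun K _ => integral_const_mul _ _

omit [Fintype ιK] in
theorem continuousOn_innerQ {A B : QField ιK d} {K : ιK} (hA : ContinuousOn (A K) (M.elem K))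
    (hB : ContinuousOn (B K) (M.elem K)) :
    ContinuousOn (fun x => ∑ i, ∑ j, A K x i j * B K x i j) (M.elem K) :=
  continuousOn_finsetSum _ fun i _ => continuousOn_finsetSum _ fun j _ =>
    (continuousOn_pi.1 (continuousOn_pi.1 hA i) j).mul
      (continuousOn_pi.1 (continuousOn_pi.1 hB i) j)

theorem innerQ_comm (A B : QField ιK d) : M.innerQ A B = M.innerQ B A := by
  simp only [innerQ, mul_comm]

theorem innerQ_add_right {A B C : QField ιK d} (hA : ∀ K, ContinuousOn (A K) (M.elem K))
    (hB : ∀ K, ContinuousOn (B K) (M.elem K)) (hC : ∀ K, ContinuousOn (C K) (M.elem K)) :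
    M.innerQ A (fun K x => B K x + C K x) = M.innerQ A B + M.innerQ A C := by
  simp only [innerQ, Pi.add_apply, mul_add, Finset.sum_add_distrib]
  exact vol_add (fun K => integrableOn_elem (continuousOn_innerQ (hA K) (hB K)))
    (fun K => integrableOn_elem (continuousOn_innerQ (hA K) (hC K)))

theorem innerQ_smul_right (A B : QField ιK d) (c : ℝ) :
    M.innerQ A (fun K x => c • B K x) = c * M.innerQ A B := by
  simp only [innerQ, Pi.smul_apply, smul_eq_mul, mul_left_comm _ c, ← Finset.mul_sum]
  exact vol_smul c _

end Vol

section Projection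

/-- A linear functional vanishing on the kernel of a positive semidefinite form is represented
by the form. -/
theorem exists_form_eq {W : Type*} [AddCommGroup W] [Module ℝ W] [FiniteDimensional ℝ W]
    (B : W →ₗ[ℝ] Dual ℝ W) (hB : ∀ p r, B p r = B r p) (ℓ : Dual ℝ W)
    (hℓ : ∀ w, B w w = 0 → ℓ w = 0) : ∃ p, ∀ r, B p r = ℓ r := by
  -- The range of the transpose is the annihilator of ker B; symmetry and reflexivity identify the
  -- transpose with B.
  have h : ℓ ∈ LinearMap.range B.dualMap := by
    rw [LinearMap.range_dualMap_eq_dualAnnihilator_ker, Submodule.mem_dualAnnihilator]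
    intro w hw
    refine hℓ w ?_
    rw [LinearMap.mem_ker.1 hw]
    rfl
  obtain ⟨φ, hφ⟩ := h
  obtain ⟨p, hp⟩ := (evalEquiv ℝ W).surjective φ
  refine ⟨p, fun r => ?_⟩
  rw [← hφ, ← hp, hB]
  rfl

variable [Fintype ιK]

/-- Existence only needs that (A, ·) kills every polynomial field of zero L² norm, which holds since
such a field vanishes almost everywhere. Definiteness of the form on coefficients is not required.
-/
theorem exists_projection {A : QField ιK d} (hA : ∀ K, ContinuousOn (A K) (M.elem K)) :
    ∃ P, P ∈ M.Qspace k ∧ ∀ r ∈ M.Qspace k, M.innerQ P r = M.innerQ A r := by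
  let W := ιK → Idx d → Fin d → MvPolynomial.restrictTotalDegree (Fin d) ℝ k
  let fld : W → QField ιK d := fun p K x i j => polyFun (p K i j : MvPolynomial (Fin d) ℝ) (M.pull K x)
  have hfc (p : W) (K : ιK) : Continuous (fld p K) :=
    continuous_pi fun i => continuous_pi fun j => (contDiff_poly_pull K _).continuous
  have hfco (p : W) (K : ιK) : ContinuousOn (fld p K) (M.elem K) := (hfc p K).continuousOn
  have hfadd (p r : W) : fld (p + r) = fun K x => fld p K x + fld r K x := by
    ext K x i j
    change polyFun ((p K i j : MvPolynomial (Fin d) ℝ) + (r K i j : MvPolynomial (Fin d) ℝ)) _ = _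
    rw [polyFun_add]
    rfl
  have hfsmul (c : ℝ) (p : W) : fld (c • p) = fun K x => c • fld p K x := by
    ext K x i j
    change polyFun (c • (p K i j : MvPolynomial (Fin d) ℝ)) _ = _
    simp [fld, polyFun]
  have hfmem (p : W) : fld p ∈ M.Qspace k := fun K i j => by
    refine ⟨p K i j, (MvPolynomial.mem_restrictTotalDegree (Fin d) k _).1 (p K i j).2,
      fun x _ => ?_⟩
    simp only [fld, pull_psi]
    rfl
  have hlin (C : QField ιK d) (hC : ∀ K, ContinuousOn (C K) (M.elem K)) :
      ∃ L : Dual ℝ W, ∀ p, L p = M.innerQ C (fld p) :=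
    ⟨{ toFun := fun p => M.innerQ C (fld p)
       map_add' := fun p r => by
        simp only [hfadd]
        exact innerQ_add_right hC (hfco p) (hfco r)
       map_smul' := fun c p => by
        simp only [hfsmul]
        exact innerQ_smul_right _ _ _ }, fun p => rfl⟩
  choose L hL using hlin
  let B : W →ₗ[ℝ] Dual ℝ W :=
    { toFun := fun p => L (fld p) (hfco p)
      map_add' := fun p r => by
        ext1 s
        rw [LinearMap.add_apply, hL, hL, hL, innerQ_comm, hfadd,
          innerQ_add_right (hfco s) (hfco p) (hfco r), innerQ_comm, innerQ_comm (fld s)]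
      map_smul' := fun c p => by
        ext1 s
        rw [LinearMap.smul_apply, hL, hL, innerQ_comm, hfsmul, innerQ_smul_right, innerQ_comm]
        rfl }
  have hBapp (p r : W) : B p r = M.innerQ (fld p) (fld r) := hL _ _ _
  have hker (p : W) (hp : B p p = 0) : L A hA p = 0 := by
    rw [hBapp] at hp
    rw [hL]
    have hK : ∀ K ∈ Finset.univ, ∫ x in M.elem K, ∑ i, ∑ j, fld p K x i j * fld p K x i j = 0 :=
      (Finset.sum_eq_zero_iff_of_nonneg fun K _ => integral_nonneg fun x =>
        Finset.sum_nonneg fun i _ => Finset.sum_nonneg fun j _ => mul_self_nonneg _).1 hp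
    have h0 : M.innerQ A (fld p) = M.vol fun _ _ => 0 := by
      refine vol_congr_ae fun K => ?_
      have h1 := (integral_eq_zero_iff_of_nonneg (fun x => Finset.sum_nonneg fun i _ =>
        Finset.sum_nonneg fun j _ => mul_self_nonneg _)
        (integrableOn_elem (continuousOn_innerQ (hfco p K) (hfco p K)))).1
        (hK K (Finset.mem_univ K))
      filter_upwards [h1] with x hx
      refine Finset.sum_eq_zero fun i _ => Finset.sum_eq_zero fun j _ => ?_
      have h2 := (Finset.sum_eq_zero_iff_of_nonneg fun i _ => Finset.sum_nonneg fun j _ =>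
        mul_self_nonneg _).1 hx i (Finset.mem_univ i)
      have h3 := (Finset.sum_eq_zero_iff_of_nonneg fun j _ => mul_self_nonneg _).1 h2 j
        (Finset.mem_univ j)
      rw [mul_self_eq_zero.1 h3, mul_zero]
    rw [h0]
    simp [vol]
  obtain ⟨p, hp⟩ := exists_form_eq B (fun p r => by rw [hBapp, hBapp, innerQ_comm]) (L A hA) hker
  refine ⟨fld p, hfmem p, fun r hr => ?_⟩
  choose P hP hPr using hr
  let r' : W := fun K i j =>
    ⟨P K i j, (MvPolynomial.mem_restrictTotalDegree (Fin d) k _).2 (hP K i j)⟩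
  have hrr (C : QField ιK d) : M.innerQ C r = M.innerQ C (fld r') := by
    refine vol_congr fun K x hx => ?_
    refine Finset.sum_congr rfl fun i _ => Finset.sum_congr rfl fun j _ => ?_
    rw [poly_eq_on_elem (f := fun x => r K x i j) (hPr K i j) hx]
  rw [hrr, hrr, ← hBapp, hp, hL]

theorem projQ_spec {A : QField ιK d} (hA : ∀ K, ContinuousOn (A K) (M.elem K)) :
    M.projQ k A ∈ M.Qspace k ∧ ∀ r ∈ M.Qspace k, M.innerQ (M.projQ k A) r = M.innerQ A r :=
  Classical.epsilon_spec (p := fun P => P ∈ M.Qspace k ∧ ∀ r ∈ M.Qspace k,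
    M.innerQ P r = M.innerQ A r) (exists_projection hA)

end Projection

section Green

variable [Fintype ιF]

open Classical in
/-- The divergence theorem for a vector field on an element. -/
theorem integral_div_elem (K : ιK) {Φ : Fin d → E d → ℝ} {U : Set (E d)} (hU : IsOpen U)
    (hKU : M.elem K ⊆ U) (hΦ : ∀ j, ContDiffOn ℝ 1 (Φ j) U) :
    ∫ x in M.elem K, ∑ j, fderiv ℝ (Φ j) x (EuclideanSpace.single j 1)
      = ∑ F with M.face F ⊆ frontier (M.elem K),
        M.faceInt F (fun x => ∑ j, Φ j x * M.normal K F j) := by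
  have hint (j : Fin d) : IntegrableOn (fun x => fderiv ℝ (Φ j) x (EuclideanSpace.single j 1))
      (M.elem K) := integrableOn_elem
    ((((hΦ j).continuousOn_fderiv_of_isOpen hU le_rfl).clm_apply continuousOn_const).mono hKU)
  rw [integral_finsetSum _ fun j _ => hint j, Finset.sum_congr rfl fun j _ =>
    integral_fderiv_elem K hU hKU (hΦ j) _, Finset.sum_comm]
  refine Finset.sum_congr rfl fun F hF => ?_
  have hF' := (Finset.mem_filter.1 hF).2
  rw [faceInt, integral_finsetSum _ fun j _ => (integrableOn_face hF'
    (((hΦ j).continuousOn.mono hKU).mono (M.face_subset_elem hF'))).mul_const _]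
  refine Finset.sum_congr rfl fun j _ => ?_
  rw [integral_mul_const, faceInt, mul_comm]
  congr 1
  simp [EuclideanSpace.inner_single_right]

variable [Fintype ιK]

theorem bdry_congr {f h : ιK → ιF → E d → ℝ} (H : ∀ K F, M.face F ⊆ frontier (M.elem K) →
    ∀ x ∈ M.face F, f K F x = h K F x) : M.bdry f = M.bdry h := by
  classical
  refine Finset.sum_congr rfl fun K _ => Finset.sum_congr rfl fun F hF => ?_
  exact setIntegral_congr_fun (M.measurableSet_face F) (H K F (Finset.mem_filter.1 hF).2)

/-- Green's formula for piecewise polynomials. -/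
theorem green_poly {w : VField ιK d} (hw : w ∈ M.Vspace k) {r : QField ιK d}
    (hr : r ∈ M.Qspace k) : M.vol (fun K x => w K x ⬝ᵥ divF r K x) + M.innerQ r (gradF w)
      = M.bdry fun K F x => w K x ⬝ᵥ dotN (r K x) (M.normal K F) := by
  classical
  obtain ⟨W, hW, hwW, -⟩ := exists_extension_of_mem_Vspace hw
  obtain ⟨R, hR, hrR⟩ := exists_extension_of_mem_Qspace hr
  have h1 : M.vol (fun K x => w K x ⬝ᵥ divF r K x) = M.vol fun K x => W K x ⬝ᵥ divF R K x := by
    refine vol_congr_ae fun K => ?_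
    have h : ∀ᵐ x ∂volume.restrict (M.elem K), ∀ i j,
        fderiv ℝ (fun y => r K y i j) x = fderiv ℝ (fun y => R K y i j) x := by
      simp_rw [ae_all_iff]
      exact fun i j => ae_fderiv_eq fun x hx => by rw [hrR K x hx]
    filter_upwards [h, ae_restrict_mem (M.measurableSet_elem K)] with x hx hxK
    have hdiv : divF r K x = divF R K x := by
      ext i
      simp only [divF, hx]
    rw [hwW K x hxK, hdiv]
  have h2 : M.innerQ r (gradF w) = M.innerQ R (gradF W) := by
    refine vol_congr_ae fun K => ?_
    have h : ∀ᵐ x ∂volume.restrict (M.elem K), ∀ i,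
        fderiv ℝ (fun y => w K y i) x = fderiv ℝ (fun y => W K y i) x := by
      simp_rw [ae_all_iff]
      exact fun i => ae_fderiv_eq fun x hx => by rw [hwW K x hx]
    filter_upwards [h, ae_restrict_mem (M.measurableSet_elem K)] with x hx hxK
    simp only [gradF, hrR K x hxK, hx]
  have h3 : (M.bdry fun K F x => w K x ⬝ᵥ dotN (r K x) (M.normal K F))
      = M.bdry fun K F x => W K x ⬝ᵥ dotN (R K x) (M.normal K F) :=
    bdry_congr fun K F hF x hx => by
      rw [hwW K x (M.face_subset_elem hF hx), hrR K x (M.face_subset_elem hF hx)]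
  have hWc (K : ιK) (i : Idx d) : Continuous fun x => W K x i := (hW K i).continuous
  have hRc (K : ιK) (i : Idx d) (j : Fin d) : Continuous fun x => R K x i j := (hR K i j).continuous
  have hWd (K : ιK) (i : Idx d) (e : E d) : Continuous fun x => fderiv ℝ (fun y => W K y i) x e :=
    ((hW K i).continuous_fderiv one_ne_zero).clm_apply continuous_const
  have hRd (K : ιK) (i : Idx d) (j : Fin d) (e : E d) :
      Continuous fun x => fderiv ℝ (fun y => R K y i j) x e :=
    ((hR K i j).continuous_fderiv one_ne_zero).clm_apply continuous_const
  rw [h1, h2, h3, innerQ, ← vol_add]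
  · refine Finset.sum_congr rfl fun K _ => ?_
    -- The divergence theorem for the vector field WᵗR.
    have h := integral_div_elem (M := M) K (Φ := fun j x => ∑ i, W K x i * R K x i j) isOpen_univ
      (Set.subset_univ _) fun j => (ContDiff.sum fun i _ => (hW K i).mul (hR K i j)).contDiffOn
    convert h using 1
    · refine integral_congr_ae (Eventually.of_forall fun x => ?_)
      have h4 (j : Fin d) : fderiv ℝ (fun x => ∑ i, W K x i * R K x i j) x
          (EuclideanSpace.single j 1) = ∑ i, (W K x i * fderiv ℝ (fun y => R K y i j) x
            (EuclideanSpace.single j 1) + R K x i j * fderiv ℝ (fun y => W K y i) x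
            (EuclideanSpace.single j 1)) := by
        rw [fderiv_fun_sum fun i _ => ((hW K i).mul (hR K i j)).differentiable one_ne_zero x,
          sum_apply]
        refine Finset.sum_congr rfl fun i _ => ?_
        rw [fderiv_fun_mul ((hW K i).differentiable one_ne_zero x)
          ((hR K i j).differentiable one_ne_zero x)]
        rfl
      simp_rw [h4, Finset.sum_add_distrib, dotProduct, divF, gradF, Finset.mul_sum]
      rw [Finset.sum_comm]
      congr 1
      exact Finset.sum_comm
    · refine Finset.sum_congr rfl fun F _ => ?_
      congr 1
      ext x
      simp only [dotProduct, dotN, Finset.mul_sum, Finset.sum_mul]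
      rw [Finset.sum_comm]
      exact Finset.sum_congr rfl fun j _ => Finset.sum_congr rfl fun i _ => by ring
  · intro K
    refine integrableOn_elem (Continuous.continuousOn ?_)
    exact continuous_finsetSum _ fun i _ => (hWc K i).mul
      (continuous_finsetSum _ fun j _ => hRd K i j _)
  · intro K
    refine integrableOn_elem (Continuous.continuousOn ?_)
    exact continuous_finsetSum _ fun i _ => continuous_finsetSum _ fun j _ =>
      (hRc K i j).mul (hWd K i _)

/-- The inviscid flux tested with the gradient of the entropy variables is a boundary term. -/
theorem green_flux {g : Gas d} {w : VField ιK d} (hw : w ∈ M.Vspace k)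
    (hphys : ∀ K, ∀ x ∈ M.elem K, w K x ∈ physicalV g) :
    M.innerQ (fun K x => invFlux g (consVars g (w K x))) (gradF w)
      = M.bdry fun K F x => ∑ j, fluxPotential g j (w K x) * M.normal K F j := by
  classical
  obtain ⟨W, hW, hwW, -⟩ := exists_extension_of_mem_Vspace hw
  have hWc (K : ιK) : ContDiff ℝ 1 (W K) := contDiff_pi.2 (hW K)
  have h2 : M.innerQ (fun K x => invFlux g (consVars g (w K x))) (gradF w)
      = M.innerQ (fun K x => invFlux g (consVars g (W K x))) (gradF W) := by
    refine vol_congr_ae fun K => ?_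
    have h : ∀ᵐ x ∂volume.restrict (M.elem K), ∀ i,
        fderiv ℝ (fun y => w K y i) x = fderiv ℝ (fun y => W K y i) x := by
      simp_rw [ae_all_iff]
      exact fun i => ae_fderiv_eq fun x hx => by rw [hwW K x hx]
    filter_upwards [h, ae_restrict_mem (M.measurableSet_elem K)] with x hx hxK
    simp only [gradF, hwW K x hxK, hx]
  have h3 : (M.bdry fun K F x => ∑ j, fluxPotential g j (w K x) * M.normal K F j)
      = M.bdry fun K F x => ∑ j, fluxPotential g j (W K x) * M.normal K F j :=
    bdry_congr fun K F hF x hx => by rw [hwW K x (M.face_subset_elem hF hx)]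
  rw [h2, h3]
  refine Finset.sum_congr rfl fun K _ => ?_
  have hmem : M.elem K ⊆ W K ⁻¹' physicalV g := fun x hx => by
    rw [Set.mem_preimage, ← hwW K x hx]
    exact hphys K x hx
  -- The extension W may leave X_v away from the element, so ψ(W) is C¹ only on the open preimage of
  -- X_v, which contains the element.
  have h := integral_div_elem (M := M) K (Φ := fun j x => fluxPotential g j (W K x))
    (isOpen_physicalV.preimage (hWc K).continuous) hmem
    fun j => (contDiffOn_fluxPotential (g := g) j).comp (hWc K).contDiffOn fun x hx => hx
  rw [← h]
  refine setIntegral_congr_fun (M.measurableSet_elem K) fun x hx => ?_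
  simp only
  rw [Finset.sum_comm]
  refine Finset.sum_congr rfl fun j _ => ?_
  have hd := differentiableAt_of_contDiffOn (contDiffOn_fluxPotential (g := g) j) isOpen_physicalV
    (hmem hx)
  have hc := fderiv_comp x hd ((hWc K).differentiable one_ne_zero x)
  rw [show (fun x => fluxPotential g j (W K x)) = fluxPotential g j ∘ W K from rfl, hc,
    ContinuousLinearMap.comp_apply, fderiv_fluxPotential (hmem hx)]
  refine Finset.sum_congr rfl fun i _ => ?_
  congr 1
  have h5 := hasFDerivAt_pi'.1 ((hWc K).differentiable one_ne_zero x).hasFDerivAt i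
  rw [gradF, h5.fderiv]
  rfl

end Green

end Mesh

end HDG

/-! ### The time derivative of the total entropy. -/

namespace HDG

open Filter Topology Module

/-- Functions from a finite-dimensional space are determined by finitely many of their values. -/
theorem exists_interpolation {X : Type*} (V : Submodule ℝ (X → ℝ)) [FiniteDimensional ℝ V] :
    ∃ (T : Finset X) (φ : X → X → ℝ), (∀ a, φ a ∈ V) ∧
      ∀ f ∈ V, ∀ y, f y = ∑ a ∈ T, f a * φ a y := by
  classical
  let ev : X → Dual ℝ V := fun x => (LinearMap.proj x) ∘ₗ V.subtype
  -- Point evaluations have no common zero in V except 0, so they span the dual; each coordinate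
  -- functional of a basis is then a finite combination of evaluations.
  have hspan : Submodule.span ℝ (Set.range ev) = ⊤ := by
    rw [← Subspace.dualCoannihilator_dualAnnihilator_eq (W := Submodule.span ℝ (Set.range ev))]
    have : (Submodule.span ℝ (Set.range ev)).dualCoannihilator = ⊥ := by
      refine (Submodule.eq_bot_iff _).2 fun f hf => Subtype.ext (funext fun x => ?_)
      exact (Submodule.mem_dualCoannihilator _).1 hf (ev x) (Submodule.subset_span ⟨x, rfl⟩)
    rw [this, Submodule.dualAnnihilator_bot]
  let b := finBasis ℝ V
  have hc (m : Fin (finrank ℝ V)) : ∃ c : X →₀ ℝ, (c.sum fun x r => r • ev x) = b.coord m :=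
    Finsupp.mem_span_range_iff_exists_finsupp.1 (hspan ▸ Submodule.mem_top)
  choose c hc using hc
  refine ⟨Finset.univ.biUnion fun m => (c m).support, fun a => ∑ m, c m a • (b m : X → ℝ),
    fun a => V.sum_mem fun m _ => V.smul_mem _ (b m).2, fun f hf y => ?_⟩
  have h1 : f y = ∑ m, b.coord m ⟨f, hf⟩ * (b m : X → ℝ) y := by
    have h2 := congrArg (fun g : V => (g : X → ℝ) y) (b.sum_repr ⟨f, hf⟩)
    simp only [Submodule.coe_sum, Finset.sum_apply, Submodule.coe_smul, Pi.smul_apply,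
      smul_eq_mul] at h2
    exact h2.symm
  have h3 (m : Fin (finrank ℝ V)) : b.coord m ⟨f, hf⟩
      = ∑ a ∈ Finset.univ.biUnion fun m => (c m).support, f a * c m a := by
    rw [← hc m, Finsupp.sum, LinearMap.sum_apply]
    refine (Finset.sum_subset (Finset.subset_biUnion_of_mem (fun m => (c m).support)
      (Finset.mem_univ m)) fun a _ ha => ?_).trans (Finset.sum_congr rfl fun a _ => ?_)
    · rw [Finsupp.notMem_support_iff.1 ha, zero_smul]
      rfl
    · exact mul_comm _ _
  rw [h1]
  simp_rw [h3, Finset.sum_mul, Finset.sum_apply, Pi.smul_apply, smul_eq_mul, Finset.mul_sum]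
  rw [Finset.sum_comm]
  exact Finset.sum_congr rfl fun a _ => Finset.sum_congr rfl fun m _ => by ring

/-- A continuously differentiable function is uniformly Lipschitz at the points of a compact set. -/
theorem exists_lipschitz_near_compact {A : Type*} [NormedAddCommGroup A] [NormedSpace ℝ A]
    [FiniteDimensional ℝ A] {f : A → ℝ} {U S : Set A} (hU : IsOpen U) (hf : ContDiffOn ℝ 1 f U)
    (hS : IsCompact S) (hSU : S ⊆ U) :
    ∃ δ > 0, ∃ L, 0 ≤ L ∧ ∀ b ∈ S, ∀ a, ‖a - b‖ ≤ δ → ‖f a - f b‖ ≤ L * ‖a - b‖ := by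
  have : ProperSpace A := FiniteDimensional.proper ℝ A
  obtain ⟨δ, hδ, hsub⟩ := hS.exists_cthickening_subset_open hU hSU
  obtain ⟨L, hL⟩ := hS.cthickening.exists_bound_of_continuousOn
    ((hf.continuousOn_fderiv_of_isOpen hU le_rfl).mono hsub)
  refine ⟨δ, hδ, max L 0, le_max_right _ _, fun b hb a hab => ?_⟩
  have hball : Metric.closedBall b δ ⊆ Metric.cthickening δ S :=
    Metric.closedBall_subset_cthickening hb δ
  refine (convex_closedBall b δ).norm_image_sub_le_of_norm_fderiv_le (𝕜 := ℝ)
    (fun x hx => differentiableAt_of_contDiffOn hf hU (hsub (hball hx)))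
    (fun x hx => (hL x (hball hx)).trans (le_max_left _ _)) (Metric.mem_closedBall_self hδ.le) ?_
  rwa [Metric.mem_closedBall, dist_eq_norm]

namespace Mesh

variable {d : ℕ} {Ω : Set (E d)} {ιK ιF : Type*} {M : Mesh d Ω ιK ιF} {k : ℕ}

/-- The nodes and shape functions do not depend on w. Differentiability in time at finitely many
nodes therefore controls v_h uniformly on the element. -/
theorem exists_interpolation_Vspace (M : Mesh d Ω ιK ιF) (k : ℕ) (K : ιK) :
    ∃ (T : Finset (M.elem K)) (φ : M.elem K → E d → ℝ), (∀ a, Continuous (φ a)) ∧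
      ∀ w ∈ M.Vspace k, ∀ x ∈ M.elem K, w K x = ∑ a ∈ T, φ a x • w K a := by
  let ℓ : MvPolynomial.restrictTotalDegree (Fin d) ℝ k →ₗ[ℝ] (M.elem K → ℝ) :=
    { toFun := fun P x => polyFun (P : MvPolynomial (Fin d) ℝ) (M.pull K x)
      map_add' := fun P Q => by ext x; simp [polyFun]
      map_smul' := fun c P => by ext x; simp [polyFun] }
  obtain ⟨T, φ, hφ, hT⟩ := exists_interpolation (LinearMap.range ℓ)
  choose P hP using hφ
  refine ⟨T, fun a x => polyFun (P a : MvPolynomial (Fin d) ℝ) (M.pull K x),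
    fun a => (contDiff_poly_pull K _).continuous, fun w hw x hx => funext fun i => ?_⟩
  obtain ⟨Q, hQ, hQw⟩ := hw K i
  have h := hT (fun x => w K x i) ⟨⟨Q, (MvPolynomial.mem_restrictTotalDegree _ _ _).2 hQ⟩,
    funext fun y => (poly_eq_on_elem (f := fun x => w K x i) hQw y.2).symm⟩ ⟨x, hx⟩
  simp only at h
  rw [h, Finset.sum_apply]
  refine Finset.sum_congr rfl fun a _ => ?_
  rw [Pi.smul_apply, smul_eq_mul, mul_comm, ← hP]
  rfl

/-- Differentiation under the integral: interpolation bounds v(s) - v(t) by C |s - t| uniformly in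
space, and the entropy is Lipschitz at the points of the compact set v(t)(K). -/
theorem hasDerivAt_integral_entropy {g : Gas d} {v : ℝ → VField ιK d} {t : ℝ} (K : ιK)
    (hv : ∀ᶠ s in 𝓝 t, v s ∈ M.Vspace k)
    (hphys : ∀ᶠ s in 𝓝 t, ∀ x ∈ M.elem K, v s K x ∈ physicalV g)
    (hd : ∀ x ∈ M.elem K, DifferentiableAt ℝ (fun s => v s K x) t) :
    IntegrableOn (fun x => deriv (fun s => consVars g (v s K x)) t ⬝ᵥ v t K x) (M.elem K) ∧
    HasDerivAt (fun s => ∫ x in M.elem K, entropy g (consVars g (v s K x)))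
      (∫ x in M.elem K, deriv (fun s => consVars g (v s K x)) t ⬝ᵥ v t K x) t := by
  obtain ⟨T, φ, hφ, hT⟩ := M.exists_interpolation_Vspace k K
  have hvt := hv.self_of_nhds
  have hphyst := hphys.self_of_nhds
  have hKm := M.measurableSet_elem K
  set D : E d → ℝ := fun x => deriv (fun s => consVars g (v s K x)) t ⬝ᵥ v t K x with hD
  have hder (x : E d) (hx : x ∈ M.elem K) :
      HasDerivAt (fun s => entropy g (consVars g (v s K x))) (D x) t :=
    hasDerivAt_entropy (hphyst x hx) (hd x hx)
  have hvc : ContinuousOn (v t K) (M.elem K) := continuousOn_of_mem_Vspace hvt K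
  -- the time derivative of the entropy is continuous in space
  have hDc : ContinuousOn D (M.elem K) := by
    have hdot (x : E d) (hx : x ∈ M.elem K) : HasDerivAt (fun s => v s K x)
        (∑ a ∈ T, φ a x • deriv (fun s => v s K a) t) t := by
      have h1 : HasDerivAt (fun s => ∑ a ∈ T, φ a x • v s K a)
          (∑ a ∈ T, φ a x • deriv (fun s => v s K a) t) t :=
        HasDerivAt.fun_sum fun a _ => (hd a a.2).hasDerivAt.const_smul (φ a x)
      exact h1.congr_of_eventuallyEq (hv.mono fun s hs => hT _ hs x hx)
    have hval (x : E d) (hx : x ∈ M.elem K) : D x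
        = fderiv ℝ (fun w => entropy g (consVars g w)) (v t K x)
          (∑ a ∈ T, φ a x • deriv (fun s => v s K a) t) := by
      have h := (differentiableAt_of_contDiffOn (contDiffOn_entropy (g := g))
        isOpen_physicalV (hphyst x hx)).hasFDerivAt
      exact (hder x hx).unique (HasFDerivAt.comp_hasDerivAt
        (l := fun w => entropy g (consVars g w)) (f := fun s => v s K x) t h (hdot x hx))
    refine ContinuousOn.congr ?_ hval
    refine ContinuousOn.clm_apply ?_ ?_
    · exact (contDiffOn_entropy.continuousOn_fderiv_of_isOpen isOpen_physicalV le_rfl).comp hvc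
        hphyst
    · exact (continuous_finsetSum _ fun a _ => (hφ a).smul continuous_const).continuousOn
  have hDi : IntegrableOn D (M.elem K) := integrableOn_elem hDc
  refine ⟨hDi, ?_⟩
  -- the solution is Lipschitz in time at `t`, uniformly in space
  have hlip : ∃ C, 0 ≤ C ∧ ∀ᶠ s in 𝓝 t, ∀ x ∈ M.elem K, ‖v s K x - v t K x‖ ≤ C * ‖s - t‖ := by
    have h1 (a : M.elem K) : ∃ c, 0 < c ∧ ∀ᶠ s in 𝓝 t, ‖v s K a - v t K a‖ ≤ c * ‖s - t‖ := by
      obtain ⟨c, hc, h⟩ := (hd a a.2).isBigO_sub.exists_pos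
      exact ⟨c, hc, h.bound⟩
    have h2 (a : M.elem K) : ∃ m, ∀ x ∈ M.elem K, ‖φ a x‖ ≤ m :=
      (M.isCompact_elem K).exists_bound_of_continuousOn (hφ a).continuousOn
    choose c hc hcb using h1
    choose m hm using h2
    have hm0 (a : M.elem K) : 0 ≤ m a := (norm_nonneg _).trans (hm a a a.2)
    refine ⟨∑ a ∈ T, m a * c a, Finset.sum_nonneg fun a _ => mul_nonneg (hm0 a) (hc a).le, ?_⟩
    have h3 : ∀ᶠ s in 𝓝 t, ∀ a ∈ T, ‖v s K a - v t K a‖ ≤ c a * ‖s - t‖ :=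
      (Finset.eventually_all T).2 fun a _ => hcb a
    filter_upwards [hv, h3] with s hs hs3 x hx
    rw [hT _ hs x hx, hT _ hvt x hx, ← Finset.sum_sub_distrib, Finset.sum_mul]
    refine norm_sum_le_of_le _ fun a ha => ?_
    rw [← smul_sub, norm_smul, mul_assoc]
    exact mul_le_mul (hm a x hx) (hs3 a ha) (norm_nonneg _) (hm0 a)
  obtain ⟨C, hC, hlip⟩ := hlip
  obtain ⟨δ, hδ, L, hL, hη⟩ := exists_lipschitz_near_compact isOpen_physicalV
    (contDiffOn_entropy (g := g)) ((M.isCompact_elem K).image_of_continuousOn hvc)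
    (by rintro _ ⟨x, hx, rfl⟩; exact hphyst x hx)
  have hsmall : ∀ᶠ s in 𝓝 t, C * ‖s - t‖ ≤ δ := by
    have h1 : Tendsto (fun s : ℝ => C * ‖s - t‖) (𝓝 t) (𝓝 (C * ‖t - t‖)) :=
      Continuous.tendsto (by fun_prop) t
    rw [sub_self, norm_zero, mul_zero] at h1
    exact h1.eventually (eventually_le_nhds hδ)
  have hcont {s : ℝ} (hs : v s ∈ M.Vspace k) (hs2 : ∀ x ∈ M.elem K, v s K x ∈ physicalV g) :
      ContinuousOn (fun x => entropy g (consVars g (v s K x))) (M.elem K) :=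
    contDiffOn_entropy.continuousOn.comp (continuousOn_of_mem_Vspace hs K) hs2
  -- This version asks for a Lipschitz bound relative to the base point t only, in accordance with
  -- differentiability known just at t.
  have key := hasFDerivAt_integral_of_dominated_loc_of_lip' (𝕜 := ℝ)
    (μ := volume.restrict (M.elem K)) (x₀ := t)
    (F := fun s x => entropy g (consVars g (v s K x)))
    (F' := fun x => D x • ContinuousLinearMap.id ℝ ℝ) (bound := fun _ => L * C)
    (hv.and (hphys.and (hlip.and hsmall)))
    (fun s hs => (hcont hs.1 hs.2.1).aestronglyMeasurable hKm)
    (integrableOn_elem (hcont hvt hphyst))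
    ((hDc.smul continuousOn_const).aestronglyMeasurable hKm) ?_ ?_ ?_
  · have h := key.2.hasDerivAt
    rw [integral_smul_const] at h
    simpa using h
  · refine ae_restrict_of_forall_mem hKm fun x hx s hs => ?_
    have h1 := hs.2.2.1 x hx
    refine (hη _ ⟨x, hx, rfl⟩ _ (h1.trans hs.2.2.2)).trans ?_
    rw [mul_assoc]
    exact mul_le_mul_of_nonneg_left h1 hL
  · exact integrableOn_const (M.isCompact_elem K).measure_lt_top.ne
  · refine ae_restrict_of_forall_mem hKm fun x hx => ?_
    have h := (hder x hx).hasFDerivAt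
    exact h.congr_fderiv (by ext; simp)

end Mesh

end HDG

/-! ### The entropy balance of the scheme. -/

namespace HDG

open Filter Topology Module

/-- By `dotProduct_Sig` the central flux contributes the jump of the potential minus half the Σ
form; the stabilization adds half the σ form. -/
theorem numFlux_dotProduct {d : ℕ} {g : Gas d}
    (σ : State d → State d → E d → Matrix (Idx d) (Idx d) ℝ) (n : E d) {v w : State d}
    (hv : v ∈ physicalV g) (hw : w ∈ physicalV g) :
    numFlux g σ n v w ⬝ᵥ (w - v) - ∑ j, fluxPotential g j w * n j
      = 1 / 2 * ((w - v) ⬝ᵥ Matrix.mulVec (σ v w n - Sig g v w n) (w - v))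
        - ∑ j, fluxPotential g j v * n j := by
  rw [Matrix.sub_mulVec, dotProduct_sub (w - v), dotProduct_Sig n hv hw, numFlux, add_dotProduct,
    smul_dotProduct, smul_dotProduct, smul_eq_mul, smul_eq_mul,
    dotProduct_comm (Matrix.mulVec _ _) (w - v)]
  ring

theorem continuousOn_dotProduct {X ι : Type*} [TopologicalSpace X] [Fintype ι] {s : Set X}
    {a b : X → ι → ℝ} (ha : ContinuousOn a s) (hb : ContinuousOn b s) :
    ContinuousOn (fun x => a x ⬝ᵥ b x) s :=
  continuousOn_finsetSum _ fun i _ => (continuousOn_pi.1 ha i).mul (continuousOn_pi.1 hb i)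

namespace Mesh

variable {d : ℕ} {Ω : Set (E d)} {ιK ιF : Type*} {M : Mesh d Ω ιK ιF} {k : ℕ}

theorem integrableOn_face_dotProduct {F : ιF} {a b : E d → State d}
    (ha : ∀ i, IntegrableOn (fun x => a x i) (M.face F) μHE[d - 1])
    (hb : ContinuousOn b (M.face F)) :
    IntegrableOn (fun x => a x ⬝ᵥ b x) (M.face F) μHE[d - 1] :=
  integrable_finsetSum _ fun i _ =>
    (ha i).mul_continuousOn (continuousOn_pi.1 hb i) (M.isCompact_face F)

section Sums

variable [Fintype ιK] [Fintype ιF]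

theorem bdry_const_mul (c : ℝ) (f : ιK → ιF → E d → ℝ) :
    M.bdry (fun K F x => c * f K F x) = c * M.bdry f := by
  simp only [bdry, Finset.mul_sum]
  exact Finset.sum_congr rfl fun K _ => Finset.sum_congr rfl fun F _ => integral_const_mul _ _

/-- Linearity of the face integrals, in the shape needed by `entropy_jump_balance`. -/
theorem bdry_eq_of_forall_eq {a₁ a₂ b₁ b₂ b₃ b₄ b₅ b₆ : ιK → ιF → E d → ℝ}
    (ha₁ : ∀ K F, M.face F ⊆ frontier (M.elem K) → IntegrableOn (a₁ K F) (M.face F) μHE[d - 1])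
    (ha₂ : ∀ K F, M.face F ⊆ frontier (M.elem K) → IntegrableOn (a₂ K F) (M.face F) μHE[d - 1])
    (hb₁ : ∀ K F, M.face F ⊆ frontier (M.elem K) → IntegrableOn (b₁ K F) (M.face F) μHE[d - 1])
    (hb₂ : ∀ K F, M.face F ⊆ frontier (M.elem K) → IntegrableOn (b₂ K F) (M.face F) μHE[d - 1])
    (hb₃ : ∀ K F, M.face F ⊆ frontier (M.elem K) → IntegrableOn (b₃ K F) (M.face F) μHE[d - 1])
    (hb₄ : ∀ K F, M.face F ⊆ frontier (M.elem K) → IntegrableOn (b₄ K F) (M.face F) μHE[d - 1])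
    (hb₅ : ∀ K F, M.face F ⊆ frontier (M.elem K) → IntegrableOn (b₅ K F) (M.face F) μHE[d - 1])
    (hb₆ : ∀ K F, M.face F ⊆ frontier (M.elem K) → IntegrableOn (b₆ K F) (M.face F) μHE[d - 1])
    (H : ∀ K F, M.face F ⊆ frontier (M.elem K) → ∀ x ∈ M.face F, a₁ K F x + a₂ K F x
      = b₁ K F x - b₂ K F x - b₃ K F x + b₄ K F x - (b₅ K F x - b₆ K F x)) :
    M.bdry a₁ + M.bdry a₂ = M.bdry b₁ - M.bdry b₂ - M.bdry b₃ + M.bdry b₄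
      - (M.bdry b₅ - M.bdry b₆) := by
  classical
  simp only [bdry, ← Finset.sum_add_distrib, ← Finset.sum_sub_distrib]
  refine Finset.sum_congr rfl fun K _ => Finset.sum_congr rfl fun F hF => ?_
  have hF := (Finset.mem_filter.1 hF).2
  simp only [faceInt]
  rw [← integral_add' (ha₁ K F hF) (ha₂ K F hF), ← integral_sub' (hb₁ K F hF) (hb₂ K F hF),
    ← integral_sub' ((hb₁ K F hF).sub (hb₂ K F hF)) (hb₃ K F hF),
    ← integral_add' (((hb₁ K F hF).sub (hb₂ K F hF)).sub (hb₃ K F hF)) (hb₄ K F hF),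
    ← integral_sub' (hb₅ K F hF) (hb₆ K F hF),
    ← integral_sub' ((((hb₁ K F hF).sub (hb₂ K F hF)).sub (hb₃ K F hF)).add (hb₄ K F hF))
      ((hb₅ K F hF).sub (hb₆ K F hF))]
  exact setIntegral_congr_fun (M.measurableSet_face F) (H K F hF)

theorem bdryDomain_sub {f h : ιK → ιF → E d → ℝ}
    (hf : ∀ K F, M.face F ⊆ frontier (M.elem K) → M.face F ⊆ frontier Ω →
      IntegrableOn (f K F) (M.face F) μHE[d - 1])
    (hh : ∀ K F, M.face F ⊆ frontier (M.elem K) → M.face F ⊆ frontier Ω →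
      IntegrableOn (h K F) (M.face F) μHE[d - 1]) :
    M.bdryDomain (fun K F x => f K F x - h K F x) = M.bdryDomain f - M.bdryDomain h := by
  classical
  simp only [bdryDomain, ← Finset.sum_sub_distrib]
  refine Finset.sum_congr rfl fun K _ => Finset.sum_congr rfl fun F hF => ?_
  have hF := (Finset.mem_filter.1 hF).2
  exact integral_sub (hf K F hF.1 hF.2) (hh K F hF.1 hF.2)

theorem bdryDomain_congr {f h : ιK → ιF → E d → ℝ} (H : ∀ K F, M.face F ⊆ frontier (M.elem K) →
    ∀ x ∈ M.face F, f K F x = h K F x) : M.bdryDomain f = M.bdryDomain h := by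
  classical
  refine Finset.sum_congr rfl fun K _ => Finset.sum_congr rfl fun F hF => ?_
  exact setIntegral_congr_fun (M.measurableSet_face F) (H K F (Finset.mem_filter.1 hF).2.1)

theorem bdry_eq_interior_add_domain (f : ιK → ιF → E d → ℝ) :
    M.bdry f = M.bdryInterior f + M.bdryDomain f := by
  classical
  simp only [bdry, bdryInterior, bdryDomain, ← Finset.sum_add_distrib]
  refine Finset.sum_congr rfl fun K _ => ?_
  rw [← Finset.sum_filter_add_sum_filter_not _ (fun F => M.face F ⊆ frontier Ω),
    Finset.filter_filter, Finset.filter_filter, add_comm]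

/-- The normal component of a single-valued vector field has no total flux through the interior
faces. -/
theorem bdryInterior_eq_zero (hd : 1 ≤ d) (ψ : ιF → E d → Fin d → ℝ) :
    M.bdryInterior (fun K F x => ∑ j, ψ F x j * M.normal K F j) = 0 := by
  classical
  rw [bdryInterior]
  simp_rw [Finset.sum_filter]
  rw [Finset.sum_comm]
  refine Finset.sum_eq_zero fun F _ => ?_
  by_cases hF : M.face F ⊆ frontier Ω
  · exact Finset.sum_eq_zero fun K _ => if_neg fun h => h.2 hF
  obtain ⟨K₁, K₂, hne, hface, honly⟩ := M.interior_face F hF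
  have h1 : M.face F ⊆ frontier (M.elem K₁) := hface ▸ Set.inter_subset_left
  have h2 : M.face F ⊆ frontier (M.elem K₂) := hface ▸ Set.inter_subset_right
  rw [Finset.sum_eq_add K₁ K₂ hne (fun K _ hK => if_neg fun h =>
    (honly K h.1).elim hK.1 hK.2) (fun h => absurd (Finset.mem_univ _) h)
    (fun h => absurd (Finset.mem_univ _) h), if_pos ⟨h1, hF⟩, if_pos ⟨h2, hF⟩, faceInt, faceInt,
    normal_eq_neg_of_ne hd hne h1 h2]
  simp only [PiLp.neg_apply, mul_neg, Finset.sum_neg_distrib, integral_neg, add_neg_cancel]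

end Sums

section Volume

variable [Fintype ιK] {g : Gas d} {w : VField ιK d} {q : QField ιK d}

theorem innerQ_congr_right {A B C : QField ιK d} (h : ∀ K, ∀ᵐ x ∂volume.restrict (M.elem K),
    B K x = C K x) : M.innerQ A B = M.innerQ A C :=
  vol_congr_ae fun K => (h K).mono fun x hx => by rw [hx]

/-- `gradF w` itself need not be polynomial on the boundary of an element, where `fderiv` sees
values outside; almost everywhere it agrees with a member of 𝒬_h^k. -/
theorem exists_gradF_eq (hw : w ∈ M.Vspace k) :
    ∃ r ∈ M.Qspace k, ∀ A : QField ιK d, M.innerQ A (gradF w) = M.innerQ A r := by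
  obtain ⟨W, hW, hwW, hr⟩ := exists_extension_of_mem_Vspace hw
  refine ⟨gradF W, hr, fun A => innerQ_congr_right fun K => ?_⟩
  have h : ∀ᵐ x ∂volume.restrict (M.elem K), ∀ i,
      fderiv ℝ (fun y => w K y i) x = fderiv ℝ (fun y => W K y i) x := by
    simp_rw [ae_all_iff]
    exact fun i => ae_fderiv_eq fun x hx => by rw [hwW K x hx]
  filter_upwards [h] with x hx
  ext i j
  simp only [gradF, hx]

theorem viscDissipation_eq (v : VField ιK d) (q : QField ιK d) :
    viscDissipation g M q v = -M.innerQ q fun K x => viscFluxV g (v K x) (q K x) := by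
  rw [viscDissipation, innerQ, ← neg_one_mul, ← vol_smul]
  congr 1
  ext K x
  rw [Ktilde_form]
  simp only [mul_neg, Finset.sum_neg_distrib, neg_mul, one_mul]

theorem innerQ_add_gradF {A B : QField ιK d} (hA : ∀ K, ContinuousOn (A K) (M.elem K))
    (hB : ∀ K, ContinuousOn (B K) (M.elem K)) (hw : w ∈ M.Vspace k) :
    M.innerQ (fun K x => A K x + B K x) (gradF w)
      = M.innerQ A (gradF w) + M.innerQ B (gradF w) := by
  obtain ⟨r, hr, h⟩ := exists_gradF_eq hw
  rw [h, h, h, innerQ_comm, innerQ_add_right (continuousOn_of_mem_Qspace hr) hA hB, innerQ_comm,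
    innerQ_comm r]

theorem innerQ_projQ_gradF {A : QField ιK d} (hA : ∀ K, ContinuousOn (A K) (M.elem K))
    (hw : w ∈ M.Vspace k) : M.innerQ (M.projQ k A) (gradF w) = M.innerQ A (gradF w) := by
  obtain ⟨r, hr, h⟩ := exists_gradF_eq hw
  rw [h, h, (projQ_spec hA).2 r hr]

end Volume

end Mesh

open Mesh

variable {d : ℕ} {Ω : Set (E d)} {ιK ιF : Type*} [Fintype ιK] [Fintype ιF] {g : Gas d}
  {M : Mesh d Ω ιK ιF} {S : Scheme d ιK ιF} {k : ℕ} {tf : ℝ} {q : ℝ → QField ιK d}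
  {v : ℝ → VField ιK d} {vh : ℝ → MField ιF d} {t : ℝ}

omit [Fintype ιK] [Fintype ιF] in
theorem continuousOn_viscFluxV_elem {v : VField ιK d} {q : QField ιK d} (hv : v ∈ M.Vspace k)
    (hq : q ∈ M.Qspace k) (hphys : ∀ K, ∀ x ∈ M.elem K, v K x ∈ physicalV g) (K : ιK) :
    ContinuousOn (fun x => viscFluxV g (v K x) (q K x)) (M.elem K) :=
  continuousOn_pi.2 fun i => continuousOn_pi.2 fun j =>
    continuousOn_viscFluxV (continuousOn_of_mem_Vspace hv K) (continuousOn_of_mem_Qspace hq K)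
      (hphys K) i j

theorem hasDerivAt_totalEntropy (hsol : IsSolution g M S k tf q v vh)
    (hphys : IsPhysical g M tf v vh) (ht : t ∈ Set.Ioo 0 tf) :
    HasDerivAt (fun s => totalEntropy g M (v s))
      (M.vol fun K x => deriv (fun s => consVars g (v s K x)) t ⬝ᵥ v t K x) t := by
  have hnhds : ∀ᶠ s in 𝓝 t, s ∈ Set.Ioo 0 tf := Ioo_mem_nhds ht.1 ht.2
  exact HasDerivAt.fun_sum fun K _ => (hasDerivAt_integral_entropy K
    (hnhds.mono fun s hs => hsol.v_mem s hs) (hnhds.mono fun s hs => (hphys s hs).1 K)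
    fun x hx => hsol.differentiable_time t ht K x hx).2

/-- The scheme tested with the entropy variables. -/
theorem entropy_volume_balance (hsol : IsSolution g M S k tf q v vh)
    (hphys : IsPhysical g M tf v vh) (ht : t ∈ Set.Ioo 0 tf) {R : QField ιK d}
    (hR : R = M.projQ k fun K x => viscFluxV g (v t K x) (q t K x)) :
    R ∈ M.Qspace k ∧
    (M.vol fun K x => deriv (fun s => consVars g (v s K x)) t ⬝ᵥ v t K x)
      + viscDissipation g M (q t) (v t)
      - M.bdry (fun K F x => ∑ j, fluxPotential g j (v t K x) * M.normal K F j)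
      - (M.bdry (fun K F x => v t K x ⬝ᵥ dotN (R K x) (M.normal K F))
        - M.bdry (fun K F x => vh t F x ⬝ᵥ dotN (R K x) (M.normal K F)))
      + M.bdry (fun K F x => (fhat g M S (v t) (vh t) K F x
        + S.ghat (q t) (v t) (vh t) K F x) ⬝ᵥ v t K x) = 0 := by
  have hv := hsol.v_mem t ht
  have hq := hsol.q_mem t ht
  have hpv := (hphys t ht).1
  have hG := continuousOn_viscFluxV_elem hv hq hpv
  have hF (K : ιK) : ContinuousOn (fun x => invFlux g (consVars g (v t K x))) (M.elem K) :=
    continuousOn_pi.2 fun i => continuousOn_pi.2 fun j =>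
      (contDiffOn_invFlux_consVars i j).continuousOn.comp (continuousOn_of_mem_Vspace hv K) (hpv K)
  obtain ⟨hRQ, hRs⟩ := projQ_spec (k := k) hG
  have hRg := innerQ_projQ_gradF (M := M) hG hv
  rw [← hR] at hRQ hRs hRg
  refine ⟨hRQ, ?_⟩
  -- With r = ΠG, Green's formula turns the gradient equation into (ΠG, ∇v) = (q, ΠG) + ⟨v - v̂, ΠG
  -- · n⟩.
  have h1 := hsol.gradient_eq t ht R hRQ
  have h2 := green_poly hv hRQ
  have h3 := hsol.conservation_eq t ht _ hv
  rw [innerQ_add_gradF hF hG hv, green_flux hv hpv] at h3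
  -- (q, ΠG) = (q, G), since q_h belongs to 𝒬_h^k.
  rw [viscDissipation_eq, innerQ_comm, ← hRs _ hq, innerQ_comm]
  linarith

/-- The entropy balance on the skeleton. -/
theorem entropy_face_balance (hd : 1 ≤ d) (hsol : IsSolution g M S k tf q v vh)
    (hphys : IsPhysical g M tf v vh) (hint : FluxesIntegrable g M S tf q v vh)
    (ht : t ∈ Set.Ioo 0 tf) :
    M.bdry (fun K F x => (fhat g M S (v t) (vh t) K F x
        + S.ghat (q t) (v t) (vh t) K F x) ⬝ᵥ vh t F x)
      - M.bdry (fun K F x => ∑ j, fluxPotential g j (vh t F x) * M.normal K F j)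
      = boundaryTerm g M S (q t) (v t) (vh t) (S.vbd t) := by
  have hvh := continuousOn_of_mem_Mspace (hsol.vh_mem t ht)
  have hpvh := (hphys t ht).2
  have hN (K : ιK) (F : ιF) : ContinuousOn
      (fun x => invFluxN g (M.normal K F) (vh t F x)) (M.face F) :=
    (contDiffOn_invFluxN _).continuousOn.comp (hvh F) (hpvh F)
  have hψ (K : ιK) (F : ιF) : ContinuousOn
      (fun x => ∑ j, fluxPotential g j (vh t F x) * M.normal K F j) (M.face F) :=
    continuousOn_finsetSum _ fun j _ =>
      ((contDiffOn_fluxPotential j).continuousOn.comp (hvh F) (hpvh F)).mul continuousOn_const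
  -- The trace v̂_h is its own test function.
  have h1 := hsol.flux_eq t ht _ (hsol.vh_mem t ht)
  have h2 : M.bdryDomain (fun K F x => entropyFluxN g (M.normal K F) (vh t F x))
      = M.bdryDomain (fun K F x => vh t F x ⬝ᵥ invFluxN g (M.normal K F) (vh t F x))
        - M.bdryDomain fun K F x => ∑ j, fluxPotential g j (vh t F x) * M.normal K F j := by
    rw [← bdryDomain_sub]
    · refine bdryDomain_congr fun K F _ x hx => ?_
      rw [← fluxPotentialN_eq _ (hpvh F x hx)]
      ring
    · exact fun K F hF _ => integrableOn_face hF (continuousOn_dotProduct (hvh F) (hN K F))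
    · exact fun K F hF _ => integrableOn_face hF (hψ K F)
  have h3 : M.bdryDomain (fun K F x => vh t F x ⬝ᵥ (fhat g M S (v t) (vh t) K F x
        + S.ghat (q t) (v t) (vh t) K F x - S.bhat (vh t) (v t) (q t) (S.vbd t) F x))
      = M.bdryDomain (fun K F x => (fhat g M S (v t) (vh t) K F x
        + S.ghat (q t) (v t) (vh t) K F x) ⬝ᵥ vh t F x)
        - M.bdryDomain fun _ F x => S.bhat (vh t) (v t) (q t) (S.vbd t) F x ⬝ᵥ vh t F x := by
    rw [← bdryDomain_sub]
    · refine bdryDomain_congr fun K F _ x _ => ?_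
      rw [dotProduct_sub, dotProduct_comm (vh t F x), dotProduct_comm (vh t F x)]
    · exact fun K F hF _ => integrableOn_face_dotProduct
        (fun i => ((hint t ht i).1 K F hF).1.add ((hint t ht i).1 K F hF).2) (hvh F)
    · exact fun K F _ hF => integrableOn_face_dotProduct (fun i => (hint t ht i).2 F hF) (hvh F)
  rw [boundaryTerm, h2, h3, bdry_eq_interior_add_domain, bdry_eq_interior_add_domain,
    bdryInterior_eq_zero hd fun F x j => fluxPotential g j (vh t F x)]
  linarith

/-- The contribution of the jumps across the faces. -/
theorem entropy_jump_balance (hsol : IsSolution g M S k tf q v vh)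
    (hphys : IsPhysical g M tf v vh) (hint : FluxesIntegrable g M S tf q v vh)
    (ht : t ∈ Set.Ioo 0 tf) (hRQ : M.projQ k (fun K x => viscFluxV g (v t K x) (q t K x))
      ∈ M.Qspace k) :
    1 / 2 * jumpTerm g M S (v t) (vh t) + viscFaceTerm g M S k (q t) (v t) (vh t)
      = M.bdry (fun K F x => (fhat g M S (v t) (vh t) K F x
          + S.ghat (q t) (v t) (vh t) K F x) ⬝ᵥ v t K x)
        - M.bdry (fun K F x => (fhat g M S (v t) (vh t) K F x
          + S.ghat (q t) (v t) (vh t) K F x) ⬝ᵥ vh t F x)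
        - M.bdry (fun K F x => ∑ j, fluxPotential g j (v t K x) * M.normal K F j)
        + M.bdry (fun K F x => ∑ j, fluxPotential g j (vh t F x) * M.normal K F j)
        - (M.bdry (fun K F x => v t K x ⬝ᵥ dotN (M.projQ k (fun K x => viscFluxV g (v t K x)
            (q t K x)) K x) (M.normal K F))
          - M.bdry (fun K F x => vh t F x ⬝ᵥ dotN (M.projQ k (fun K x => viscFluxV g (v t K x)
            (q t K x)) K x) (M.normal K F))) := by
  rw [jumpTerm, viscFaceTerm]
  set R := M.projQ k fun K x => viscFluxV g (v t K x) (q t K x)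
  have hpv := (hphys t ht).1
  have hpvh := (hphys t ht).2
  have hvh := continuousOn_of_mem_Mspace (hsol.vh_mem t ht)
  have hvF (K : ιK) (F : ιF) (hF : M.face F ⊆ frontier (M.elem K)) :
      ContinuousOn (v t K) (M.face F) :=
    (continuousOn_of_mem_Vspace (hsol.v_mem t ht) K).mono (M.face_subset_elem hF)
  have hRn (K : ιK) (F : ιF) (hF : M.face F ⊆ frontier (M.elem K)) :
      ContinuousOn (fun x => dotN (R K x) (M.normal K F)) (M.face F) :=
    continuousOn_pi.2 fun i => continuousOn_finsetSum _ fun j _ =>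
      (continuousOn_pi.1 (continuousOn_pi.1 ((continuousOn_of_mem_Qspace hRQ K).mono
        (M.face_subset_elem hF)) i) j).mul continuousOn_const
  have hfg (K : ιK) (F : ιF) (hF : M.face F ⊆ frontier (M.elem K)) (i : Idx d) :=
    ((hint t ht i).1 K F hF).1.add ((hint t ht i).1 K F hF).2
  have i1 (K : ιK) (F : ιF) (hF : M.face F ⊆ frontier (M.elem K)) :
      IntegrableOn (fun x => (fhat g M S (v t) (vh t) K F x
        + S.ghat (q t) (v t) (vh t) K F x) ⬝ᵥ v t K x) (M.face F) μHE[d - 1] :=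
    integrableOn_face_dotProduct (hfg K F hF) (hvF K F hF)
  have i2 (K : ιK) (F : ιF) (hF : M.face F ⊆ frontier (M.elem K)) :
      IntegrableOn (fun x => (fhat g M S (v t) (vh t) K F x
        + S.ghat (q t) (v t) (vh t) K F x) ⬝ᵥ vh t F x) (M.face F) μHE[d - 1] :=
    integrableOn_face_dotProduct (hfg K F hF) (hvh F)
  have i3 (K : ιK) (F : ιF) (hF : M.face F ⊆ frontier (M.elem K)) :
      IntegrableOn (fun x => ∑ j, fluxPotential g j (v t K x) * M.normal K F j) (M.face F)
        μHE[d - 1] :=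
    integrableOn_face hF (continuousOn_finsetSum _ fun j _ =>
      ((contDiffOn_fluxPotential j).continuousOn.comp (hvF K F hF)
        fun x hx => hpv K x (M.face_subset_elem hF hx)).mul continuousOn_const)
  have i4 (K : ιK) (F : ιF) (hF : M.face F ⊆ frontier (M.elem K)) :
      IntegrableOn (fun x => ∑ j, fluxPotential g j (vh t F x) * M.normal K F j) (M.face F)
        μHE[d - 1] :=
    integrableOn_face hF (continuousOn_finsetSum _ fun j _ =>
      ((contDiffOn_fluxPotential j).continuousOn.comp (hvh F) (hpvh F)).mul continuousOn_const)
  have i5 (K : ιK) (F : ιF) (hF : M.face F ⊆ frontier (M.elem K)) :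
      IntegrableOn (fun x => v t K x ⬝ᵥ dotN (R K x) (M.normal K F)) (M.face F) μHE[d - 1] :=
    integrableOn_face hF (continuousOn_dotProduct (hvF K F hF) (hRn K F hF))
  have i6 (K : ιK) (F : ιF) (hF : M.face F ⊆ frontier (M.elem K)) :
      IntegrableOn (fun x => vh t F x ⬝ᵥ dotN (R K x) (M.normal K F)) (M.face F) μHE[d - 1] :=
    integrableOn_face hF (continuousOn_dotProduct (hvh F) (hRn K F hF))
  have hδ (K : ιK) (F : ιF) (hF : M.face F ⊆ frontier (M.elem K)) :
      ContinuousOn (fun x => v t K x - vh t F x) (M.face F) := (hvF K F hF).sub (hvh F)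
  have hjump (K : ιK) (F : ιF) (hF : M.face F ⊆ frontier (M.elem K)) (x : E d)
      (hx : x ∈ M.face F) := numFlux_dotProduct S.σ (M.normal K F) (hpvh F x hx)
        (hpv K x (M.face_subset_elem hF hx))
  have i7 (K : ιK) (F : ιF) (hF : M.face F ⊆ frontier (M.elem K)) :
      IntegrableOn (fun x => 1 / 2 * ((v t K x - vh t F x) ⬝ᵥ Matrix.mulVec
        (S.σ (vh t F x) (v t K x) (M.normal K F) - Sig g (vh t F x) (v t K x) (M.normal K F))
        (v t K x - vh t F x))) (M.face F) μHE[d - 1] := by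
    -- σ is arbitrary, so integrability of the jump term is obtained from the identity `hjump`,
    -- whose other terms are integrable.
    have h := ((integrableOn_face_dotProduct (fun i => ((hint t ht i).1 K F hF).1)
      (hδ K F hF)).sub (i3 K F hF)).add (i4 K F hF)
    refine IntegrableOn.congr_fun h (fun x hx => ?_) (M.measurableSet_face F)
    have := hjump K F hF x hx
    simp only [Pi.add_apply, Pi.sub_apply, fhat]
    linarith
  have i8 (K : ιK) (F : ιF) (hF : M.face F ⊆ frontier (M.elem K)) :
      IntegrableOn (fun x => (v t K x - vh t F x) ⬝ᵥ (S.ghat (q t) (v t) (vh t) K F x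
        - dotN (R K x) (M.normal K F))) (M.face F) μHE[d - 1] := by
    have h := (integrableOn_face_dotProduct (fun i => ((hint t ht i).1 K F hF).2)
      (hδ K F hF)).sub (integrableOn_face hF (continuousOn_dotProduct (hδ K F hF) (hRn K F hF)))
    refine IntegrableOn.congr_fun h (fun x hx => ?_) (M.measurableSet_face F)
    simp only [Pi.sub_apply]
    rw [dotProduct_sub (v t K x - vh t F x), dotProduct_comm (S.ghat _ _ _ _ _ _)]
  rw [← bdry_const_mul]
  refine bdry_eq_of_forall_eq i7 i8 i1 i2 i3 i4 i5 i6 fun K F hF x hx => ?_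
  have h := hjump K F hF x hx
  have h1 : (v t K x - vh t F x) ⬝ᵥ (S.ghat (q t) (v t) (vh t) K F x
      - dotN (R K x) (M.normal K F)) = S.ghat (q t) (v t) (vh t) K F x ⬝ᵥ v t K x
        - S.ghat (q t) (v t) (vh t) K F x ⬝ᵥ vh t F x
        - (v t K x ⬝ᵥ dotN (R K x) (M.normal K F) - vh t F x ⬝ᵥ dotN (R K x) (M.normal K F)) := by
    rw [dotProduct_sub, sub_dotProduct, sub_dotProduct, dotProduct_comm (v t K x) (S.ghat _ _ _ _ _ _),
      dotProduct_comm (vh t F x) (S.ghat _ _ _ _ _ _)]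
  rw [dotProduct_sub] at h
  rw [h1, add_dotProduct, add_dotProduct, fhat]
  linarith

end HDG

theorem proposition2 {d : ℕ} (hd₁ : 1 ≤ d) (hd₃ : d ≤ 3) {Ω : Set (HDG.E d)} (hΩ : IsOpen Ω)
    {ιK ιF : Type*} [Fintype ιK] [Fintype ιF] (g : HDG.Gas d) (M : HDG.Mesh d Ω ιK ιF)
    (S : HDG.Scheme d ιK ιF) (k : ℕ) (tf : ℝ) (q : ℝ → HDG.QField ιK d) (v : ℝ → HDG.VField ιK d)
    (vh : ℝ → HDG.MField ιF d)
    (hsol : HDG.IsSolution g M S k tf q v vh)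
    (hphys : HDG.IsPhysical g M tf v vh)
    (hint : HDG.FluxesIntegrable g M S tf q v vh) :
    (∀ w ∈ HDG.physicalV g, (HDG.Ktilde g w).PosSemidef) ∧
    ∀ t ∈ Set.Ioo 0 tf, ∃ H' : ℝ,
      HasDerivAt (fun s => HDG.totalEntropy g M (v s)) H' t ∧
      H' + HDG.viscDissipation g M (q t) (v t)
        + 1 / 2 * HDG.jumpTerm g M S (v t) (vh t)
        + HDG.viscFaceTerm g M S k (q t) (v t) (vh t)
        + HDG.boundaryTerm g M S (q t) (v t) (vh t) (S.vbd t) = 0 := by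
  refine ⟨fun w hw => HDG.Ktilde_posSemidef hd₃ hw, fun t ht =>
    ⟨_, HDG.hasDerivAt_totalEntropy hsol hphys ht, ?_⟩⟩
  obtain ⟨hRQ, h1⟩ := HDG.entropy_volume_balance hsol hphys ht rfl
  have h2 := HDG.entropy_face_balance hd₁ hsol hphys hint ht
  have h3 := HDG.entropy_jump_balance hsol hphys hint ht hRQ
  -- In the sum, the face integrals of f̂ + ĝ against v_h and v̂_h, of both potentials and of ΠG · n
  -- cancel.
  linarith
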